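/- Let $M$ be an $n$-dimensional smooth manifold, $\mathcal TM=TM\setminus\{0\}$ its slashed tangent bundle, $J$ the vertical endomorphism and $C$ the Liouville vector field of $TM$ (locally $J=dx^i\otimes\partial/\partial y^i$, $C=y^i\,\partial/\partial y^i$). Let $S$ be a spray on $M$, that is, a smooth vector field on $\mathcal TM$ with $JS=C$ and $[C,S]=S$, and let $\Gamma=[J,S]$ be its connection, i.e. $\Gamma X=[JX,S]-J[X,S]$, $h=\frac12(I+\Gamma)$ the horizontal projector, $R=\frac12[h,h]$ the curvature and $\Phi=i_SR$ the Jacobi endomorphism (Frölicher–Nijenhuis brackets). For a smooth function $F$ put $\Omega=dd_JF$, where $d_JF(X)=(JX)F$, and consider the linear differential operator $$\mathcal P F=(\mathcal L_CF-F,\; i_\Gamma\Omega,\; i_\Phi\Omega).$$ For $m\ge 2$, the jet $j_m(F)_x$ is an $m$-th order solution of $\mathcal P$ at $x$ if the $(m-1)$-jet of $\mathcal L_CF-F$ and the $(m-2)$-jets of $i_\Gamma\Omega$ and $i_\Phi\Omega$ vanish at $x$. An eigenvector field of $\Phi$ near $x$ with eigenfunction $\lambda$ is a smooth horizontal vector field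 $X$ ($hX=X$) defined near $x$ such that $\Phi X=\lambda JX$, $\lambda$ being a smooth function. Let $x\in\mathcal TM$ and suppose that $\Phi$ has $n$ pairwise distinct eigenvalues near $x$: there are eigenvector fields $h_1,\dots,h_n$ near $x$, nonzero at $x$, with eigenfunctions $\lambda_1,\dots,\lambda_n$ pairwise distinct at $x$, one of the $h_i$ being $S$. Put $v_i=Jh_i$. For vector fields $A,B,D$ write $$\sum_{cycl}\Omega([A,B],D)=\Omega([A,B],D)+\Omega([B,D],A)+\Omega([D,A],B).$$ Then a third-order solution $j_3(F)_x$ of $\mathcal P$ at $x$ can be lifted to a fourth-order solution (there is a fourth-order solution $j_4(G)_x$ with $j_3(G)_x=j_3(F)_x$) if and only if (a) the prolonged first compatibility condition holds at $x$: the $1$-jets at $x$ of $i_R\Omega$, of $i_{[\Phi,\Phi]}\Omega$ and of the functions $\sum_{cycl}\Omega([v_i,h_j],h_k)$ ($i,j,k$ pairwise different) vanish; and (b) for any two eigenvector fields $X,Y$ of $\Phi$ near $x$ whose eigenvalues at $x$ are different, one has at $x$ $$\begin{aligned} [hX,\Phi X]\,\Omega(JY,Y)-[hY,\Phi Y]\,\Omega(X,JX)={}&\Phi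 X\Big(\sum_{cycl}\Omega([JY,hX],hY)\Big)\\ &-hX\Big(\sum_{cycl}\Omega([JY,\Phi X],hY)-\sum_{cycl}\Omega([JY,\Phi Y],X)\Big)\\ &-\Phi Y\Big(\sum_{cycl}\Omega([JX,hX],hY)\Big)\\ &+hY\Big(\sum_{cycl}\Omega([JX,\Phi X],Y)-\sum_{cycl}\Omega([JX,\Phi Y],X)\Big). \end{aligned}$$ -/

import Mathlib

open Set Filter Topology Bundle
open scoped Manifold ContDiff

noncomputable section

namespace Rapcsak

/-- The tangent bundle `TM` of an `n`-dimensional manifold. -/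
abbrev TM (n : ℕ) (M : Type*) [TopologicalSpace M] [ChartedSpace (EuclideanSpace ℝ (Fin n)) M]
    [IsManifold (𝓡 n) ∞ M] : Type _ :=
  TangentBundle (𝓡 n) M

/-- (Not necessarily smooth) vector fields on the manifold `TM`. -/
abbrev VF (n : ℕ) (M : Type*) [TopologicalSpace M] [ChartedSpace (EuclideanSpace ℝ (Fin n)) M]
    [IsManifold (𝓡 n) ∞ M] : Type _ :=
  (p : TM n M) → TangentSpace (𝓡 n).tangent p

variable {n : ℕ} {M : Type*} [TopologicalSpace M] [ChartedSpace (EuclideanSpace ℝ (Fin n)) M]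
  [IsManifold (𝓡 n) ∞ M]

/-- The slashed tangent bundle: nonzero tangent vectors. -/
def slashed (n : ℕ) (M : Type*) [TopologicalSpace M] [ChartedSpace (EuclideanSpace ℝ (Fin n)) M]
    [IsManifold (𝓡 n) ∞ M] : Set (TM n M) :=
  {p | p.snd ≠ 0}

/-- `X` is a smooth vector field on the set `U`. -/
def SmoothFieldOn (X : VF n M) (U : Set (TM n M)) : Prop :=
  ContMDiffOn (𝓡 n).tangent (𝓡 n).tangent.tangent ∞
    (fun p => (⟨p, X p⟩ : TangentBundle (𝓡 n).tangent (TM n M))) U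

/-- `X` is a smooth vector field on a neighbourhood of `x`. -/
def SmoothFieldNear (X : VF n M) (x : TM n M) : Prop :=
  ∃ U ∈ 𝓝 x, SmoothFieldOn X U

/-- `f` is a smooth function on a neighbourhood of `x`. -/
def SmoothNear (f : TM n M → ℝ) (x : TM n M) : Prop :=
  ∃ U ∈ 𝓝 x, ContMDiffOn (𝓡 n).tangent 𝓘(ℝ, ℝ) ∞ f U

/-- The Lie bracket of vector fields on `TM`. -/
def br (X Y : VF n M) : VF n M := VectorField.mlieBracket (𝓡 n).tangent X Y

/-- The derivative `X f` of a function along a vector field. -/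
def act (X : VF n M) (f : TM n M → ℝ) : TM n M → ℝ :=
  fun p => mfderiv (𝓡 n).tangent 𝓘(ℝ, ℝ) f p (X p)

/-- The vertical lift of `w ∈ T_{π p} M` to `T_p TM`: the velocity at `t = 0` of `t ↦ p + t w`. -/
def vertLift (p : TM n M) (w : TangentSpace (𝓡 n) p.proj) : TangentSpace (𝓡 n).tangent p :=
  mfderiv 𝓘(ℝ, ℝ) (𝓡 n).tangent (fun t : ℝ => (⟨p.proj, p.snd + t • w⟩ : TM n M)) 0 (1 : ℝ)

/-- The vertical endomorphism `J = dx^i ⊗ ∂/∂y^i`: the vertical lift of the projection. -/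
def J (X : VF n M) : VF n M :=
  fun p => vertLift p (mfderiv (𝓡 n).tangent (𝓡 n) (fun q : TM n M => q.proj) p (X p))

/-- The Liouville vector field `C = y^i ∂/∂y^i`. -/
def liouville : VF n M := fun p => vertLift p p.snd

/-- A spray: a smooth vector field `S` on the slashed tangent bundle with `J S = C` and
`[C, S] = S`. (The values of `S` on the zero section are irrelevant.) -/
structure IsSpray (S : VF n M) : Prop where
  smooth : SmoothFieldOn S (slashed n M)
  second_order : ∀ p ∈ slashed n M, J S p = liouville p
  homogeneous : ∀ p ∈ slashed n M, br liouville S p = S p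

/-- The Frölicher–Nijenhuis bracket `[K, S]` of a vector valued 1-form and a vector field. -/
def fnField (K : VF n M → VF n M) (S X : VF n M) : VF n M :=
  br (K X) S - K (br X S)

/-- The Frölicher–Nijenhuis bracket `[K, K]` of a vector valued 1-form with itself. -/
def fnSelf (K : VF n M → VF n M) (X Y : VF n M) : VF n M :=
  (2 : ℝ) • (br (K X) (K Y) + K (K (br X Y)) - K (br (K X) Y) - K (br X (K Y)))

/-- The connection `Γ = [J, S]` of the spray. -/
def conn (S : VF n M) (X : VF n M) : VF n M := fnField J S X

/-- The horizontal projector `h = (I + Γ) / 2`. -/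
def hor (S : VF n M) (X : VF n M) : VF n M := (1 / 2 : ℝ) • (X + conn S X)

/-- The curvature `R = [h, h] / 2`. -/
def curv (S : VF n M) (X Y : VF n M) : VF n M := (1 / 2 : ℝ) • fnSelf (hor S) X Y

/-- The Jacobi endomorphism `Φ = i_S R`. -/
def jacobi (S : VF n M) (X : VF n M) : VF n M := curv S S X

/-- The 2-form `Ω = d d_J F`, where `(d_J F)(X) = (J X) F`, evaluated on vector fields. -/
def Om (F : TM n M → ℝ) (X Y : VF n M) : TM n M → ℝ :=
  act X (act (J Y) F) - act Y (act (J X) F) - act (J (br X Y)) F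

/-- `i_K Ω` for a vector valued 1-form `K`. -/
def ins1 (F : TM n M → ℝ) (K : VF n M → VF n M) (X Y : VF n M) : TM n M → ℝ :=
  Om F (K X) Y + Om F X (K Y)

/-- `i_L Ω` for a vector valued 2-form `L`. -/
def ins2 (F : TM n M → ℝ) (L : VF n M → VF n M → VF n M) (X Y Z : VF n M) : TM n M → ℝ :=
  Om F (L X Y) Z + Om F (L Y Z) X + Om F (L Z X) Y

/-- The cyclic sum `Ω([X, Y], Z) + Ω([Y, Z], X) + Ω([Z, X], Y)`. -/
def cyc (F : TM n M → ℝ) (X Y Z : VF n M) : TM n M → ℝ :=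
  Om F (br X Y) Z + Om F (br Y Z) X + Om F (br Z X) Y

/-- The `k`-jet of the function `f` at `x` vanishes. -/
def JetVanishes (k : ℕ) (f : TM n M → ℝ) (x : TM n M) : Prop :=
  ∀ j ≤ k, iteratedFDeriv ℝ j (f ∘ (extChartAt (𝓡 n).tangent x).symm)
    (extChartAt (𝓡 n).tangent x x) = 0

/-- The `k`-jets at `x` of two functions agree. -/
def SameJet (k : ℕ) (f g : TM n M → ℝ) (x : TM n M) : Prop := JetVanishes k (f - g) x

/-- The `(l + 2)`-jet of `F` at `x` is a solution of order `l + 2` of the second order operator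
`P = (F ↦ C F - F, F ↦ i_Γ Ω, F ↦ i_Φ Ω)`: it lies in the kernel of the `l`-th prolongation of `P`,
where `C F - F` is of first order. A `k`-jet of a form vanishes iff the `k`-jets of all its
values on smooth vector fields do. -/
structure IsFormalSolution (S : VF n M) (l : ℕ) (F : TM n M → ℝ) (x : TM n M) : Prop where
  homogeneity : JetVanishes (l + 1) (act liouville F - F) x
  connection : ∀ X Y : VF n M, SmoothFieldNear X x → SmoothFieldNear Y x →
    JetVanishes l (ins1 F (conn S) X Y) x
  curvature : ∀ X Y : VF n M, SmoothFieldNear X x → SmoothFieldNear Y x →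
    JetVanishes l (ins1 F (jacobi S) X Y) x

/-- Near `x`, `X` is a smooth horizontal field with `Φ X = lam J X`, `lam` smooth. -/
structure IsEigenfield (S : VF n M) (x : TM n M) (lam : TM n M → ℝ) (X : VF n M) : Prop where
  smooth : SmoothFieldNear X x
  smooth_eigenfunction : SmoothNear lam x
  horizontal : ∀ᶠ p in 𝓝 x, hor S X p = X p
  eigen : ∀ᶠ p in 𝓝 x, jacobi S X p = lam p • J X p

/-- Adapted frame at `x`: `n` eigenvector fields of `Φ` near `x`, nonzero at `x`, whose eigenvalues
at `x` (hence near `x`) are pairwise distinct, one of them being the spray itself. -/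
structure IsAdaptedFrame (S : VF n M) (x : TM n M) (lam : Fin n → TM n M → ℝ)
    (e : Fin n → VF n M) : Prop where
  eigenfield : ∀ i, IsEigenfield S x (lam i) (e i)
  ne_zero : ∀ i, e i x ≠ 0
  distinct : ∀ i j, i ≠ j → lam i x ≠ lam j x
  spray : ∃ o, ∀ᶠ p in 𝓝 x, e o p = S p

/-- The prolongation at `x` of the first compatibility condition
`i_R Ω = 0`, `i_{[Φ, Φ]} Ω = 0`, `Ω([v_i, h_j], h_k) + cyclic = 0` (`i, j, k` distinct,
`v_i = J h_i`): these expressions vanish at `x` together with their first derivatives. -/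
structure ProlongedFirstCondition (S : VF n M) (e : Fin n → VF n M) (F : TM n M → ℝ)
    (x : TM n M) : Prop where
  curv_cond : ∀ X Y Z : VF n M, SmoothFieldNear X x → SmoothFieldNear Y x → SmoothFieldNear Z x →
    JetVanishes 1 (ins2 F (curv S) X Y Z) x
  jacobi_cond : ∀ X Y Z : VF n M, SmoothFieldNear X x → SmoothFieldNear Y x → SmoothFieldNear Z x →
    JetVanishes 1 (ins2 F (fnSelf (jacobi S)) X Y Z) x
  frame_cond : ∀ i j k, i ≠ j → j ≠ k → i ≠ k → JetVanishes 1 (cyc F (J (e i)) (e j) (e k)) x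

/-- The third order condition at `x` for the horizontal fields `X`, `Y`. -/
def ThirdOrderIdentity (S : VF n M) (F : TM n M → ℝ) (X Y : VF n M) (x : TM n M) : Prop :=
  act (br (hor S X) (jacobi S X)) (Om F (J Y) Y) x
      - act (br (hor S Y) (jacobi S Y)) (Om F X (J X)) x =
    act (jacobi S X) (cyc F (J Y) (hor S X) (hor S Y)) x
      - act (hor S X) (cyc F (J Y) (jacobi S X) (hor S Y) - cyc F (J Y) (jacobi S Y) X) x
      - act (jacobi S Y) (cyc F (J X) (hor S X) (hor S Y)) x
      + act (hor S Y) (cyc F (J X) (jacobi S X) Y - cyc F (J X) (jacobi S Y) X) x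

end Rapcsak

end

/-! Two functions with the same 3-jet at x differ by some Q with vanishing 3-jet, and the fourth
derivatives of such a Q at x form an arbitrary symmetric quartic form β on the tangent space. In the
frame h_i, v_i, with h_o = S and v_o = C, F + Q is a fourth-order solution exactly when β solves a
linear system: β(·,·,h_i,v_j) − β(·,·,h_j,v_i) = η_ij, β(·,·,v_i,v_j) = ε_ij for i ≠ j, and
β(·,·,·,v_o) = κ. Here η_ij and ε_ij are minus the Hessians of Ω(h_i,h_j) and Ω(v_i,h_j), and κ is
minus the third derivative of CF − F. The second family encodes i_ΦΩ, because i_ΦΩ(h_i,h_j) = (λ_i −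
λ_j) Ω(v_i,h_j).

The symmetry of β forces relations among η, ε and κ. Those with three indices come from (a): i_RΩ
gives the cyclic identity of η, i_RΩ and i_[Φ,Φ]Ω together give that of ε through [J,Φ] = 3R
(`fnJacobi_eq`, `Compat.cyclic`), and the frame sums link the two families. Homogeneity supplies the
compatibility with κ and the relation for the triple C, S, h_k. One relation with only two indices
remains, and after multiplication by λ_i − λ_j it is (b) (`thirdOrder_iff`).
`QuarticData.exists_quartic` shows that these relations suffice, `EigenFrame.quarticData` verifies
them for F, and `EigenFrame.exists_lift` builds the lift.

Conversely, Ω is closed, so for a fourth-order solution all these expressions are derivatives of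
quantities with vanishing 2-jets (`Sol.compat`, `Sol.thirdOrder`), and they depend on the 3-jet only
(`compat_congr`, `thirdOrder_congr`). The argument runs in a Lie–Rinehart algebra modelled on germs
(`SprayGerm`); `Models` is the dictionary with the manifold. -/

set_option linter.unusedSectionVars false

/-! ### Linear algebra: symmetric quartic forms with prescribed components. -/

noncomputable section

namespace Rapcsak

/-- Symmetric quartic forms on the span of `h i = inl i`, `v i = inr i` with prescribed
antisymmetrizations `η`, prescribed mixed vertical components `ε` and prescribed contraction `κ`
with `v o`. -/
structure QuarticData {ι : Type*} (o : ι) (ε η : ι → ι → ι ⊕ ι → ι ⊕ ι → ℝ)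
    (κ : ι ⊕ ι → ι ⊕ ι → ι ⊕ ι → ℝ) : Prop where
  κ_swap₁ : ∀ a b c, κ a b c = κ b a c
  κ_swap₂ : ∀ a b c, κ a b c = κ a c b
  ε_symm : ∀ i j a b, ε i j a b = ε j i a b
  ε_swap : ∀ i j a b, ε i j a b = ε i j b a
  η_antisymm : ∀ i j a b, η i j a b = - η j i a b
  η_swap : ∀ i j a b, η i j a b = η i j b a
  ε_base : ∀ i a b, ε o i a b = κ (.inr i) a b
  cyclic_η : ∀ i j k a, η i j (.inl k) a + η j k (.inl i) a + η k i (.inl j) a = 0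
  cyclic_ε : ∀ i j k a, i ≠ j → j ≠ k → i ≠ k → ε j k (.inr i) a = ε k i (.inr j) a
  mixed : ∀ i j k a, i ≠ j → j ≠ k → i ≠ k →
    η j k (.inr i) a - ε i k (.inl j) a + ε i j (.inl k) a = 0
  mixed_base : ∀ k a, η o k (.inr o) a - ε o k (.inl o) a + ε o o (.inl k) a = 0
  -- The two-index relation: `ε i j` fixes both β(v_i,v_j,h_i,v_j) and β(v_i,v_j,h_j,v_i), while `η
  -- i j` prescribes their difference.
  quadratic : ∀ i j, i ≠ j →
    η i j (.inr i) (.inr j) + ε i j (.inr i) (.inl j) - ε i j (.inl i) (.inr j) = 0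

namespace QuarticData

open Classical in
/-- The symmetric part of the components of type `h h h v`. -/
def symPart {ι : Type*} (o : ι) (ψ : ι → ι → ι → ℝ) (a b c d : ι) : ℝ :=
  -- An index equal to `o` determines the value. If several are, symmetry of `ψ` makes the choice
  -- immaterial; if none is, the component is free.
  if d = o then ψ a b c else if c = o then ψ a b d else if b = o then ψ a c d
  else if a = o then ψ b c d else 0

theorem symPart_swap {ι : Type*} {o : ι} {ψ : ι → ι → ι → ℝ} (h₁ : ∀ a b c, ψ a b c = ψ b a c)
    (h₂ : ∀ a b c, ψ a b c = ψ a c b) (a b c d : ι) :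
    symPart o ψ a b c d = symPart o ψ b a c d ∧ symPart o ψ a b c d = symPart o ψ a c b d ∧
      symPart o ψ a b c d = symPart o ψ a b d c := by
  refine ⟨?_, ?_, ?_⟩ <;> unfold symPart <;> split_ifs <;> subst_vars <;> grind

variable {ι : Type*} {o : ι} {ε η : ι → ι → ι ⊕ ι → ι ⊕ ι → ℝ} {κ : ι ⊕ ι → ι ⊕ ι → ι ⊕ ι → ℝ}

/-- The part of the components of type `h h h v` forced by `η`. -/
def antiPart (η : ι → ι → ι ⊕ ι → ι ⊕ ι → ℝ) (a b c d : ι) : ℝ :=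
  -- The difference between a component and its average over the four positions of v: each of the
  -- three other positions contributes one `η`.
  (1 / 4) * (η a d (.inl b) (.inl c) + η b d (.inl a) (.inl c) + η c d (.inl a) (.inl b))

/-- Components of type `h h h v`. -/
def comp₁ (o : ι) (η : ι → ι → ι ⊕ ι → ι ⊕ ι → ℝ) (κ : ι ⊕ ι → ι ⊕ ι → ι ⊕ ι → ℝ)
    (a b c d : ι) : ℝ :=
  -- Subtracting `antiPart` here makes the total equal to `κ` when `d = o`.
  symPart o (fun a b c => κ (.inl a) (.inl b) (.inl c) - antiPart η a b c o) a b c d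
    + antiPart η a b c d

open Classical in
/-- Components of type `h h v v`. -/
def comp₂ (o : ι) (ε η : ι → ι → ι ⊕ ι → ι ⊕ ι → ℝ) (a b c d : ι) : ℝ :=
  if c ≠ d ∨ c = o then ε c d (.inl a) (.inl b)
  -- The diagonal component is not prescribed by `ε`, but `η a c` ties β(h_a,h_b,v_c,v_c) to
  -- β(h_c,h_b,v_a,v_c), which is.
  else if a ≠ c then ε a c (.inl c) (.inl b) + η a c (.inl b) (.inr c)
  else if b ≠ c then ε b c (.inl c) (.inl a) + η b c (.inl a) (.inr c) else 0

open Classical in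
/-- Components of type `h v v v`. -/
def comp₃ (o : ι) (ε η : ι → ι → ι ⊕ ι → ι ⊕ ι → ℝ) (a b c d : ι) : ℝ :=
  if b ≠ c ∨ b = o then ε b c (.inl a) (.inr d)
  else if c ≠ d then ε c d (.inl a) (.inr b)
  -- Here all three vertical indices agree and `η a b` trades one of them for `a`; only
  -- β(h_b,v_b,v_b,v_b) is free.
  else if a ≠ b then ε a b (.inl b) (.inr b) + η a b (.inr b) (.inr b) else 0

open Classical in
/-- Components of type `v v v v`. -/
def comp₄ (o : ι) (ε : ι → ι → ι ⊕ ι → ι ⊕ ι → ℝ) (a b c d : ι) : ℝ :=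
  if a ≠ b ∨ a = o then ε a b (.inr c) (.inr d)
  else if b ≠ c then ε b c (.inr a) (.inr d)
  else if c ≠ d then ε c d (.inr a) (.inr b) else 0

/-- The condition `i ≠ j ∨ i = o` singles out the pairs whose vertical component is prescribed. For
`i = o` the symmetry is that of `κ`; for `j = k` it is trivial. -/
theorem cyclic_ε_good (D : QuarticData o ε η κ) (i j k : ι) (a : ι ⊕ ι) (hj : i ≠ j ∨ i = o) (hk : i ≠ k ∨ i = o) :
    ε i j (.inr k) a = ε i k (.inr j) a := by
  have := D.cyclic_ε; have := D.ε_symm; have := D.ε_swap; have := D.ε_base; have := D.κ_swap₁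
  have := D.κ_swap₂
  grind

/-- Coincident indices either reduce to antisymmetry of `η` or force the repeated index to be `o`,
where `mixed_base` applies. -/
theorem mixed_good (D : QuarticData o ε η κ) (i j k : ι) (a : ι ⊕ ι) (hj : i ≠ j ∨ i = o) (hk : i ≠ k ∨ i = o) :
    η j k (.inr i) a - ε i k (.inl j) a + ε i j (.inl k) a = 0 := by
  have := D.mixed i j k a; have := D.mixed_base j a; have := D.mixed_base k a
  have := D.η_antisymm j k (.inr i) a
  rcases eq_or_ne j k with rfl | h₁
  · linarith
  rcases eq_or_ne i j with rfl | h₂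
  · obtain rfl : i = o := by tauto
    assumption
  rcases eq_or_ne i k with rfl | h₃
  · obtain rfl : i = o := by tauto
    linarith
  · tauto

theorem comp₁_swap (D : QuarticData o ε η κ) (a b c d : ι) :
    comp₁ o η κ a b c d = comp₁ o η κ b a c d ∧ comp₁ o η κ a b c d = comp₁ o η κ a c b d := by
  have h₁ : ∀ a b c d, antiPart η a b c d = antiPart η b a c d := fun a b c d => by
    simp only [antiPart]; rw [D.η_swap c d (.inl a)]; ring
  have h₂ : ∀ a b c d, antiPart η a b c d = antiPart η a c b d := fun a b c d => by
    simp only [antiPart]; rw [D.η_swap a d (.inl b)]; ring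
  have h := symPart_swap (o := o)
    (ψ := fun a b c => κ (.inl a) (.inl b) (.inl c) - antiPart η a b c o)
    (fun a b c => by rw [D.κ_swap₁, h₁]) (fun a b c => by rw [D.κ_swap₂, h₂]) a b c d
  simp only [comp₁]
  exact ⟨by rw [h.1, h₁], by rw [h.2.1, h₂]⟩

theorem comp₁_base (a b c : ι) : comp₁ o η κ a b c o = κ (.inl a) (.inl b) (.inl c) := by
  simp [comp₁, symPart]

/-- The symmetric parts cancel. In the difference of the two `antiPart`s, `cyclic_η` turns the
remaining terms into four equal copies of a quarter of `η`. -/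
theorem comp₁_anti (D : QuarticData o ε η κ) (i j a b : ι) :
    comp₁ o η κ i a b j - comp₁ o η κ j a b i = η i j (.inl a) (.inl b) := by
  have h₁ : ∀ a b c d, antiPart η a b c d = antiPart η b a c d := fun a b c d => by
    simp only [antiPart]; rw [D.η_swap c d (.inl a)]; ring
  have h₂ : ∀ a b c d, antiPart η a b c d = antiPart η a c b d := fun a b c d => by
    simp only [antiPart]; rw [D.η_swap a d (.inl b)]; ring
  have h := symPart_swap (o := o)
    (ψ := fun a b c => κ (.inl a) (.inl b) (.inl c) - antiPart η a b c o)
    (fun a b c => by rw [D.κ_swap₁, h₁]) (fun a b c => by rw [D.κ_swap₂, h₂])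
  have hs : symPart o (fun a b c => κ (.inl a) (.inl b) (.inl c) - antiPart η a b c o) i a b j =
      symPart o (fun a b c => κ (.inl a) (.inl b) (.inl c) - antiPart η a b c o) j a b i := by
    rw [(h i a b j).1, (h a i b j).2.1, (h a b i j).2.2, (h a b j i).2.1, (h a j b i).1]
  simp only [comp₁, hs]
  simp only [antiPart]
  have e₁ := D.cyclic_η a j i (.inl b)
  have e₂ := D.cyclic_η b j i (.inl a)
  have := D.η_antisymm i j (.inl a) (.inl b)
  have := D.η_antisymm i a (.inl j) (.inl b)
  have := D.η_antisymm i b (.inl j) (.inl a)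
  have := D.η_swap j i (.inl a) (.inl b)
  have := D.η_swap b j (.inl i) (.inl a)
  have := D.η_swap b i (.inl j) (.inl a)
  linarith

theorem comp₂_swap₁ (D : QuarticData o ε η κ) (a b c d : ι) : comp₂ o ε η a b c d = comp₂ o ε η b a c d := by
  unfold comp₂
  have := D.ε_swap c d (.inl a) (.inl b)
  by_cases h : c ≠ d ∨ c = o
  · simpa [h]
  rw [if_neg h, if_neg h]
  by_cases ha : a = c <;> by_cases hb : b = c
  · simp [ha, hb]
  · simp [ha, hb]
  · simp [ha, hb]
  · simp only [ne_eq, ha, hb, not_false_eq_true, if_true]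
    -- Both `a` and `b` could be traded for `c`; the mixed relation and the cyclic identity of `η`
    -- show that the two choices agree.
    have := D.mixed_good c a b (.inl c) (.inl (Ne.symm ha)) (.inl (Ne.symm hb))
    have := D.cyclic_η a b c (.inr c)
    have := D.η_swap a b (.inr c) (.inl c)
    have := D.η_antisymm c a (.inl b) (.inr c)
    have := D.ε_symm a c (.inl c) (.inl b)
    have := D.ε_symm b c (.inl c) (.inl a)
    have := D.ε_swap c a (.inl c) (.inl b)
    have := D.ε_swap c b (.inl c) (.inl a)
    linarith

theorem comp₂_swap₂ (D : QuarticData o ε η κ) (a b c d : ι) : comp₂ o ε η a b c d = comp₂ o ε η a b d c := by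
  rcases eq_or_ne c d with rfl | h
  · rfl
  · simp only [comp₂, h, h.symm, ne_eq, not_false_eq_true, true_or, if_true]
    exact D.ε_symm ..

theorem comp₂_good (a b i j : ι) (h : i ≠ j ∨ i = o) :
    comp₂ o ε η a b i j = ε i j (.inl a) (.inl b) := by
  simp only [comp₂, if_pos h]

theorem comp₂_anti (D : QuarticData o ε η κ) (i j a b : ι) :
    comp₂ o ε η i a j b - comp₂ o ε η j a i b = η i j (.inl a) (.inr b) := by
  have hη := D.η_antisymm i j (.inl a) (.inr b)
  have s₁ := D.η_swap i j (.inl a) (.inr b)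
  by_cases hj : b ≠ j ∨ b = o <;> by_cases hi : b ≠ i ∨ b = o
  · have := D.mixed_good b i j (.inl a) hi hj
    rw [D.comp₂_swap₂, comp₂_good _ _ _ _ hj, D.comp₂_swap₂, comp₂_good _ _ _ _ hi]
    linarith
  · push Not at hi
    obtain ⟨rfl, h⟩ := hi
    rcases eq_or_ne b j with rfl | hbj
    · linarith
    rw [D.comp₂_swap₂, comp₂_good _ _ _ _ hj]
    have : comp₂ o ε η j a b b = ε j b (.inl b) (.inl a) + η j b (.inl a) (.inr b) := by
      simp [comp₂, h, hbj.symm]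
    rw [this, D.ε_symm]
    linarith
  · push Not at hj
    obtain ⟨rfl, h⟩ := hj
    rcases eq_or_ne b i with rfl | hbi
    · linarith
    rw [D.comp₂_swap₂ b, comp₂_good _ _ _ _ hi]
    have : comp₂ o ε η i a b b = ε i b (.inl b) (.inl a) + η i b (.inl a) (.inr b) := by
      simp [comp₂, h, hbi.symm]
    rw [this, D.ε_symm]
    linarith
  · push Not at hi hj
    obtain ⟨rfl, h⟩ := hi
    obtain ⟨rfl, h⟩ := hj
    linarith

theorem comp₃_good (a i j b : ι) (h : i ≠ j ∨ i = o) :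
    comp₃ o ε η a i j b = ε i j (.inl a) (.inr b) := by
  simp only [comp₃, if_pos h]

theorem comp₃_swap₁ (D : QuarticData o ε η κ) (a b c d : ι) : comp₃ o ε η a b c d = comp₃ o ε η a c b d := by
  rcases eq_or_ne b c with rfl | h
  · rfl
  · rw [comp₃_good _ _ _ _ (.inl h), comp₃_good _ _ _ _ (.inl h.symm), D.ε_symm]

theorem comp₃_swap₂ (D : QuarticData o ε η κ) (a b c d : ι) : comp₃ o ε η a b c d = comp₃ o ε η a b d c := by
  have key : ∀ i j k, (i ≠ j ∨ i = o) → (i ≠ k ∨ i = o) →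
      ε i j (.inl a) (.inr k) = ε i k (.inl a) (.inr j) := fun i j k hj hk => by
    rw [D.ε_swap, D.cyclic_ε_good i j k _ hj hk, D.ε_swap]
  rcases eq_or_ne c d with rfl | h
  · rfl
  by_cases h₁ : b ≠ c ∨ b = o <;> by_cases h₂ : b ≠ d ∨ b = o
  · rw [comp₃_good _ _ _ _ h₁, comp₃_good _ _ _ _ h₂, key _ _ _ h₁ h₂]
  · push Not at h₂
    obtain ⟨rfl, h₂⟩ := h₂
    rw [comp₃_good _ _ _ _ h₁]
    simp [comp₃, h₂, h.symm]
  · push Not at h₁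
    obtain ⟨rfl, h₁⟩ := h₁
    rw [comp₃_good _ _ _ _ h₂]
    simp [comp₃, h₁, h]
  · push Not at h₁ h₂
    exact absurd (h₁.1.symm.trans h₂.1) h

/-- If a vertical slot forms prescribed pairs with both `i` and `j`, this is the mixed relation.
Otherwise only `i` and `j` occur. -/
theorem comp₃_anti (D : QuarticData o ε η κ) (i j a b : ι) :
    comp₃ o ε η i j a b - comp₃ o ε η j i a b = η i j (.inr a) (.inr b) := by
  have hη := D.η_antisymm i j (.inr a) (.inr b)
  rcases eq_or_ne i j with rfl | hij
  · linarith
  have main : ∀ a b, (a ≠ i ∨ a = o) → (a ≠ j ∨ a = o) →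
      comp₃ o ε η i j a b - comp₃ o ε η j i a b = η i j (.inr a) (.inr b) := fun a b hi hj => by
    have := D.mixed_good a i j (.inr b) hi hj
    rw [D.comp₃_swap₁, comp₃_good _ _ _ _ hj, D.comp₃_swap₁, comp₃_good _ _ _ _ hi]
    linarith
  by_cases ha : (a ≠ i ∨ a = o) ∧ (a ≠ j ∨ a = o)
  · exact main a b ha.1 ha.2
  by_cases hb : (b ≠ i ∨ b = o) ∧ (b ≠ j ∨ b = o)
  · rw [D.comp₃_swap₂, D.comp₃_swap₂ j, D.η_swap]
    exact main b a hb.1 hb.2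
  have ha' : a = i ∨ a = j := by tauto
  have hb' : b = i ∨ b = j := by tauto
  -- Equal slots hold by the choice of the diagonal component in `comp₃`; the slots {i, j} are
  -- exactly the two-index relation.
  have hq := D.quadratic i j hij
  rcases ha' with rfl | rfl <;> rcases hb' with rfl | rfl
  · have : comp₃ o ε η j b b b = ε j b (.inl b) (.inr b) + η j b (.inr b) (.inr b) := by
      have : b ≠ o := by tauto
      simp [comp₃, this, hij.symm]
    rw [comp₃_good _ _ _ _ (.inl hij.symm), this]
    linarith
  · rw [D.comp₃_swap₂ b, comp₃_good _ _ _ _ (.inl hij), comp₃_good _ _ _ _ (.inl hij.symm),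
      D.ε_symm b a, D.ε_swap a b (.inl b)]
    linarith
  · rw [D.comp₃_swap₂ b, comp₃_good _ _ _ _ (.inl hij), comp₃_good _ _ _ _ (.inl hij.symm),
      D.ε_symm a b, D.ε_swap b a (.inl a), D.η_swap]
    linarith
  · have : comp₃ o ε η i b b b = ε i b (.inl b) (.inr b) + η i b (.inr b) (.inr b) := by
      have : b ≠ o := by tauto
      simp [comp₃, this, hij]
    rw [comp₃_good _ _ _ _ (.inl hij), this, D.ε_symm]
    linarith

theorem comp₄_good (i j a b : ι) (h : i ≠ j ∨ i = o) :
    comp₄ o ε i j a b = ε i j (.inr a) (.inr b) := by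
  simp only [comp₄, if_pos h]

theorem comp₄_swap₁ (D : QuarticData o ε η κ) (a b c d : ι) : comp₄ o ε a b c d = comp₄ o ε b a c d := by
  rcases eq_or_ne a b with rfl | h
  · rfl
  · rw [comp₄_good _ _ _ _ (.inl h), comp₄_good _ _ _ _ (.inl h.symm), D.ε_symm]

theorem comp₄_swap₂ (D : QuarticData o ε η κ) (a b c d : ι) : comp₄ o ε a b c d = comp₄ o ε a c b d := by
  rcases eq_or_ne b c with rfl | h
  · rfl
  by_cases h₁ : a ≠ b ∨ a = o <;> by_cases h₂ : a ≠ c ∨ a = o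
  · rw [comp₄_good _ _ _ _ h₁, comp₄_good _ _ _ _ h₂, D.cyclic_ε_good _ _ _ _ h₁ h₂]
  · push Not at h₂
    obtain ⟨rfl, h₂⟩ := h₂
    rw [comp₄_good _ _ _ _ h₁]
    simp [comp₄, h₂, h.symm]
  · push Not at h₁
    obtain ⟨rfl, h₁⟩ := h₁
    rw [comp₄_good _ _ _ _ h₂]
    simp [comp₄, h₁, h]
  · push Not at h₁ h₂
    exact absurd (h₁.1.symm.trans h₂.1) h

theorem comp₄_swap₃ (D : QuarticData o ε η κ) (a b c d : ι) : comp₄ o ε a b c d = comp₄ o ε a b d c := by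
  rcases eq_or_ne c d with rfl | h
  · rfl
  by_cases h₁ : a ≠ b ∨ a = o
  · rw [comp₄_good _ _ _ _ h₁, comp₄_good _ _ _ _ h₁, D.ε_swap]
  · push Not at h₁
    obtain ⟨rfl, h₁⟩ := h₁
    have key : ∀ j k, a ≠ j → a ≠ k →
        ε a j (.inr a) (.inr k) = ε a k (.inr a) (.inr j) := fun j k hj hk => by
      rw [D.ε_swap, D.cyclic_ε_good a j k _ (.inl hj) (.inl hk), D.ε_swap]
    rcases eq_or_ne a c with rfl | hc
    · simp [comp₄, h₁, h]
    rcases eq_or_ne a d with rfl | hd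
    · simp [comp₄, h₁, hc]
    simp [comp₄, h₁, hc, hd, key c d hc hd]

/-- Components are grouped by their number of v's. The groups do not interact, so symmetry and the
linear equations are checked in each separately; the purely horizontal components are unconstrained
and set to zero. -/
theorem exists_quartic (D : QuarticData o ε η κ) : ∃ β : ι ⊕ ι → ι ⊕ ι → ι ⊕ ι → ι ⊕ ι → ℝ,
    (∀ a b c d, β a b c d = β b a c d) ∧ (∀ a b c d, β a b c d = β a c b d) ∧
    (∀ a b c d, β a b c d = β a b d c) ∧
    (∀ i j a b, β a b (.inl i) (.inr j) - β a b (.inl j) (.inr i) = η i j a b) ∧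
    (∀ i j a b, i ≠ j → β a b (.inr i) (.inr j) = ε i j a b) ∧
    ∀ a b c, β a b c (.inr o) = κ a b c := by
  have s₁ := D.comp₁_swap
  have s₂ := D.comp₂_swap₁
  have s₂' := D.comp₂_swap₂
  have s₃ := D.comp₃_swap₁
  have s₃' := D.comp₃_swap₂
  have s₄ := D.comp₄_swap₁
  have s₄' := D.comp₄_swap₂
  have s₄'' := D.comp₄_swap₃
  refine ⟨fun a b c d => match a, b, c, d with
    | .inl _, .inl _, .inl _, .inl _ => 0
    | .inl a, .inl b, .inl c, .inr d => comp₁ o η κ a b c d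
    | .inl a, .inl b, .inr c, .inl d => comp₁ o η κ a b d c
    | .inl a, .inr b, .inl c, .inl d => comp₁ o η κ a c d b
    | .inr a, .inl b, .inl c, .inl d => comp₁ o η κ b c d a
    | .inl a, .inl b, .inr c, .inr d => comp₂ o ε η a b c d
    | .inl a, .inr b, .inl c, .inr d => comp₂ o ε η a c b d
    | .inl a, .inr b, .inr c, .inl d => comp₂ o ε η a d b c
    | .inr a, .inl b, .inl c, .inr d => comp₂ o ε η b c a d
    | .inr a, .inl b, .inr c, .inl d => comp₂ o ε η b d a c
    | .inr a, .inr b, .inl c, .inl d => comp₂ o ε η c d a b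
    | .inl a, .inr b, .inr c, .inr d => comp₃ o ε η a b c d
    | .inr a, .inl b, .inr c, .inr d => comp₃ o ε η b a c d
    | .inr a, .inr b, .inl c, .inr d => comp₃ o ε η c a b d
    | .inr a, .inr b, .inr c, .inl d => comp₃ o ε η d a b c
    | .inr a, .inr b, .inr c, .inr d => comp₄ o ε a b c d, ?_, ?_, ?_, ?_, ?_, ?_⟩
  · rintro (a | a) (b | b) (c | c) (d | d) <;>
      first | rfl | exact (s₁ _ _ _ _).1 | exact s₂ .. | exact s₂' .. | exact s₃ .. | exact s₄ ..
  · rintro (a | a) (b | b) (c | c) (d | d) <;>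
      first | rfl | exact (s₁ _ _ _ _).1 | exact (s₁ _ _ _ _).2 | exact s₂ .. | exact s₂' ..
            | exact s₃ .. | exact s₃' .. | exact s₄' ..
  · rintro (a | a) (b | b) (c | c) (d | d) <;>
      first | rfl | exact (s₁ _ _ _ _).2 | exact s₂ .. | exact s₂' ..
            | exact s₃' .. | exact s₄'' ..
  · rintro i j (a | a) (b | b)
    · have := D.comp₁_anti i j a b
      rw [(s₁ i a b j).1, (s₁ a i b j).2, (s₁ j a b i).1, (s₁ a j b i).2] at this
      exact this
    · have := D.comp₂_anti i j a b
      rw [s₂ i a j b, s₂ j a i b, s₂', s₂' _ _ i b] at this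
      exact this
    · have := D.comp₂_anti i j b a
      rw [s₂ i b j a, s₂ j b i a, s₂', s₂' _ _ i a, D.η_swap] at this
      exact this
    · have := D.comp₃_anti i j a b
      rw [s₃, s₃', s₃ j i a b, s₃' j a i b] at this
      exact this
  · rintro i j (a | a) (b | b) h
    · exact comp₂_good _ _ _ _ (.inl h)
    · have : comp₃ o ε η a b i j = ε i j (.inl a) (.inr b) := by
        rw [s₃, s₃', comp₃_good _ _ _ _ (.inl h)]
      exact this
    · have : comp₃ o ε η b a i j = ε i j (.inr a) (.inl b) := by
        rw [s₃, s₃', comp₃_good _ _ _ _ (.inl h), D.ε_swap]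
      exact this
    · have : comp₄ o ε a b i j = ε i j (.inr a) (.inr b) := by
        rw [s₄', s₄, s₄'', s₄', comp₄_good _ _ _ _ (.inl h)]
      exact this
  · have k₂ : ∀ a b c, comp₂ o ε η a b c o = κ (.inl a) (.inl b) (.inr c) := fun a b c => by
      rw [s₂', comp₂_good _ _ _ _ (.inr rfl), D.ε_base, D.κ_swap₁, D.κ_swap₂]
    have k₃ : ∀ a b c, comp₃ o ε η a b c o = κ (.inl a) (.inr b) (.inr c) := fun a b c => by
      rw [s₃', s₃, comp₃_good _ _ _ _ (.inr rfl), D.ε_base, D.κ_swap₁]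
    rintro (a | a) (b | b) (c | c)
    · exact comp₁_base _ _ _
    · exact k₂ _ _ _
    · exact (k₂ _ _ _).trans (D.κ_swap₂ ..)
    · exact k₃ _ _ _
    · exact (k₂ _ _ _).trans ((D.κ_swap₂ ..).trans (D.κ_swap₁ ..))
    · exact (k₃ _ _ _).trans (D.κ_swap₁ ..)
    · exact (k₃ _ _ _).trans ((D.κ_swap₁ ..).trans (D.κ_swap₂ ..))
    · have : comp₄ o ε a b c o = κ (.inr a) (.inr b) (.inr c) := by
        rw [s₄'', s₄', s₄, comp₄_good _ _ _ _ (.inr rfl), D.ε_base]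
      exact this

end QuarticData
end Rapcsak

/-! ### Sprays, connection and curvature in a Lie–Rinehart algebra. -/

namespace Rapcsak

/-- Fibred coordinates `x i`, `y i` with their coordinate fields `px i`, `py i`, and a spray `S`,
in a Lie–Rinehart algebra `L` over an algebra `A` of germs of functions, with evaluation `ev`. -/
structure SprayGerm (ι A L : Type*) [Fintype ι] [DecidableEq ι] [CommRing A] [Algebra ℝ A]
    [LieRing L] [Module A L] [LieRingModule L A] where
  x : ι → A
  y : ι → A
  px : ι → L
  py : ι → L
  px_x : ∀ i j, ⁅px i, x j⁆ = if i = j then 1 else 0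
  px_y : ∀ i j, ⁅px i, y j⁆ = 0
  py_x : ∀ i j, ⁅py i, x j⁆ = 0
  py_y : ∀ i j, ⁅py i, y j⁆ = if i = j then 1 else 0
  decomp : ∀ X : L, X = ∑ i, ⁅X, x i⁆ • px i + ∑ i, ⁅X, y i⁆ • py i
  S : L
  S_x : ∀ i, ⁅S, x i⁆ = y i
  homogeneous : ⁅∑ i, y i • py i, S⁆ = S
  ev : A →ₐ[ℝ] ℝ
  -- Locality: it permits division by differences of eigenvalues that are distinct at the base
  -- point.
  isUnit_of_ev : ∀ f, ev f ≠ 0 → IsUnit f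

variable {ι A L : Type*} [Fintype ι] [DecidableEq ι] [CommRing A] [Algebra ℝ A]
  [LieRing L] [Module A L] [LieRingModule L A] [LieRinehartRing A L] [LieAlgebra ℝ L]
  [LieRinehartAlgebra ℝ A L]

section LieRinehart

theorem act_mul (X : L) (a b : A) : ⁅X, a * b⁆ = a * ⁅X, b⁆ + ⁅X, a⁆ * b := by
  rw [LieRinehartRing.leibniz_mul_right, smul_eq_mul]

theorem act_one (X : L) : ⁅X, (1 : A)⁆ = 0 := by
  have h := act_mul X (1 : A) 1
  simp only [one_mul, mul_one] at h
  exact left_eq_add.mp h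

theorem act_algebraMap (X : L) (r : ℝ) : ⁅X, algebraMap ℝ A r⁆ = 0 := by
  rw [Algebra.algebraMap_eq_smul_one, lie_smul, act_one, smul_zero]

theorem act_ite (X : L) (p : Prop) [Decidable p] : ⁅X, if p then (1 : A) else 0⁆ = 0 := by
  split_ifs
  · exact act_one X
  · exact lie_zero X

theorem smul_act (a b : A) (X : L) : ⁅a • X, b⁆ = a * ⁅X, b⁆ :=
  LieRinehartRing.lie_smul_eq_mul a b X

theorem lie_smul_field (a : A) (X Y : L) : ⁅X, a • Y⁆ = a • ⁅X, Y⁆ + ⁅X, a⁆ • Y :=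
  LieRinehartRing.leibniz_smul_right X Y a

theorem smul_lie_field (a : A) (X Y : L) : ⁅a • X, Y⁆ = a • ⁅X, Y⁆ - ⁅Y, a⁆ • X := by
  rw [← lie_skew, lie_smul_field, ← lie_skew X Y]
  module

/-- The Frölicher–Nijenhuis square `[K, K]` of an endomorphism. -/
def fnSq (K : L →ₗ[A] L) (X Y : L) : L :=
  (2 : ℝ) • (⁅K X, K Y⁆ + K (K ⁅X, Y⁆) - K ⁅K X, Y⁆ - K ⁅X, K Y⁆)

theorem map_real_smul (K : L →ₗ[A] L) (r : ℝ) (X : L) : K (r • X) = r • K X := by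
  rw [← algebraMap_smul A r X, map_smul, algebraMap_smul]

theorem fnSq_add_left (K : L →ₗ[A] L) (X X' Y : L) :
    fnSq K (X + X') Y = fnSq K X Y + fnSq K X' Y := by
  simp only [fnSq, add_lie, map_add]
  module

theorem fnSq_smul_left (K : L →ₗ[A] L) (a : A) (X Y : L) :
    fnSq K (a • X) Y = a • fnSq K X Y := by
  simp only [fnSq, smul_lie_field, map_sub, map_smul]
  module

theorem fnSq_swap (K : L →ₗ[A] L) (X Y : L) : fnSq K X Y = - fnSq K Y X := by
  simp only [fnSq]
  rw [← lie_skew (K X) (K Y), ← lie_skew X Y, ← lie_skew (K X) Y, ← lie_skew X (K Y)]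
  simp only [map_neg]
  module

end LieRinehart

namespace SprayGerm

variable (T : SprayGerm ι A L)

variable {T} in
theorem ext_coord {X Y : L} (hx : ∀ i, ⁅X, T.x i⁆ = ⁅Y, T.x i⁆)
    (hy : ∀ i, ⁅X, T.y i⁆ = ⁅Y, T.y i⁆) : X = Y := by
  rw [T.decomp X, T.decomp Y]
  simp only [hx, hy]

/-- The vertical endomorphism. -/
def J : L →ₗ[A] L where
  toFun X := ∑ i, ⁅X, T.x i⁆ • T.py i
  map_add' X Y := by simp only [add_lie, add_smul, Finset.sum_add_distrib]
  map_smul' a X := by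
    simp only [smul_act, mul_smul, Finset.smul_sum, RingHom.id_apply]

/-- The Liouville field. -/
def C : L := ∑ i, T.y i • T.py i

theorem J_apply (X : L) : T.J X = ∑ i, ⁅X, T.x i⁆ • T.py i := rfl

theorem J_act_x (X : L) (i : ι) : ⁅T.J X, T.x i⁆ = 0 := by
  simp [J_apply, sum_lie, T.py_x]

theorem J_act_y (X : L) (i : ι) : ⁅T.J X, T.y i⁆ = ⁅X, T.x i⁆ := by
  simp [J_apply, sum_lie, T.py_y]

theorem C_act_x (i : ι) : ⁅T.C, T.x i⁆ = 0 := by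
  simp [C, sum_lie, T.py_x]

theorem C_act_y (i : ι) : ⁅T.C, T.y i⁆ = T.y i := by
  simp [C, sum_lie, T.py_y]

theorem J_J (X : L) : T.J (T.J X) = 0 := by
  simp [J_apply T (T.J X), J_act_x]

theorem J_S : T.J T.S = T.C := by
  simp [J_apply, C, T.S_x]

theorem J_C : T.J T.C = 0 := by rw [← J_S, J_J]

theorem C_S : ⁅T.C, T.S⁆ = T.S := T.homogeneous

/-- The Nijenhuis tensor of `J` vanishes. This makes the vertical fields involutive and is the
source of i_JΩ = 0. -/
theorem nijenhuis (X Y : L) : ⁅T.J X, T.J Y⁆ = T.J ⁅T.J X, Y⁆ + T.J ⁅X, T.J Y⁆ := by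
  refine T.ext_coord (fun i => ?_) (fun i => ?_) <;>
  simp [add_lie, lie_lie, J_act_x, J_act_y]
  abel

theorem C_lie_J (X : L) : ⁅T.C, T.J X⁆ = T.J ⁅T.C, X⁆ - T.J X := by
  refine T.ext_coord (fun i => ?_) (fun i => ?_) <;>
  simp [sub_lie, lie_lie, J_act_x, J_act_y, C_act_x, C_act_y]

theorem J_lie_S (X : L) : T.J ⁅T.J X, T.S⁆ = T.J X := by
  refine T.ext_coord (fun i => ?_) (fun i => ?_) <;>
  simp [lie_lie, J_act_x, J_act_y, T.S_x]

theorem exists_of_J_eq_zero {X : L} (h : T.J X = 0) : ∃ Y, X = T.J Y := by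
  refine ⟨∑ i, ⁅X, T.y i⁆ • T.px i, T.ext_coord (fun i => ?_) (fun i => ?_)⟩
  · rw [J_act_x, ← J_act_y, h, zero_lie]
  · simp [J_act_y, sum_lie, T.px_x]

/-- The connection `Γ = [J, S]`. -/
def conn : L →ₗ[A] L where
  toFun X := ⁅T.J X, T.S⁆ - T.J ⁅X, T.S⁆
  map_add' X Y := by simp only [map_add, add_lie]; abel
  map_smul' a X := by
    simp only [map_smul, smul_lie_field, map_sub, RingHom.id_apply]; module

theorem conn_apply (X : L) : T.conn X = ⁅T.J X, T.S⁆ - T.J ⁅X, T.S⁆ := rfl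

theorem conn_J (X : L) : T.conn (T.J X) = - T.J X := by
  rw [conn_apply, J_J, J_lie_S, zero_lie, zero_sub]

theorem J_conn (X : L) : T.J (T.conn X) = T.J X := by
  rw [conn_apply, map_sub, J_lie_S, J_J, sub_zero]

/-- Since JΓ = J, the field X − ΓX is vertical, and Γ is −1 on vertical fields. -/
theorem conn_conn (X : L) : T.conn (T.conn X) = X := by
  obtain ⟨Y, hY⟩ := T.exists_of_J_eq_zero (X := X - T.conn X) (by rw [map_sub, J_conn, sub_self])
  have h := T.conn_J Y
  rw [← hY, map_sub] at h
  have := congrArg (fun Z => T.conn X - Z) h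
  simpa using this

theorem conn_S : T.conn T.S = T.S := by
  rw [conn_apply, J_S, C_S, lie_self, map_zero, sub_zero]

theorem conn_C_lie (X : L) : T.conn ⁅T.C, X⁆ = ⁅T.C, T.conn X⁆ := by
  rw [conn_apply, conn_apply, lie_sub, C_lie_J, leibniz_lie T.C (T.J X), C_lie_J,
    leibniz_lie T.C X, C_S, sub_lie, map_add]
  abel

/-- The horizontal projector `h = (I + Γ) / 2`. -/
def hor : L →ₗ[A] L where
  toFun X := (1 / 2 : ℝ) • (X + T.conn X)
  map_add' X Y := by simp only [map_add]; module
  map_smul' a X := by simp only [map_smul, RingHom.id_apply]; module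

theorem hor_apply (X : L) : T.hor X = (1 / 2 : ℝ) • (X + T.conn X) := rfl

theorem conn_hor (X : L) : T.conn (T.hor X) = T.hor X := by
  rw [hor_apply, map_real_smul, map_add, conn_conn, add_comm]

theorem hor_of_conn {X : L} (h : T.conn X = X) : T.hor X = X := by
  rw [hor_apply, h]; module

theorem conn_of_hor {X : L} (h : T.hor X = X) : T.conn X = X := by
  rw [← h, conn_hor]

theorem hor_hor (X : L) : T.hor (T.hor X) = T.hor X := T.hor_of_conn (T.conn_hor X)

theorem hor_S : T.hor T.S = T.S := T.hor_of_conn T.conn_S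

theorem hor_J (X : L) : T.hor (T.J X) = 0 := by
  rw [hor_apply, conn_J, add_neg_cancel, smul_zero]

theorem J_hor (X : L) : T.J (T.hor X) = T.J X := by
  rw [hor_apply, map_real_smul, map_add, J_conn]; module

theorem exists_ver (X : L) : ∃ Y, X - T.hor X = T.J Y :=
  T.exists_of_J_eq_zero (by rw [map_sub, J_hor, sub_self])

/-- The curvature `R = [h, h] / 2`. -/
def curv (X Y : L) : L := (1 / 2 : ℝ) • fnSq T.hor X Y

theorem curv_eq (X Y : L) : T.curv X Y = ⁅T.hor X, T.hor Y⁆ - T.hor ⁅T.hor X, T.hor Y⁆ := by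
  obtain ⟨X', hX⟩ := T.exists_ver X
  obtain ⟨Y', hY⟩ := T.exists_ver Y
  -- Involutivity of the vertical distribution removes the vertical arguments from the Nijenhuis
  -- bracket.
  have h0 : T.hor ⁅X - T.hor X, Y - T.hor Y⁆ = 0 := by
    rw [hX, hY, nijenhuis, map_add, hor_J, hor_J, add_zero]
  simp only [lie_sub, sub_lie, map_sub] at h0
  simp only [curv, fnSq, hor_hor]
  have h1 : T.hor ⁅X, Y⁆ - T.hor ⁅T.hor X, Y⁆ - T.hor ⁅X, T.hor Y⁆ =
      - T.hor ⁅T.hor X, T.hor Y⁆ := by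
    linear_combination (norm := module) h0
  linear_combination (norm := module) (1 : ℝ) • h1

theorem J_curv (X Y : L) : T.J (T.curv X Y) = 0 := by
  rw [curv_eq, map_sub, J_hor, sub_self]

theorem curv_add_left (X X' Y : L) : T.curv (X + X') Y = T.curv X Y + T.curv X' Y := by
  simp only [curv, fnSq_add_left, smul_add]

theorem curv_smul_left (a : A) (X Y : L) : T.curv (a • X) Y = a • T.curv X Y := by
  simp only [curv, fnSq_smul_left]; module

theorem curv_swap (X Y : L) : T.curv X Y = - T.curv Y X := by
  rw [curv, fnSq_swap, smul_neg, curv]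

theorem curv_J_left (X Y : L) : T.curv (T.J X) Y = 0 := by
  rw [curv_eq, hor_J, zero_lie, map_zero, sub_zero]

/-- The Jacobi endomorphism `Φ = i_S R`. -/
def jacobi : L →ₗ[A] L where
  toFun X := T.curv T.S X
  map_add' X Y := by
    rw [curv_swap, curv_add_left, curv_swap T T.S X, curv_swap T T.S Y, neg_add]
  map_smul' a X := by
    rw [curv_swap, curv_smul_left, curv_swap T T.S X, smul_neg, RingHom.id_apply]

theorem jacobi_apply (X : L) : T.jacobi X = T.curv T.S X := rfl

theorem J_jacobi (X : L) : T.J (T.jacobi X) = 0 := T.J_curv _ _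

theorem jacobi_J (X : L) : T.jacobi (T.J X) = 0 := by
  rw [jacobi_apply, curv_swap, curv_J_left, neg_zero]

theorem exists_jacobi (X : L) : ∃ Y, T.jacobi X = T.J Y := T.exists_of_J_eq_zero (T.J_jacobi X)

theorem jacobi_jacobi (X : L) : T.jacobi (T.jacobi X) = 0 := by
  obtain ⟨Y, hY⟩ := T.exists_jacobi X
  rw [hY, jacobi_J]

end SprayGerm
end Rapcsak

/-! ### The 2-form Ω and its contractions. -/

namespace Rapcsak

variable {ι A L : Type*} [Fintype ι] [DecidableEq ι] [CommRing A] [Algebra ℝ A]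
  [LieRing L] [Module A L] [LieRingModule L A] [LieRinehartRing A L] [LieAlgebra ℝ L]
  [LieRinehartAlgebra ℝ A L]

namespace SprayGerm

variable (T : SprayGerm ι A L)

/-- The 2-form `Ω = d d_J F`. -/
def Om (F : A) (X Y : L) : A := ⁅X, ⁅T.J Y, F⁆⁆ - ⁅Y, ⁅T.J X, F⁆⁆ - ⁅T.J ⁅X, Y⁆, F⁆

/-- `i_K Ω` for an endomorphism `K`. -/
def ins1 (F : A) (K : L →ₗ[A] L) (X Y : L) : A := T.Om F (K X) Y + T.Om F X (K Y)

/-- `i_R Ω` for a vector valued 2-form `R`. -/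
def ins2 (F : A) (R : L → L → L) (X Y Z : L) : A :=
  T.Om F (R X Y) Z + T.Om F (R Y Z) X + T.Om F (R Z X) Y

/-- The cyclic sum of `Ω([X, Y], Z)`. -/
def cyc (F : A) (X Y Z : L) : A := T.Om F ⁅X, Y⁆ Z + T.Om F ⁅Y, Z⁆ X + T.Om F ⁅Z, X⁆ Y

section Om

variable (F : A)

theorem Om_swap (X Y : L) : T.Om F X Y = - T.Om F Y X := by
  simp only [Om]
  rw [← lie_skew X Y, map_neg, neg_lie]
  ring

theorem Om_add_left (X X' Y : L) : T.Om F (X + X') Y = T.Om F X Y + T.Om F X' Y := by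
  simp only [Om, add_lie, map_add, lie_add]
  ring

theorem Om_smul_left (a : A) (X Y : L) : T.Om F (a • X) Y = a * T.Om F X Y := by
  simp only [Om, smul_act, map_smul, smul_lie_field, map_sub, sub_lie, act_mul]
  ring

theorem Om_add_right (X Y Y' : L) : T.Om F X (Y + Y') = T.Om F X Y + T.Om F X Y' := by
  rw [Om_swap, Om_add_left, Om_swap T F Y, Om_swap T F Y']
  ring

theorem Om_smul_right (a : A) (X Y : L) : T.Om F X (a • Y) = a * T.Om F X Y := by
  rw [Om_swap, Om_smul_left, Om_swap T F Y]
  ring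

theorem Om_neg_left (X Y : L) : T.Om F (-X) Y = - T.Om F X Y := by
  rw [← neg_one_smul A X, Om_smul_left, neg_one_mul]

theorem Om_neg_right (X Y : L) : T.Om F X (-Y) = - T.Om F X Y := by
  rw [← neg_one_smul A Y, Om_smul_right, neg_one_mul]

theorem Om_sub_left (X X' Y : L) : T.Om F (X - X') Y = T.Om F X Y - T.Om F X' Y := by
  rw [sub_eq_add_neg, Om_add_left, Om_neg_left, sub_eq_add_neg]

theorem Om_sub_right (X Y Y' : L) : T.Om F X (Y - Y') = T.Om F X Y - T.Om F X Y' := by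
  rw [sub_eq_add_neg, Om_add_right, Om_neg_right, sub_eq_add_neg]

theorem Om_zero_left (Y : L) : T.Om F 0 Y = 0 := by
  rw [← zero_smul A (0 : L), Om_smul_left, zero_mul]

theorem Om_zero_right (Y : L) : T.Om F Y 0 = 0 := by
  rw [Om_swap, Om_zero_left, neg_zero]

theorem Om_real_smul_left (r : ℝ) (X Y : L) : T.Om F (r • X) Y = r • T.Om F X Y := by
  rw [← algebraMap_smul A r X, Om_smul_left, Algebra.smul_def]

theorem Om_sub_fun (G : A) (X Y : L) : T.Om (G - F) X Y = T.Om G X Y - T.Om F X Y := by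
  simp only [Om, lie_sub]
  ring

theorem Om_add_fun (G : A) (X Y : L) : T.Om (F + G) X Y = T.Om F X Y + T.Om G X Y := by
  simp only [Om, lie_add]
  ring

/-- Together with antisymmetry this is i_JΩ = 0, a consequence of the vanishing Nijenhuis tensor of
`J`. -/
theorem Om_J_symm (X Y : L) : T.Om F (T.J X) Y = T.Om F (T.J Y) X := by
  have h := congrArg (fun Z => ⁅Z, F⁆) (T.nijenhuis X Y)
  simp only [add_lie, lie_lie (T.J X)] at h
  simp only [Om, J_J, zero_lie, lie_zero]
  rw [← lie_skew (T.J Y) X, map_neg, neg_lie]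
  linear_combination h

theorem Om_J_right (X Y : L) : T.Om F X (T.J Y) = - T.Om F (T.J X) Y := by
  rw [Om_swap, Om_J_symm]

theorem Om_J_J (X Y : L) : T.Om F (T.J X) (T.J Y) = 0 := by
  rw [Om_J_right, J_J, Om_zero_left, neg_zero]

/-- This is dΩ = 0: the exterior derivative of the exact form Ω is the difference of the two sides.
It turns every cyclic sum of brackets into first derivatives of values of Ω. -/
theorem cyc_eq (X Y Z : L) : T.cyc F X Y Z =
    ⁅X, T.Om F Y Z⁆ + ⁅Y, T.Om F Z X⁆ + ⁅Z, T.Om F X Y⁆ := by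
  have jac : ⁅⁅X, Y⁆, Z⁆ + ⁅⁅Y, Z⁆, X⁆ + ⁅⁅Z, X⁆, Y⁆ = 0 := by
    rw [← lie_skew ⁅X, Y⁆, ← lie_skew ⁅Y, Z⁆, ← lie_skew ⁅Z, X⁆]
    have := lie_jacobi X Y Z
    rw [← neg_eq_zero] at this
    rw [← this]
    abel
  have h := congrArg (fun W => ⁅T.J W, F⁆) jac
  simp only [map_add, add_lie, map_zero, zero_lie] at h
  simp only [cyc, Om, lie_sub]
  rw [lie_lie X Y ⁅T.J Z, F⁆, lie_lie Y Z ⁅T.J X, F⁆, lie_lie Z X ⁅T.J Y, F⁆]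
  linear_combination - h

/-- The identity i_CΩ = d_J(CF − F): homogeneity controls every component of Ω involving C = v_o. -/
theorem Om_C (X : L) : T.Om F T.C X = ⁅T.J X, ⁅T.C, F⁆ - F⁆ := by
  have h := congrArg (fun Z => ⁅Z, F⁆) (T.C_lie_J X)
  simp only [sub_lie, lie_lie T.C (T.J X)] at h
  simp only [Om, J_C, zero_lie, lie_zero, lie_sub]
  linear_combination h

theorem Om_jacobi_J (X Y : L) : T.Om F (T.jacobi X) (T.J Y) = 0 := by
  obtain ⟨Z, hZ⟩ := T.exists_jacobi X
  rw [hZ, Om_J_J]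

theorem Om_jacobi_jacobi (X Y : L) : T.Om F (T.jacobi X) (T.jacobi Y) = 0 := by
  obtain ⟨Z, hZ⟩ := T.exists_jacobi Y
  rw [hZ, Om_jacobi_J]

theorem Om_curv_J (X Y Z : L) : T.Om F (T.curv X Y) (T.J Z) = 0 := by
  obtain ⟨W, hW⟩ := T.exists_of_J_eq_zero (T.J_curv X Y)
  rw [hW, Om_J_J]

theorem ins1_conn_hor (X Y : L) :
    T.ins1 F T.conn (T.hor X) (T.hor Y) = (2 : ℝ) • T.Om F (T.hor X) (T.hor Y) := by
  rw [ins1, conn_hor, conn_hor, two_smul]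

/-- `R` has vertical values, which pair to zero with vertical arguments, so only horizontal parts
contribute. The subtracted terms involve only values of Ω on horizontal pairs. -/
theorem ins2_curv_eq (X Y Z : L) : T.ins2 F T.curv X Y Z =
    T.cyc F (T.hor X) (T.hor Y) (T.hor Z) - (T.Om F (T.hor ⁅T.hor X, T.hor Y⁆) (T.hor Z)
      + T.Om F (T.hor ⁅T.hor Y, T.hor Z⁆) (T.hor X)
      + T.Om F (T.hor ⁅T.hor Z, T.hor X⁆) (T.hor Y)) := by
  have h : ∀ X Y Z, T.Om F (T.curv X Y) Z = T.Om F ⁅T.hor X, T.hor Y⁆ (T.hor Z)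
      - T.Om F (T.hor ⁅T.hor X, T.hor Y⁆) (T.hor Z) := fun X Y Z => by
    obtain ⟨W, hW⟩ := T.exists_ver Z
    have h0 : T.Om F (T.curv X Y) (Z - T.hor Z) = 0 := by rw [hW, Om_curv_J]
    rw [Om_sub_right, sub_eq_zero] at h0
    rw [h0, curv_eq, Om_sub_left]
  rw [ins2, h, h, h, cyc]
  ring

/-- The Frölicher–Nijenhuis bracket `[J, Φ]`. -/
def fnJacobi (X Y : L) : L :=
  ⁅T.J X, T.jacobi Y⁆ + ⁅T.jacobi X, T.J Y⁆ - T.J ⁅X, T.jacobi Y⁆ - T.J ⁅T.jacobi X, Y⁆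
    - T.jacobi ⁅X, T.J Y⁆ - T.jacobi ⁅T.J X, Y⁆

/-- Closedness of Ω is applied to the triples with `Φ` on two of the three arguments. Since Φ² = 0
and Ω(Φ·,Φ·) = 0, what survives consists of first derivatives and values of i_ΦΩ. -/
theorem ins2_fnSq_jacobi (X Y Z : L) : T.ins2 F (fnSq T.jacobi) X Y Z =
    (2 : ℝ) • ((⁅T.jacobi X, T.ins1 F T.jacobi Y Z⁆ + ⁅T.jacobi Y, T.ins1 F T.jacobi Z X⁆
      + ⁅T.jacobi Z, T.ins1 F T.jacobi X Y⁆)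
      - (T.ins1 F T.jacobi (⁅T.jacobi X, Y⁆ + ⁅X, T.jacobi Y⁆) Z
        + T.ins1 F T.jacobi (⁅T.jacobi Y, Z⁆ + ⁅Y, T.jacobi Z⁆) X
        + T.ins1 F T.jacobi (⁅T.jacobi Z, X⁆ + ⁅Z, T.jacobi X⁆) Y)) := by
  have c₁ := T.cyc_eq F (T.jacobi X) (T.jacobi Y) Z
  have c₂ := T.cyc_eq F X (T.jacobi Y) (T.jacobi Z)
  have c₃ := T.cyc_eq F (T.jacobi X) Y (T.jacobi Z)
  simp only [Om_jacobi_jacobi, lie_zero, cyc] at c₁ c₂ c₃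
  simp only [ins2, fnSq, Om_real_smul_left, jacobi_jacobi, Om_sub_left, Om_add_left, ins1,
    map_add, lie_add, Om_zero_left, ← smul_add]
  congr 1
  linear_combination c₁ + c₂ + c₃

/-- The analogue for the mixed bracket: closedness is applied with `J` and `Φ` on two different
arguments, and i_JΩ = 0 leaves only i_ΦΩ. -/
theorem Om_fnJacobi (X Y Z : L) : T.ins2 F T.fnJacobi X Y Z =
    (⁅T.J X, T.ins1 F T.jacobi Y Z⁆ + ⁅T.J Y, T.ins1 F T.jacobi Z X⁆
      + ⁅T.J Z, T.ins1 F T.jacobi X Y⁆)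
      - (T.ins1 F T.jacobi (⁅T.J X, Y⁆ + ⁅X, T.J Y⁆) Z
        + T.ins1 F T.jacobi (⁅T.J Y, Z⁆ + ⁅Y, T.J Z⁆) X
        + T.ins1 F T.jacobi (⁅T.J Z, X⁆ + ⁅Z, T.J X⁆) Y) := by
  have c₁ := T.cyc_eq F (T.jacobi X) (T.J Y) Z
  have c₂ := T.cyc_eq F X (T.jacobi Y) (T.J Z)
  have c₃ := T.cyc_eq F (T.jacobi X) Y (T.J Z)
  have c₄ := T.cyc_eq F (T.J X) (T.jacobi Y) Z
  have c₅ := T.cyc_eq F X (T.J Y) (T.jacobi Z)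
  have c₆ := T.cyc_eq F (T.J X) Y (T.jacobi Z)
  have s : ∀ X Y, T.Om F (T.J X) (T.jacobi Y) = 0 := fun X Y => by
    rw [Om_swap, Om_jacobi_J, neg_zero]
  simp only [J_jacobi, Om_zero_left, neg_zero, s, lie_zero, cyc, Om_J_right, lie_neg] at c₁ c₂ c₃ c₄ c₅ c₆
  simp only [ins2, fnJacobi, Om_sub_left, Om_add_left, ins1, map_add, lie_add]
  linear_combination c₁ + c₂ + c₃ + c₄ + c₅ + c₆

end Om

end SprayGerm
end Rapcsak

/-! ### The classical identity [J, Φ] = 3R. -/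

namespace Rapcsak

variable {ι A L : Type*} [Fintype ι] [DecidableEq ι] [CommRing A] [Algebra ℝ A]
  [LieRing L] [Module A L] [LieRingModule L A] [LieRinehartRing A L] [LieAlgebra ℝ L]
  [LieRinehartAlgebra ℝ A L]

namespace SprayGerm

variable (T : SprayGerm ι A L)

theorem coord_induction {P : L → Prop} (h0 : P 0) (hadd : ∀ X Y, P X → P Y → P (X + Y))
    (hsmul : ∀ (a : A) X, P X → P (a • X)) (hx : ∀ i, P (T.px i)) (hy : ∀ i, P (T.py i)) (X : L) :
    P X := by
  rw [T.decomp X]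
  exact hadd _ _ (Finset.sum_induction _ P hadd h0 fun i _ => hsmul _ _ (hx i))
    (Finset.sum_induction _ P hadd h0 fun i _ => hsmul _ _ (hy i))

theorem J_lie_J_J (X Y : L) : T.J ⁅T.J X, T.J Y⁆ = 0 := by
  rw [nijenhuis, map_add, J_J, J_J, add_zero]

theorem J_px (i : ι) : T.J (T.px i) = T.py i := by
  refine T.ext_coord (fun j => ?_) (fun j => ?_) <;>
  simp [J_act_x, J_act_y, T.px_x, T.py_x, T.py_y]

theorem px_lie_py (i j : ι) : ⁅T.px i, T.py j⁆ = 0 := by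
  refine T.ext_coord (fun k => ?_) (fun k => ?_) <;>
  simp [lie_lie, T.px_x, T.px_y, T.py_x, T.py_y, act_ite]

theorem py_lie_px (i j : ι) : ⁅T.py i, T.px j⁆ = 0 := by
  rw [← lie_skew, px_lie_py, neg_zero]

theorem py_lie_py (i j : ι) : ⁅T.py i, T.py j⁆ = 0 := by
  refine T.ext_coord (fun k => ?_) (fun k => ?_) <;>
  simp [lie_lie, T.py_x, T.py_y, act_ite]

theorem C_lie_px (i : ι) : ⁅T.C, T.px i⁆ = 0 := by
  refine T.ext_coord (fun k => ?_) (fun k => ?_) <;>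
  simp [lie_lie, T.px_x, T.px_y, C_act_x, C_act_y, act_ite]

theorem C_lie_hor (X : L) : ⁅T.C, T.hor X⁆ = T.hor ⁅T.C, X⁆ := by
  rw [hor_apply, hor_apply, lie_smul, lie_add, conn_C_lie]

theorem hor_px (i : ι) : T.hor (T.px i) = (1 / 2 : ℝ) • (T.px i + ⁅T.py i, T.S⁆) := by
  have : T.J ⁅T.px i, T.S⁆ = 0 := by
    refine T.ext_coord (fun k => ?_) (fun k => ?_) <;>
    simp [lie_lie, J_act_x, J_act_y, T.S_x, T.px_x, T.px_y, act_ite]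
  rw [hor_apply, conn_apply, this, J_px, sub_zero]

theorem hor_px_act_x (i j : ι) : ⁅T.hor (T.px i), T.x j⁆ = if i = j then 1 else 0 := by
  rw [← J_act_y, J_hor, J_px, T.py_y]

theorem curv_px (i j : ι) : T.curv (T.px i) (T.px j) = ⁅T.hor (T.px i), T.hor (T.px j)⁆ := by
  obtain ⟨Y, hY⟩ := T.exists_of_J_eq_zero (X := ⁅T.hor (T.px i), T.hor (T.px j)⁆) (by
    refine T.ext_coord (fun k => ?_) (fun k => ?_) <;>
    simp [lie_lie, J_act_x, J_act_y, hor_px_act_x, act_ite])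
  rw [curv_eq, hY, hor_J, sub_zero]

/-- Torsion-freeness: both sides are half the iterated vertical bracket with `S`, and ∂/∂y^i, ∂/∂y^j
commute. -/
theorem py_lie_hor_px (i j : ι) : ⁅T.py i, T.hor (T.px j)⁆ = ⁅T.py j, T.hor (T.px i)⁆ := by
  simp only [hor_px, lie_smul, lie_add, py_lie_px]
  rw [leibniz_lie (T.py i), py_lie_py, zero_lie, zero_add]

/-- The identity [J, R] = 0 in coordinates. Each term splits by Jacobi, and torsion-freeness makes
the pieces cancel in pairs. -/
theorem py_lie_curv_cyclic (l i j : ι) :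
    ⁅T.py l, T.curv (T.px i) (T.px j)⁆ + ⁅T.py i, T.curv (T.px j) (T.px l)⁆
      + ⁅T.py j, T.curv (T.px l) (T.px i)⁆ = 0 := by
  simp only [curv_px]
  rw [leibniz_lie (T.py l), leibniz_lie (T.py i), leibniz_lie (T.py j), py_lie_hor_px T l i,
    py_lie_hor_px T l j, py_lie_hor_px T i j]
  rw [← lie_skew (T.hor (T.px i)), ← lie_skew (T.hor (T.px j)) , ← lie_skew (T.hor (T.px l))]
  abel

/-- Euler's relation: the components of `R` are homogeneous of degree one in y, because C commutes
with the horizontal coordinate fields. -/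
theorem sum_y_py_lie_curv (i j : ι) :
    ∑ k, T.y k • ⁅T.py k, T.curv (T.px i) (T.px j)⁆ = T.curv (T.px i) (T.px j) := by
  have h : ⁅T.C, T.curv (T.px i) (T.px j)⁆ = 0 := by
    rw [curv_px, leibniz_lie, C_lie_hor, C_lie_hor, C_lie_px, C_lie_px]
    simp
  have hx : ∀ k, ⁅T.curv (T.px i) (T.px j), T.x k⁆ = 0 := fun k => by
    rw [← J_act_y, J_curv, zero_lie]
  rw [C, sum_lie] at h
  simp only [smul_lie_field, Finset.sum_sub_distrib] at h
  rw [sub_eq_zero.mp h]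
  conv_rhs => rw [T.decomp (T.curv (T.px i) (T.px j))]
  simp [hx]

theorem curv_add_right (X Y Y' : L) : T.curv X (Y + Y') = T.curv X Y + T.curv X Y' := by
  rw [curv_swap, curv_add_left, curv_swap T X Y, curv_swap T X Y', neg_add]

theorem curv_smul_right (a : A) (X Y : L) : T.curv X (a • Y) = a • T.curv X Y := by
  rw [curv_swap, curv_smul_left, curv_swap T X Y, smul_neg]

theorem curv_sum_left (a : ι → A) (X : ι → L) (Y : L) :
    T.curv (∑ i, a i • X i) Y = ∑ i, a i • T.curv (X i) Y := by
  let f : L →ₗ[A] L := ⟨⟨fun X => T.curv X Y, fun X X' => T.curv_add_left X X' Y⟩,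
    fun a X => T.curv_smul_left a X Y⟩
  have := map_sum f (fun i => a i • X i) Finset.univ
  simpa only [map_smul, f, LinearMap.coe_mk, AddHom.coe_mk] using this

theorem jacobi_px (j : ι) : T.jacobi (T.px j) = ∑ i, T.y i • T.curv (T.px i) (T.px j) := by
  rw [jacobi_apply]
  conv_lhs => rw [T.decomp T.S]
  rw [curv_add_left, curv_sum_left, curv_sum_left]
  simp [T.S_x, ← J_px, curv_J_left]

theorem J_px_lie_J (i : ι) (X : L) : T.J ⁅T.px i, T.J X⁆ = 0 := by
  refine T.ext_coord (fun k => ?_) (fun k => ?_) <;>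
  simp [lie_lie, J_act_x, J_act_y, T.px_x, act_ite]

theorem fnJacobi_swap (X Y : L) : T.fnJacobi X Y = - T.fnJacobi Y X := by
  simp only [fnJacobi]
  rw [← lie_skew (T.J X) (T.jacobi Y), ← lie_skew (T.jacobi X) (T.J Y), ← lie_skew X (T.jacobi Y),
    ← lie_skew (T.jacobi X) Y, ← lie_skew X (T.J Y), ← lie_skew (T.J X) Y]
  simp only [map_neg]
  abel

theorem fnJacobi_add_left (X X' Y : L) :
    T.fnJacobi (X + X') Y = T.fnJacobi X Y + T.fnJacobi X' Y := by
  simp only [fnJacobi, add_lie, map_add]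
  abel

theorem fnJacobi_smul_left (a : A) (X Y : L) : T.fnJacobi (a • X) Y = a • T.fnJacobi X Y := by
  simp only [fnJacobi, smul_lie_field, map_sub, map_smul, J_jacobi, jacobi_J]
  module

/-- In coordinates Φ_j = y^i R_ij. Antisymmetrizing ∂Φ_j/∂y^l in l and j gives 2R_lj from
differentiating y^i, and one more R_lj from [J, R] = 0 with Euler's relation. -/
theorem fnJacobi_px (l j : ι) :
    T.fnJacobi (T.px l) (T.px j) = (3 : ℝ) • T.curv (T.px l) (T.px j) := by
  have v : ∀ i j, T.J ⁅T.px i, T.jacobi (T.px j)⁆ = 0 := fun i j => by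
    obtain ⟨Y, hY⟩ := T.exists_jacobi (T.px j)
    rw [hY, J_px_lie_J]
  have v' : T.J ⁅T.jacobi (T.px l), T.px j⁆ = 0 := by rw [← lie_skew, map_neg, v, neg_zero]
  have w : ∀ l j, ⁅T.py l, T.jacobi (T.px j)⁆ = T.curv (T.px l) (T.px j)
      + ∑ i, T.y i • ⁅T.py l, T.curv (T.px i) (T.px j)⁆ := fun l j => by
    rw [jacobi_px, lie_sum]
    simp [T.py_y, Finset.sum_add_distrib, add_comm]
  have s : ∑ i, T.y i • ⁅T.py l, T.curv (T.px i) (T.px j)⁆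
      - ∑ i, T.y i • ⁅T.py j, T.curv (T.px i) (T.px l)⁆ = T.curv (T.px l) (T.px j) := by
    rw [← sum_y_py_lie_curv T l j, ← Finset.sum_sub_distrib]
    refine Finset.sum_congr rfl fun i _ => ?_
    rw [← smul_sub]
    congr 1
    have := T.py_lie_curv_cyclic l i j
    rw [curv_swap T (T.px l) (T.px i), curv_swap T (T.px j) (T.px l), lie_neg, lie_neg] at this
    rw [← sub_eq_zero, ← this]
    abel
  rw [fnJacobi, J_px, J_px, v, v', px_lie_py, py_lie_px, ← lie_skew (T.jacobi (T.px l)), w, w,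
    curv_swap T (T.px j) (T.px l)]
  simp only [map_zero]
  linear_combination (norm := module) s

theorem fnJacobi_smul_right (a : A) (X Y : L) : T.fnJacobi X (a • Y) = a • T.fnJacobi X Y := by
  rw [fnJacobi_swap, fnJacobi_smul_left, fnJacobi_swap T Y, smul_neg, neg_neg]

theorem fnJacobi_add_right (X Y Y' : L) :
    T.fnJacobi X (Y + Y') = T.fnJacobi X Y + T.fnJacobi X Y' := by
  rw [fnJacobi_swap, fnJacobi_add_left, fnJacobi_swap T Y, fnJacobi_swap T Y', neg_add, neg_neg,
    neg_neg]

theorem fnJacobi_zero_right (X : L) : T.fnJacobi X 0 = 0 := by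
  simp [fnJacobi]

theorem curv_zero_right (X : L) : T.curv X 0 = 0 := by
  simpa using T.curv_smul_right 0 X 0

/-- Both sides are tensorial, so coordinate fields suffice, and both vanish on vertical arguments.
-/
theorem fnJacobi_eq (X Y : L) : T.fnJacobi X Y = (3 : ℝ) • T.curv X Y := by
  have base : ∀ j Y, T.fnJacobi (T.J (T.px j)) Y = 0 := by
    intro j
    refine T.coord_induction (T.fnJacobi_zero_right _) (fun X Y hX hY => ?_) (fun a X hX => ?_)
      (fun i => ?_) (fun i => ?_)
    · rw [fnJacobi_add_right, hX, hY, add_zero]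
    · rw [fnJacobi_smul_right, hX, smul_zero]
    · obtain ⟨Z, hZ⟩ := T.exists_jacobi (T.px i)
      simp only [fnJacobi, J_J, jacobi_J, zero_lie, hZ, J_lie_J_J, map_zero]
      rw [J_px, J_px, py_lie_py, map_zero]
      abel
    · rw [← J_px]
      simp only [fnJacobi, J_J, jacobi_J, zero_lie, lie_zero, map_zero]
      abel
  revert X
  refine T.coord_induction ?_ (fun X Y hX hY => ?_) (fun a X hX => ?_) (fun i => ?_) (fun i => ?_)
  · rw [fnJacobi_swap, curv_swap, fnJacobi_zero_right, curv_zero_right]; simp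
  · rw [fnJacobi_add_left, curv_add_left, hX, hY, smul_add]
  · rw [fnJacobi_smul_left, curv_smul_left, hX]; module
  · revert Y
    refine T.coord_induction ?_ (fun X Y hX hY => ?_) (fun a X hX => ?_) (fun j => ?_)
      (fun j => ?_)
    · rw [fnJacobi_zero_right, curv_zero_right, smul_zero]
    · rw [fnJacobi_add_right, hX, hY, curv_add_right, smul_add]
    · rw [fnJacobi_smul_right, hX, curv_smul_right]; module
    · exact T.fnJacobi_px i j
    · rw [fnJacobi_swap, ← J_px, base, curv_swap, curv_J_left]; simp
  · rw [← J_px, base, curv_J_left, smul_zero]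

end SprayGerm
end Rapcsak

/-! ### Jets, formal solutions and the necessity of the conditions. -/

namespace Rapcsak

variable {ι A L : Type*} [Fintype ι] [DecidableEq ι] [CommRing A] [Algebra ℝ A]
  [LieRing L] [Module A L] [LieRingModule L A] [LieRinehartRing A L] [LieAlgebra ℝ L]
  [LieRinehartAlgebra ℝ A L]

namespace SprayGerm

variable (T : SprayGerm ι A L)

/-- The `k`-jet of `f` vanishes. -/
def Jet : ℕ → A → Prop
  | 0, f => T.ev f = 0
  | k + 1, f => T.ev f = 0 ∧ ∀ X : L, Jet k ⁅X, f⁆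

variable {T} {k : ℕ} {f g : A}

theorem Jet.ev (h : T.Jet k f) : T.ev f = 0 := by
  cases k with
  | zero => exact h
  | succ k => exact h.1

theorem Jet.act (h : T.Jet (k + 1) f) (X : L) : T.Jet k ⁅X, f⁆ := h.2 X

theorem Jet.of_succ (h : T.Jet (k + 1) f) : T.Jet k f := by
  induction k generalizing f with
  | zero => exact h.1
  | succ k ih => exact ⟨h.1, fun X => ih (h.2 X)⟩

theorem Jet.zero : T.Jet k 0 := by
  induction k with
  | zero => exact map_zero T.ev
  | succ k ih => exact ⟨map_zero T.ev, fun X => by rwa [lie_zero]⟩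

theorem Jet.add (hf : T.Jet k f) (hg : T.Jet k g) : T.Jet k (f + g) := by
  induction k generalizing f g with
  | zero => simp only [Jet] at *; rw [map_add, hf, hg, add_zero]
  | succ k ih =>
    exact ⟨by rw [map_add, hf.1, hg.1, add_zero], fun X => by
      rw [lie_add]; exact ih (hf.2 X) (hg.2 X)⟩

theorem Jet.mul_left (a : A) (hf : T.Jet k f) : T.Jet k (a * f) := by
  induction k generalizing f a with
  | zero => simp only [Jet] at *; rw [map_mul, hf, mul_zero]
  | succ k ih =>
    exact ⟨by rw [map_mul, hf.1, mul_zero], fun X => by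
      rw [act_mul]; exact (ih a (hf.2 X)).add (ih _ hf.of_succ)⟩

theorem Jet.neg (hf : T.Jet k f) : T.Jet k (-f) := by
  rw [← neg_one_mul]; exact hf.mul_left _

theorem Jet.sub (hf : T.Jet k f) (hg : T.Jet k g) : T.Jet k (f - g) := by
  rw [sub_eq_add_neg]; exact hf.add hg.neg

theorem Jet.real_smul (r : ℝ) (hf : T.Jet k f) : T.Jet k (r • f) := by
  rw [Algebra.smul_def]; exact hf.mul_left _

theorem Jet.of_real_smul {r : ℝ} (hr : r ≠ 0) (hf : T.Jet k (r • f)) : T.Jet k f := by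
  have := hf.real_smul r⁻¹
  rwa [smul_smul, inv_mul_cancel₀ hr, one_smul] at this

theorem Jet.of_mul {a : A} (ha : T.ev a ≠ 0) (hf : T.Jet k (a * f)) : T.Jet k f := by
  obtain ⟨u, rfl⟩ := T.isUnit_of_ev a ha
  have := hf.mul_left (↑u⁻¹ : A)
  rwa [Units.inv_mul_cancel_left] at this

theorem Jet.Om {Q : A} (hQ : T.Jet (k + 2) Q) (X Y : L) : T.Jet k (T.Om Q X Y) :=
  (((hQ.act _).act _).sub ((hQ.act _).act _)).sub (hQ.act _).of_succ

variable (T)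

/-- `F` is a solution of order `l + 2`. -/
structure Sol (l : ℕ) (F : A) : Prop where
  hom : T.Jet (l + 1) (⁅T.C, F⁆ - F)
  conn : ∀ X Y, T.Jet l (T.ins1 F T.conn X Y)
  curv : ∀ X Y, T.Jet l (T.ins1 F T.jacobi X Y)

/-- `X` is a horizontal eigenfield of `Φ` with eigenfunction `lam`. -/
structure Eig (lam : A) (X : L) : Prop where
  hor : T.hor X = X
  jacobi : T.jacobi X = lam • T.J X

/-- The prolonged first compatibility condition. -/
structure Compat (e : ι → L) (F : A) : Prop where
  curv : ∀ X Y Z, T.Jet 1 (T.ins2 F T.curv X Y Z)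
  jacobi : ∀ X Y Z, T.Jet 1 (T.ins2 F (fnSq T.jacobi) X Y Z)
  frame : ∀ i j k, i ≠ j → j ≠ k → i ≠ k → T.Jet 1 (T.cyc F (T.J (e i)) (e j) (e k))

/-- The third order identity. -/
def ThirdOrder (F : A) (X Y : L) : Prop :=
  T.ev ⁅⁅T.hor X, T.jacobi X⁆, T.Om F (T.J Y) Y⁆
      - T.ev ⁅⁅T.hor Y, T.jacobi Y⁆, T.Om F X (T.J X)⁆ =
    T.ev ⁅T.jacobi X, T.cyc F (T.J Y) (T.hor X) (T.hor Y)⁆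
      - T.ev ⁅T.hor X, T.cyc F (T.J Y) (T.jacobi X) (T.hor Y) - T.cyc F (T.J Y) (T.jacobi Y) X⁆
      - T.ev ⁅T.jacobi Y, T.cyc F (T.J X) (T.hor X) (T.hor Y)⁆
      + T.ev ⁅T.hor Y, T.cyc F (T.J X) (T.jacobi X) Y - T.cyc F (T.J X) (T.jacobi Y) X⁆

variable {T} {l : ℕ} {F : A} {X Y Z : L} {a b c : A}

theorem Sol.hor_hor (h : T.Sol l F) (hX : T.hor X = X) (hY : T.hor Y = Y) :
    T.Jet l (T.Om F X Y) := by
  have := h.conn (T.hor X) (T.hor Y)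
  rw [ins1_conn_hor] at this
  rw [← hX, ← hY]
  exact this.of_real_smul two_ne_zero

theorem Eig.ins1 (hX : T.Eig a X) (hY : T.Eig b Y) (F : A) :
    T.ins1 F T.jacobi X Y = (a - b) * T.Om F (T.J X) Y := by
  rw [SprayGerm.ins1, hX.jacobi, hY.jacobi, Om_smul_left, Om_smul_right, Om_J_right]
  ring

/-- On eigenfields i_ΦΩ is the difference of the eigenvalues times Ω(JX,Y), and that difference is
invertible. -/
theorem Sol.J_hor (h : T.Sol l F) (hX : T.Eig a X) (hY : T.Eig b Y) (hab : T.ev a ≠ T.ev b) :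
    T.Jet l (T.Om F (T.J X) Y) := by
  have := h.curv X Y
  rw [hX.ins1 hY] at this
  exact this.of_mul (by rwa [map_sub, sub_ne_zero])

/-- Here the Hessian at the base point is intrinsic, so derivatives of eigenfunctions drop out of
second-order expressions. -/
theorem ev_act_act_mul (hf : T.Jet 1 f) (a : A) (X Y : L) :
    T.ev ⁅X, ⁅Y, a * f⁆⁆ = T.ev a * T.ev ⁅X, ⁅Y, f⁆⁆ := by
  have h₁ : T.ev ⁅X, f⁆ = 0 := hf.2 X
  have h₂ : T.ev ⁅Y, f⁆ = 0 := hf.2 Y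
  simp only [act_mul, lie_add, map_add, map_mul, h₁, h₂, hf.ev]
  ring

theorem ev_act_act_comm (hf : T.Jet 1 f) (X Y : L) : T.ev ⁅X, ⁅Y, f⁆⁆ = T.ev ⁅Y, ⁅X, f⁆⁆ := by
  have h : T.ev ⁅⁅X, Y⁆, f⁆ = 0 := hf.2 _
  rwa [lie_lie, map_sub, sub_eq_zero] at h

/-- After closedness, the second derivatives of Ω(JX,X) and Ω(JY,Y), which need not vanish, enter
only through commutators and cancel against the left side of the identity. The rest involves
Hessians of functions with vanishing 1-jet. -/
theorem thirdOrder_iff (h : T.Sol 1 F) (hX : T.Eig a X) (hY : T.Eig b Y)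
    (hab : T.ev a ≠ T.ev b) : T.ThirdOrder F X Y ↔
      T.ev ⁅T.J X, ⁅T.J Y, T.Om F X Y⁆⁆ + T.ev ⁅T.J X, ⁅Y, T.Om F (T.J X) Y⁆⁆
        - T.ev ⁅X, ⁅T.J Y, T.Om F (T.J X) Y⁆⁆ = 0 := by
  have hH := h.hor_hor hX.hor hY.hor
  have hE := h.J_hor hX hY hab
  have s₁ : T.Om F (T.J Y) X = T.Om F (T.J X) Y := T.Om_J_symm F Y X
  have s₂ : T.Om F X (T.J Y) = - T.Om F (T.J X) Y := T.Om_J_right F X Y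
  have s₃ : T.Om F Y (T.J X) = - T.Om F (T.J X) Y := by rw [Om_J_right, s₁]
  have s₄ : T.Om F X (T.J X) = - T.Om F (T.J X) X := T.Om_J_right F X X
  have s₅ : T.Om F Y (T.J Y) = - T.Om F (T.J Y) Y := T.Om_J_right F Y Y
  have c₁ := ev_act_act_mul hE a X (T.J Y)
  have c₂ := ev_act_act_mul hE b Y (T.J X)
  have c₃ := ev_act_act_comm hH (T.J X) (T.J Y)
  have c₄ := ev_act_act_comm hE X (T.J Y)
  have c₅ := ev_act_act_comm hE Y (T.J X)
  have c₆ := ev_act_act_mul hE b X (T.J Y)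
  have c₇ := ev_act_act_mul hE a Y (T.J X)
  have z₁ : ∀ (Z : L) (a : A), T.ev ⁅Z, a * ⁅T.J Y, T.Om F (T.J X) Y⁆⁆ =
      T.ev a * T.ev ⁅Z, ⁅T.J Y, T.Om F (T.J X) Y⁆⁆ := fun Z a => by
    rw [act_mul, map_add, map_mul, map_mul, (hE.act (T.J Y)).ev]; ring
  have z₂ : ∀ (Z : L) (a : A), T.ev ⁅Z, a * ⁅T.J X, T.Om F (T.J X) Y⁆⁆ =
      T.ev a * T.ev ⁅Z, ⁅T.J X, T.Om F (T.J X) Y⁆⁆ := fun Z a => by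
    rw [act_mul, map_add, map_mul, map_mul, (hE.act (T.J X)).ev]; ring
  -- The third-order identity is, up to sign, this expression multiplied by the difference of the
  -- eigenvalues.
  have key : (T.ev a - T.ev b) * (T.ev ⁅T.J X, ⁅T.J Y, T.Om F X Y⁆⁆
      + T.ev ⁅T.J X, ⁅Y, T.Om F (T.J X) Y⁆⁆ - T.ev ⁅X, ⁅T.J Y, T.Om F (T.J X) Y⁆⁆) = 0 ↔
      T.ThirdOrder F X Y := by
    simp only [ThirdOrder, hX.hor, hY.hor, hX.jacobi, hY.jacobi, cyc_eq, Om_smul_left,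
      Om_smul_right, Om_J_J, s₁, s₂, s₃, s₄, s₅, lie_lie, smul_act, mul_zero, lie_zero, lie_sub,
      lie_add, lie_neg, map_add, map_sub, map_neg, map_mul, z₁, z₂, c₁, c₂, c₆, c₇, ← c₃,
      ← c₄, c₅]
    constructor <;> intro h
    · linear_combination - h
    · linear_combination - h
  rw [← key, mul_eq_zero, or_iff_right (sub_ne_zero.mpr hab)]

/-- Only first derivatives of values of Ω enter, hence only the 3-jet of the function. -/
theorem thirdOrder_congr {G : A} (h : T.Jet 3 (G - F)) (X Y : L) (hG : T.ThirdOrder G X Y) :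
    T.ThirdOrder F X Y := by
  have hO : ∀ W X Y, T.ev ⁅W, T.Om G X Y⁆ = T.ev ⁅W, T.Om F X Y⁆ := fun W X Y => by
    have := ((Jet.Om h X Y).act W).ev
    rwa [Om_sub_fun, lie_sub, map_sub, sub_eq_zero] at this
  simp only [ThirdOrder, cyc, lie_sub, lie_add, map_sub, map_add, hO] at hG ⊢
  exact hG

theorem compat_congr {G : A} {e : ι → L} (h : T.Jet 3 (G - F)) (hG : T.Compat e G) :
    T.Compat e F := by
  have hO : ∀ X Y, T.Om F X Y = T.Om G X Y - T.Om (G - F) X Y := fun X Y => by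
    rw [Om_sub_fun]; ring
  have key : ∀ X X' Y Y' Z Z', T.Jet 1 (T.Om G X X' + T.Om G Y Y' + T.Om G Z Z') →
      T.Jet 1 (T.Om F X X' + T.Om F Y Y' + T.Om F Z Z') := fun X X' Y Y' Z Z' hJ => by
    have := hJ.sub (((Jet.Om h X X').add (Jet.Om h Y Y')).add (Jet.Om h Z Z'))
    rw [hO, hO, hO]
    convert this using 1
    ring
  exact ⟨fun _ _ _ => key _ _ _ _ _ _ (hG.curv _ _ _),
    fun _ _ _ => key _ _ _ _ _ _ (hG.jacobi _ _ _),
    fun _ _ _ h₁ h₂ h₃ => key _ _ _ _ _ _ (hG.frame _ _ _ h₁ h₂ h₃)⟩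

/-- Each expression is a sum of values and first derivatives of quantities whose 2-jets vanish for a
fourth-order solution. -/
theorem Sol.compat {e : ι → L} {lam : ι → A} (he : ∀ i, T.Eig (lam i) (e i))
    (hlam : ∀ i j, i ≠ j → T.ev (lam i) ≠ T.ev (lam j)) (h : T.Sol 2 F) : T.Compat e F where
  curv X Y Z := by
    have hh : ∀ X Y, T.Jet 2 (T.Om F (T.hor X) (T.hor Y)) := fun X Y =>
      h.hor_hor (T.hor_hor X) (T.hor_hor Y)
    rw [ins2_curv_eq, cyc_eq]
    exact ((((hh _ _).act _).add ((hh _ _).act _)).add ((hh _ _).act _)).sub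
      (((hh _ _).add (hh _ _)).add (hh _ _)).of_succ
  jacobi X Y Z := by
    rw [ins2_fnSq_jacobi]
    exact (((((h.curv _ _).act _).add ((h.curv _ _).act _)).add ((h.curv _ _).act _)).sub
      (((h.curv _ _).add (h.curv _ _)).add (h.curv _ _)).of_succ).real_smul 2
  frame i j k hij hjk hik := by
    rw [cyc_eq, Om_swap T F (e k)]
    have h₁ := h.J_hor (he i) (he k) (hlam i k hik)
    have h₂ := h.J_hor (he i) (he j) (hlam i j hij)
    exact (((h.hor_hor (he j).hor (he k).hor).act _).add (h₁.neg.act _)).add (h₂.act _)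

theorem Sol.thirdOrder (h : T.Sol 2 F) (hX : T.Eig a X) (hY : T.Eig b Y)
    (hab : T.ev a ≠ T.ev b) : T.ThirdOrder F X Y := by
  have hH := h.hor_hor hX.hor hY.hor
  have hE := h.J_hor hX hY hab
  have h₁ : T.Sol 1 F := ⟨h.hom.of_succ, fun X Y => (h.conn X Y).of_succ,
    fun X Y => (h.curv X Y).of_succ⟩
  rw [thirdOrder_iff h₁ hX hY hab, ((hH.act _).act _).ev, ((hE.act _).act _).ev,
    ((hE.act _).act _).ev]
  ring

/-- The vanishing of i_RΩ = i_[J,Φ]Ω / 3 and of i_[Φ,Φ]Ω gives two relations among the derivatives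
of Ω(JX,Y), Ω(JY,Z), Ω(JZ,X) along JZ, JX, JY. Distinct eigenvalues allow one derivative to be
eliminated. -/
theorem Compat.cyclic {e : ι → L} (h : T.Sol 1 F) (hc : T.Compat e F) (hX : T.Eig a X)
    (hY : T.Eig b Y) (hZ : T.Eig c Z) (hab : T.ev a ≠ T.ev b) (hbc : T.ev b ≠ T.ev c)
    (hca : T.ev c ≠ T.ev a) :
    T.Jet 1 (⁅T.J Y, T.Om F (T.J Z) X⁆ - ⁅T.J Z, T.Om F (T.J X) Y⁆) := by
  have r := (hc.curv X Y Z).real_smul 3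
  have r' : (3 : ℝ) • T.ins2 F T.curv X Y Z = T.ins2 F T.fnJacobi X Y Z := by
    simp only [ins2, fnJacobi_eq, Om_real_smul_left, smul_add]
  rw [r', Om_fnJacobi] at r
  have p := hc.jacobi X Y Z
  rw [ins2_fnSq_jacobi] at p
  have p := p.of_real_smul two_ne_zero
  have r₂ := r.add (((h.curv (⁅T.J X, Y⁆ + ⁅X, T.J Y⁆) Z).add
    (h.curv (⁅T.J Y, Z⁆ + ⁅Y, T.J Z⁆) X)).add (h.curv (⁅T.J Z, X⁆ + ⁅Z, T.J X⁆) Y))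
  have p₂ := p.add (((h.curv (⁅T.jacobi X, Y⁆ + ⁅X, T.jacobi Y⁆) Z).add
    (h.curv (⁅T.jacobi Y, Z⁆ + ⁅Y, T.jacobi Z⁆) X)).add
      (h.curv (⁅T.jacobi Z, X⁆ + ⁅Z, T.jacobi X⁆) Y))
  rw [sub_add_cancel] at r₂ p₂
  rw [hX.ins1 hY, hY.ins1 hZ, hZ.ins1 hX] at r₂ p₂
  rw [hX.jacobi, hY.jacobi, hZ.jacobi] at p₂
  simp only [smul_act, act_mul] at r₂ p₂
  have e₁ := h.J_hor hX hY hab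
  have e₂ := h.J_hor hY hZ hbc
  have e₃ := h.J_hor hZ hX hca
  -- Subtracting after multiplication by `a` eliminates the derivative along JX; the two added terms
  -- cancel the derivatives of the eigenfunctions.
  have q := (((r₂.mul_left a).sub p₂).add
    (e₁.mul_left (c * ⁅T.J Z, a - b⁆ - a * ⁅T.J Z, a - b⁆))).add
    (e₃.mul_left (b * ⁅T.J Y, c - a⁆ - a * ⁅T.J Y, c - a⁆))
  refine Jet.of_mul (a := (a - b) * (c - a)) ?_ ?_
  · rw [map_mul, map_sub, map_sub]
    exact mul_ne_zero (sub_ne_zero.mpr hab) (sub_ne_zero.mpr hca)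
  · convert q using 1
    ring

end SprayGerm
end Rapcsak

/-! ### Eigenframes, and functions with a prescribed quartic part. -/

namespace Rapcsak

variable {ι A L : Type*} [Fintype ι] [DecidableEq ι] [CommRing A] [Algebra ℝ A]
  [LieRing L] [Module A L] [LieRingModule L A] [LieRinehartRing A L] [LieAlgebra ℝ L]
  [LieRinehartAlgebra ℝ A L]

namespace SprayGerm

variable (T : SprayGerm ι A L)

/-- Horizontal eigenfields with pairwise distinct eigenvalues, nonzero at the base point, one of
them being the spray. -/
structure EigenFrame (lam : ι → A) (e : ι → L) (o : ι) : Prop where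
  eig : ∀ i, T.Eig (lam i) (e i)
  distinct : ∀ i j, i ≠ j → T.ev (lam i) ≠ T.ev (lam j)
  ne_zero : ∀ i, ∃ f : A, T.ev ⁅e i, f⁆ ≠ 0
  spray : e o = T.S

/-- The frame `h i`, `v i = J (h i)`. -/
def fr (e : ι → L) : ι ⊕ ι → L := Sum.elim e fun i => T.J (e i)

@[simp] theorem fr_inl (e : ι → L) (i : ι) : T.fr e (.inl i) = e i := rfl

@[simp] theorem fr_inr (e : ι → L) (i : ι) : T.fr e (.inr i) = T.J (e i) := rfl

variable {T} {lam : ι → A} {e : ι → L} {o : ι}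

theorem eq_sum_hor_px {X : L} (hX : T.hor X = X) : X = ∑ k, ⁅X, T.x k⁆ • T.hor (T.px k) := by
  conv_lhs => rw [← hX, T.decomp X]
  simp [map_sum, ← J_px, hor_J]

theorem jacobi_eq_sum (X : L) : T.jacobi X = ∑ k, ⁅X, T.x k⁆ • T.jacobi (T.px k) := by
  conv_lhs => rw [T.decomp X]
  simp [map_sum, ← J_px, jacobi_J]

/-- The matrix of the components of `e`. -/
def compMatrix (T : SprayGerm ι A L) (e : ι → L) : Matrix ι ι A :=
  Matrix.of fun i k => ⁅e i, T.x k⁆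

/-- At the base point the rows are eigenvectors of the matrix of `Φ` for distinct eigenvalues, hence
independent. A zero row is excluded because a horizontal field is determined by its base components.
-/
theorem EigenFrame.isUnit_det (h : T.EigenFrame lam e o) : IsUnit (T.compMatrix e).det := by
  apply T.isUnit_of_ev
  have hdet : T.ev (T.compMatrix e).det = ((T.compMatrix e).map T.ev).det :=
    T.ev.toRingHom.map_det _
  rw [hdet]
  let P : Matrix ι ι ℝ := Matrix.of fun k j => T.ev ⁅T.jacobi (T.px k), T.y j⁆
  have hP : ∀ i j, ∑ k, T.ev ⁅e i, T.x k⁆ * P k j = T.ev (lam i) * T.ev ⁅e i, T.x j⁆ := by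
    intro i j
    have h₁ := congrArg (fun X => T.ev ⁅X, T.y j⁆) ((h.eig i).jacobi)
    simp only [smul_act, map_mul, J_act_y] at h₁
    rw [← h₁, jacobi_eq_sum, sum_lie, map_sum]
    simp [P]
  have hli : LinearIndependent ℝ ((T.compMatrix e).map T.ev).row := by
    refine Module.End.eigenvectors_linearIndependent' P.vecMulLinear (fun i => T.ev (lam i))
      (fun i j hij => by_contra fun hne => h.distinct i j hne hij) _ fun i => ?_
    rw [Module.End.hasEigenvector_iff, Module.End.mem_eigenspace_iff]
    refine ⟨?_, fun h0 => ?_⟩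
    · ext j
      simpa [Matrix.vecMul, dotProduct, compMatrix, Matrix.row] using hP i j
    · obtain ⟨f, hf⟩ := h.ne_zero i
      apply hf
      rw [eq_sum_hor_px (h.eig i).hor, sum_lie, map_sum]
      refine Finset.sum_eq_zero fun k _ => ?_
      have : T.ev ⁅e i, T.x k⁆ = 0 := congrFun h0 k
      rw [smul_act, map_mul, this, zero_mul]
  rw [Matrix.linearIndependent_rows_iff_isUnit] at hli
  exact ((Matrix.isUnit_iff_isUnit_det _).mp hli).ne_zero

theorem EigenFrame.hor_px_mem (h : T.EigenFrame lam e o) (k : ι) :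
    ∃ c : ι → A, T.hor (T.px k) = ∑ i, c i • e i := by
  refine ⟨fun i => (T.compMatrix e)⁻¹ k i, ?_⟩
  have hm := Matrix.nonsing_inv_mul (T.compMatrix e) h.isUnit_det
  have : ∀ i, e i = ∑ j, T.compMatrix e i j • T.hor (T.px j) := fun i =>
    eq_sum_hor_px (h.eig i).hor
  calc T.hor (T.px k) = ∑ j, (1 : Matrix ι ι A) k j • T.hor (T.px j) := by
        simp [Matrix.one_apply]
    _ = _ := by
        simp only [← hm, Matrix.mul_apply, Finset.sum_smul, mul_smul]
        rw [Finset.sum_comm]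
        refine Finset.sum_congr rfl fun i _ => ?_
        conv_rhs => rw [this i]
        rw [Finset.smul_sum]

theorem EigenFrame.span (h : T.EigenFrame lam e o) :
    Submodule.span A (Set.range (T.fr e)) = ⊤ := by
  rw [eq_top_iff]
  have he : ∀ i, e i ∈ Submodule.span A (Set.range (T.fr e)) := fun i =>
    Submodule.subset_span ⟨.inl i, rfl⟩
  have hv : ∀ i, T.J (e i) ∈ Submodule.span A (Set.range (T.fr e)) := fun i =>
    Submodule.subset_span ⟨.inr i, rfl⟩
  have hy : ∀ k, T.py k ∈ Submodule.span A (Set.range (T.fr e)) := fun k => by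
    obtain ⟨c, hc⟩ := h.hor_px_mem k
    rw [← J_px, ← J_hor, hc, map_sum]
    exact Submodule.sum_mem _ fun i _ => by
      rw [map_smul]; exact Submodule.smul_mem _ _ (hv i)
  rintro X -
  refine T.coord_induction (Submodule.zero_mem _) (fun _ _ => Submodule.add_mem _)
    (fun a _ => Submodule.smul_mem _ a) (fun k => ?_) hy X
  obtain ⟨c, hc⟩ := h.hor_px_mem k
  obtain ⟨Y, hY⟩ := T.exists_ver (T.px k)
  rw [sub_eq_iff_eq_add.mp hY, hc, J_apply]
  exact Submodule.add_mem _ (Submodule.sum_mem _ fun i _ => Submodule.smul_mem _ _ (hy i))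
    (Submodule.sum_mem _ fun i _ => Submodule.smul_mem _ _ (he i))

theorem EigenFrame.exists_dual (h : T.EigenFrame lam e o) : ∃ ξ : ι ⊕ ι → A,
    (∀ a, T.ev (ξ a) = 0) ∧ ∀ a b, T.ev ⁅T.fr e a, ξ b⁆ = if a = b then 1 else 0 := by
  let z : ι ⊕ ι → A := Sum.elim T.x T.y
  let p : ι ⊕ ι → L := Sum.elim T.px T.py
  have hpz : ∀ c d, ⁅p c, z d⁆ = (1 : Matrix (ι ⊕ ι) (ι ⊕ ι) A) c d := by
    rintro (c | c) (d | d) <;> simp [p, z, T.px_x, T.px_y, T.py_x, T.py_y, Matrix.one_apply]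
  have hN : ∀ c, ∃ N : ι ⊕ ι → A, ∑ a, N a • T.fr e a = p c := fun c =>
    (Submodule.mem_span_range_iff_exists_fun A).mp (h.span ▸ Submodule.mem_top)
  choose N hN using hN
  have hNK : Matrix.of N * Matrix.of (fun a d => ⁅T.fr e a, z d⁆) = 1 := by
    ext c d
    rw [← hpz, ← hN, sum_lie]
    simp [Matrix.mul_apply]
  rw [mul_eq_one_comm] at hNK
  -- Real combinations of the centred coordinates; the inverse change of frame is frozen at the base
  -- point, so duality holds there only.
  refine ⟨fun b => ∑ d, T.ev (N d b) • (z d - algebraMap ℝ A (T.ev (z d))), fun a => ?_,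
    fun a b => ?_⟩
  · simp [map_sum]
  · have := congrArg T.ev (congrFun (congrFun hNK a) b)
    simp only [Matrix.mul_apply, Matrix.of_apply, map_sum, map_mul, Matrix.one_apply] at this
    simp only [lie_sum, lie_smul, lie_sub, act_algebraMap, sub_zero, map_sum, map_smul]
    rw [apply_ite T.ev, map_one, map_zero] at this
    rw [← this]
    simp [mul_comm]

/-- Vanishing of the jet of a tensorial expression need only be tested on the frame. -/
theorem EigenFrame.jet_linear (h : T.EigenFrame lam e o) {k : ℕ} {t : L → A}
    (hadd : ∀ X Y, t (X + Y) = t X + t Y) (hsmul : ∀ (a : A) X, t (a • X) = a * t X)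
    (ht : ∀ a, T.Jet k (t (T.fr e a))) (X : L) : T.Jet k (t X) := by
  have hX : X ∈ Submodule.span A (Set.range (T.fr e)) := h.span ▸ Submodule.mem_top
  induction hX using Submodule.span_induction with
  | mem X hX => obtain ⟨a, rfl⟩ := hX; exact ht a
  | zero =>
    have := hsmul 0 0
    rw [zero_smul, zero_mul] at this
    rw [this]; exact Jet.zero
  | add X Y _ _ hX hY => rw [hadd]; exact hX.add hY
  | smul a X _ hX => rw [hsmul]; exact hX.mul_left a

theorem EigenFrame.jet_succ (h : T.EigenFrame lam e o) {k : ℕ} {f : A} (h0 : T.ev f = 0)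
    (hf : ∀ a, T.Jet k ⁅T.fr e a, f⁆) : T.Jet (k + 1) f :=
  ⟨h0, h.jet_linear (fun X Y => add_lie X Y f) (fun a X => smul_act a f X) hf⟩

theorem EigenFrame.jet_two (h : T.EigenFrame lam e o) {f : A} (h1 : T.Jet 1 f)
    (hf : ∀ a b, T.ev ⁅T.fr e a, ⁅T.fr e b, f⁆⁆ = 0) : T.Jet 2 f :=
  h.jet_succ h1.ev fun b => h.jet_succ (h1.act _).ev fun a => hf a b

theorem EigenFrame.jet_three (h : T.EigenFrame lam e o) {f : A} (h2 : T.Jet 2 f)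
    (hf : ∀ a b c, T.ev ⁅T.fr e a, ⁅T.fr e b, ⁅T.fr e c, f⁆⁆⁆ = 0) : T.Jet 3 f :=
  h.jet_succ h2.ev fun c => h.jet_two (h2.act _) fun a b => hf a b c

theorem Jet.mul_of_ev {k : ℕ} {f g : A} (hf : T.ev f = 0) (hg : T.Jet k g) :
    T.Jet (k + 1) (f * g) := by
  induction k generalizing g with
  | zero =>
    have hg : T.ev g = 0 := hg
    refine ⟨by rw [map_mul, hf, zero_mul], fun X => ?_⟩
    simp [Jet, hf, hg]
  | succ k ih =>
    refine ⟨by rw [map_mul, hf, zero_mul], fun X => ?_⟩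
    rw [act_mul]
    exact (ih (hg.act X)).add (hg.mul_left _)

theorem Jet.sum {k : ℕ} {κ : Type*} (s : Finset κ) {f : κ → A} (hf : ∀ i ∈ s, T.Jet k (f i)) :
    T.Jet k (∑ i ∈ s, f i) :=
  Finset.sum_induction _ (T.Jet k) (fun _ _ => Jet.add) Jet.zero hf

/-- Q is the Taylor polynomial (1/24) Σ β ξ ξ ξ ξ, assembled one factor at a time. Each factor
raises the order of vanishing by one, so the Leibniz rule keeps only the terms where a derivative
hits that factor; they are equal by symmetry of β, which explains 1/2, 1/3 and 1/4. -/
theorem EigenFrame.exists_quartic (h : T.EigenFrame lam e o)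
    {β : ι ⊕ ι → ι ⊕ ι → ι ⊕ ι → ι ⊕ ι → ℝ} (s₁ : ∀ a b c d, β a b c d = β b a c d)
    (s₂ : ∀ a b c d, β a b c d = β a c b d) (s₃ : ∀ a b c d, β a b c d = β a b d c) :
    ∃ Q : A, T.Jet 3 Q ∧
      ∀ a b c d, T.ev ⁅T.fr e a, ⁅T.fr e b, ⁅T.fr e c, ⁅T.fr e d, Q⁆⁆⁆⁆ = β a b c d := by
  obtain ⟨ξ, hξ, hd⟩ := h.exists_dual
  let q₁ := fun a b c => ∑ d, β a b c d • ξ d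
  have j₁ : ∀ a b c, T.Jet 0 (q₁ a b c) := fun a b c => by simp [Jet, q₁, map_sum, hξ]
  have d₁ : ∀ a b c p, T.ev ⁅T.fr e p, q₁ a b c⁆ = β a b c p := fun a b c p => by
    simp only [q₁, lie_sum, lie_smul, map_sum, map_smul, hd, smul_eq_mul, mul_ite, mul_one,
      mul_zero, Finset.sum_ite_eq, Finset.mem_univ, if_true]
  let q₂ := fun a b => ∑ c, (1 / 2 : ℝ) • (ξ c * q₁ a b c)
  have j₂ : ∀ a b, T.Jet 1 (q₂ a b) := fun a b =>
    Jet.sum _ fun c _ => (Jet.mul_of_ev (hξ c) (j₁ a b c)).real_smul _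
  have d₂ : ∀ a b p q, T.ev ⁅T.fr e p, ⁅T.fr e q, q₂ a b⁆⁆ = β a b p q := fun a b p q => by
    have e₁ : ∀ c, T.ev (q₁ a b c) = 0 := fun c => (j₁ a b c).ev
    simp only [q₂, lie_sum, lie_smul, map_sum, map_smul, act_mul, lie_add, map_add, map_mul, hξ, hd,
      d₁, e₁, zero_mul, mul_zero, ite_mul, one_mul, mul_ite, smul_eq_mul, mul_add,
      Finset.sum_add_distrib, Finset.sum_ite_eq, Finset.mem_univ, if_true, add_zero, zero_add]
    rw [s₃ a b q p]
    ring
  let q₃ := fun a => ∑ b, (1 / 3 : ℝ) • (ξ b * q₂ a b)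
  have j₃ : ∀ a, T.Jet 2 (q₃ a) := fun a =>
    Jet.sum _ fun b _ => (Jet.mul_of_ev (hξ b) (j₂ a b)).real_smul _
  have d₃ : ∀ a p q r, T.ev ⁅T.fr e p, ⁅T.fr e q, ⁅T.fr e r, q₃ a⁆⁆⁆ = β a p q r :=
      fun a p q r => by
    have e₁ : ∀ b, T.ev (q₂ a b) = 0 := fun b => (j₂ a b).ev
    have e₂ : ∀ b X, T.ev ⁅X, q₂ a b⁆ = 0 := fun b X => ((j₂ a b).act X).ev
    simp only [q₃, lie_sum, lie_smul, map_sum, map_smul, act_mul, lie_add, map_add, map_mul, hξ, hd,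
      d₂, e₁, e₂, zero_mul, mul_zero, ite_mul, one_mul, mul_ite, smul_eq_mul, mul_add,
      Finset.sum_add_distrib, Finset.sum_ite_eq, Finset.mem_univ, if_true, add_zero, zero_add]
    rw [s₂ a q p r, s₂ a r p q, s₃ a p r q]
    ring
  refine ⟨∑ a, (1 / 4 : ℝ) • (ξ a * q₃ a),
    Jet.sum _ fun a _ => (Jet.mul_of_ev (hξ a) (j₃ a)).real_smul _, fun p q r s => ?_⟩
  have e₁ : ∀ b, T.ev (q₃ b) = 0 := fun b => (j₃ b).ev
  have e₂ : ∀ b X, T.ev ⁅X, q₃ b⁆ = 0 := fun b X => ((j₃ b).act X).ev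
  have e₃ : ∀ b X Y, T.ev ⁅X, ⁅Y, q₃ b⁆⁆ = 0 := fun b X Y => (((j₃ b).act Y).act X).ev
  simp only [lie_sum, lie_smul, map_sum, map_smul, act_mul, lie_add, map_add, map_mul, hξ, hd,
    d₃, e₁, e₂, e₃, zero_mul, mul_zero, ite_mul, one_mul, mul_ite, smul_eq_mul, mul_add,
    Finset.sum_add_distrib, Finset.sum_ite_eq, Finset.mem_univ, if_true, add_zero, zero_add]
  rw [s₁ q p r s, s₁ r p q s, s₂ p r q s, s₁ s p q r, s₂ p s q r, s₃ p q s r]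
  ring

end SprayGerm
end Rapcsak

/-! ### Lifting third-order solutions. -/

namespace Rapcsak

variable {ι A L : Type*} [Fintype ι] [DecidableEq ι] [CommRing A] [Algebra ℝ A]
  [LieRing L] [Module A L] [LieRingModule L A] [LieRinehartRing A L] [LieAlgebra ℝ L]
  [LieRinehartAlgebra ℝ A L]

namespace SprayGerm

variable {T : SprayGerm ι A L} {lam : ι → A} {e : ι → L} {o : ι} {F : A}

theorem EigenFrame.J_base (h : T.EigenFrame lam e o) : T.J (e o) = T.C := by rw [h.spray, J_S]

/-- For `i ≠ j` this is the Φ-equation, and for `i = o` it is homogeneity, as v_o = C. -/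
theorem EigenFrame.jet_vert_hor (h : T.EigenFrame lam e o) (hF : T.Sol 1 F) {i j : ι}
    (hij : i ≠ j ∨ i = o) : T.Jet 1 (T.Om F (T.J (e i)) (e j)) := by
  rcases hij with hij | rfl
  · exact hF.J_hor (h.eig i) (h.eig j) (h.distinct i j hij)
  · rw [h.J_base, Om_C]
    exact hF.hom.act _

theorem EigenFrame.jet_hor_hor (h : T.EigenFrame lam e o) {l : ℕ} (hF : T.Sol l F) (i j : ι) :
    T.Jet l (T.Om F (e i) (e j)) :=
  hF.hor_hor (h.eig i).hor (h.eig j).hor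

/-- The second derivatives at the base point. -/
def hess (T : SprayGerm ι A L) (e : ι → L) (f : A) (a b : ι ⊕ ι) : ℝ :=
  T.ev ⁅T.fr e a, ⁅T.fr e b, f⁆⁆

theorem hess_comm {f : A} (hf : T.Jet 1 f) (a b : ι ⊕ ι) : T.hess e f a b = T.hess e f b a :=
  ev_act_act_comm hf _ _

theorem hess_neg (f : A) (a b : ι ⊕ ι) : T.hess e (-f) a b = - T.hess e f a b := by
  simp only [hess, lie_neg, map_neg]

/-- For the triple C, S, h_k the cyclic condition is automatic: [C, S] = S and [C, h_k] is
horizontal, so every term is controlled by the Γ-equation or by homogeneity. -/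
theorem EigenFrame.jet_cyc_base (h : T.EigenFrame lam e o) (hF : T.Sol 1 F) (k : ι) :
    T.Jet 1 (T.cyc F T.C T.S (e k)) := by
  have h₁ : T.hor ⁅T.C, e k⁆ = ⁅T.C, e k⁆ := by rw [← C_lie_hor, (h.eig k).hor]
  rw [cyc, C_S, Om_swap T F ⁅T.S, e k⁆, Om_C, ← lie_skew (e k), Om_neg_left]
  exact ((hF.hor_hor T.hor_S (h.eig k).hor).add (hF.hom.act _).neg).add
    (hF.hor_hor h₁ T.hor_S).neg

open Classical in
-- Symmetries in two derivative slots hold because the relevant 1-jets vanish. The other relations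
-- are derivatives along the frame of the compatibility expressions, rewritten by closedness of Ω;
-- `quadratic` is the third-order identity. For `i = j ≠ o`, `ε` is not prescribed and is set to
-- zero.
theorem EigenFrame.quarticData (h : T.EigenFrame lam e o) (hF : T.Sol 1 F) (hc : T.Compat e F)
    (ht : ∀ i j, i ≠ j → T.ThirdOrder F (e i) (e j)) :
    QuarticData o
      (fun i j a b => if i ≠ j ∨ i = o then - T.hess e (T.Om F (T.J (e i)) (e j)) a b else 0)
      (fun i j a b => - T.hess e (T.Om F (e i) (e j)) a b)
      (fun a b c => - T.hess e ⁅T.fr e c, ⁅T.C, F⁆ - F⁆ a b) where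
  κ_swap₁ a b c := by rw [hess_comm (hF.hom.act _)]
  κ_swap₂ a b c := by
    have := ((hF.hom.act ⁅T.fr e b, T.fr e c⁆).act (T.fr e a)).ev
    rw [lie_lie, lie_sub, map_sub, sub_eq_zero] at this
    simp only [hess, this]
  ε_symm i j a b := by
    rcases eq_or_ne i j with rfl | hij
    · rfl
    · simp only [ne_eq, hij, hij.symm, not_false_eq_true, true_or, if_true,
        Om_J_symm T F (e i) (e j)]
  ε_swap i j a b := by
    split_ifs with hij
    · rw [hess_comm (h.jet_vert_hor hF hij)]
    · rfl
  η_antisymm i j a b := by rw [Om_swap, hess_neg]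
  η_swap i j a b := by rw [hess_comm (h.jet_hor_hor hF i j)]
  ε_base i a b := by
    have := ((hF.hom.act ⁅T.fr e b, T.fr e (.inr i)⁆).act (T.fr e a)).ev
    rw [lie_lie, lie_sub, map_sub, sub_eq_zero] at this
    rw [if_pos (.inr rfl), h.J_base, Om_C]
    rw [hess_comm (hF.hom.act _) (.inr i)]
    simpa only [hess, neg_inj, fr_inr] using this
  cyclic_η i j k a := by
    have h₁ := hc.curv (e i) (e j) (e k)
    rw [ins2_curv_eq, (h.eig i).hor, (h.eig j).hor, (h.eig k).hor] at h₁
    have h₂ := h₁.add (((hF.hor_hor (T.hor_hor ⁅e i, e j⁆) (h.eig k).hor).add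
      (hF.hor_hor (T.hor_hor ⁅e j, e k⁆) (h.eig i).hor)).add
      (hF.hor_hor (T.hor_hor ⁅e k, e i⁆) (h.eig j).hor))
    rw [sub_add_cancel, cyc_eq] at h₂
    have h₃ := (h₂.act (T.fr e a)).ev
    simp only [lie_add, map_add] at h₃
    rw [hess_comm (h.jet_hor_hor hF i j), hess_comm (h.jet_hor_hor hF j k),
      hess_comm (h.jet_hor_hor hF k i)]
    simp only [hess, fr_inl]
    linear_combination - h₃
  cyclic_ε i j k a hij hjk hik := by
    have h₁ := hc.cyclic hF (h.eig k) (h.eig i) (h.eig j) (h.distinct k i hik.symm)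
      (h.distinct i j hij) (h.distinct j k hjk)
    have h₂ := (h₁.act (T.fr e a)).ev
    rw [lie_sub, map_sub] at h₂
    rw [if_pos (.inl hjk), if_pos (.inl hik.symm), hess_comm (h.jet_vert_hor hF (.inl hjk)),
      hess_comm (h.jet_vert_hor hF (.inl hik.symm))]
    simp only [hess, fr_inr]
    linear_combination - h₂
  mixed i j k a hij hjk hik := by
    have h₁ := ((hc.frame i j k hij hjk hik).act (T.fr e a)).ev
    rw [cyc_eq, Om_swap T F (e k)] at h₁
    simp only [lie_add, lie_neg, map_add, map_neg] at h₁
    rw [if_pos (.inl hik), if_pos (.inl hij), hess_comm (h.jet_vert_hor hF (.inl hik)),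
      hess_comm (h.jet_vert_hor hF (.inl hij)), hess_comm (h.jet_hor_hor hF j k)]
    simp only [hess, fr_inr, fr_inl]
    linear_combination - h₁
  mixed_base k a := by
    have h₁ := ((h.jet_cyc_base hF k).act (T.fr e a)).ev
    rw [cyc_eq, Om_swap T F (e k), ← h.J_base, ← h.spray] at h₁
    simp only [lie_add, lie_neg, map_add, map_neg] at h₁
    rw [if_pos (.inr rfl), if_pos (.inr rfl), hess_comm (h.jet_vert_hor hF (.inr rfl)),
      hess_comm (h.jet_vert_hor hF (.inr rfl)) (.inl k), hess_comm (h.jet_hor_hor hF o k)]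
    simp only [hess, fr_inr, fr_inl]
    linear_combination - h₁
  quadratic i j hij := by
    have h₁ := (thirdOrder_iff hF (h.eig i) (h.eig j) (h.distinct i j hij)).mp (ht i j hij)
    rw [if_pos (.inl hij), if_pos (.inl hij)]
    simp only [hess, fr_inr, fr_inl]
    linear_combination - h₁

/-- The quartic part of `Q` is chosen to cancel the first derivatives of F's equations that the
third-order solution leaves uncontrolled. -/
theorem EigenFrame.exists_lift (h : T.EigenFrame lam e o) (hF : T.Sol 1 F) (hc : T.Compat e F)
    (ht : ∀ i j, i ≠ j → T.ThirdOrder F (e i) (e j)) :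
    ∃ G, T.Jet 3 (G - F) ∧ T.Sol 2 G := by
  obtain ⟨β, s₁, s₂, s₃, hη, hε, hκ⟩ := (h.quarticData hF hc ht).exists_quartic
  obtain ⟨Q, hQ, hβ⟩ := h.exists_quartic s₁ s₂ s₃
  have hOm : ∀ a b X Y, T.ev ⁅T.fr e a, ⁅T.fr e b, T.Om Q X Y⁆⁆ =
      T.ev ⁅T.fr e a, ⁅T.fr e b, ⁅X, ⁅T.J Y, Q⁆⁆⁆⁆ - T.ev ⁅T.fr e a, ⁅T.fr e b, ⁅Y, ⁅T.J X, Q⁆⁆⁆⁆ :=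
    fun a b X Y => by
      have := (((hQ.act (T.J ⁅X, Y⁆)).act (T.fr e b)).act (T.fr e a)).ev
      simp only [SprayGerm.Om, lie_sub, map_sub, this, sub_zero]
  have hH : ∀ i j, T.Jet 2 (T.Om (F + Q) (e i) (e j)) := fun i j => by
    rw [Om_add_fun]
    refine h.jet_two ((h.jet_hor_hor hF i j).add (Jet.Om hQ _ _)) fun a b => ?_
    have h₁ := hη i j a b
    rw [← hβ, ← hβ] at h₁
    rw [lie_add, lie_add, map_add, hOm]
    simp only [hess, fr_inl, fr_inr] at h₁
    linear_combination h₁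
  have hE : ∀ i j, i ≠ j → T.Jet 2 (T.Om (F + Q) (T.J (e i)) (e j)) := fun i j hij => by
    rw [Om_add_fun]
    refine h.jet_two ((h.jet_vert_hor hF (.inl hij)).add (Jet.Om hQ _ _)) fun a b => ?_
    have h₁ := hε i j a b hij
    rw [← hβ, if_pos (.inl hij)] at h₁
    rw [lie_add, lie_add, map_add, hOm, J_J]
    simp only [hess, fr_inr, zero_lie, lie_zero, map_zero] at h₁ ⊢
    linear_combination h₁
  -- Insertions are bilinear over functions, so the equations reduce to pairs of frame fields.
  have lin : ∀ (K : L →ₗ[A] L), (∀ a b, T.Jet 2 (T.ins1 (F + Q) K (T.fr e a) (T.fr e b))) →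
      ∀ X Y, T.Jet 2 (T.ins1 (F + Q) K X Y) := fun K hK X Y => by
    refine h.jet_linear (t := fun X => T.ins1 (F + Q) K X Y) (fun X X' => ?_) (fun c X => ?_)
      (fun a => ?_) X
    · simp only [ins1, map_add, Om_add_left]; ring
    · simp only [ins1, map_smul, Om_smul_left]; ring
    · refine h.jet_linear (t := fun Y => T.ins1 (F + Q) K (T.fr e a) Y) (fun X X' => ?_)
        (fun c X => ?_) (fun b => hK a b) Y
      · simp only [ins1, map_add, Om_add_right]; ring
      · simp only [ins1, map_smul, Om_smul_right]; ring
  refine ⟨F + Q, by rwa [add_sub_cancel_left], ?_, lin _ ?_, lin _ ?_⟩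
  · have h₀ : ⁅T.C, F + Q⁆ - (F + Q) = (⁅T.C, F⁆ - F) + (⁅T.C, Q⁆ - Q) := by
      rw [lie_add]; ring
    rw [h₀]
    refine h.jet_three (hF.hom.add ((hQ.act _).sub hQ.of_succ)) fun a b c => ?_
    have h₁ := hκ a b c
    -- In CQ − Q only CQ has nonzero third derivatives; they are the components of β with last slot
    -- v_o.
    have h₂ := (((hQ.act (T.fr e c)).act (T.fr e b)).act (T.fr e a)).ev
    rw [← hβ, fr_inr, h.J_base] at h₁
    simp only [hess] at h₁
    simp only [lie_add, lie_sub, map_add, map_sub] at h₁ ⊢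
    linear_combination h₁ - h₂
  · have hi : ∀ i, T.conn (e i) = e i := fun i => T.conn_of_hor (h.eig i).hor
    rintro (i | i) (j | j)
    · simp only [ins1, fr_inl, hi]
      exact (hH i j).add (hH i j)
    · simp only [ins1, fr_inl, fr_inr, hi, conn_J, Om_neg_right, add_neg_cancel]
      exact Jet.zero
    · simp only [ins1, fr_inl, fr_inr, hi, conn_J, Om_neg_left, neg_add_cancel]
      exact Jet.zero
    · simp only [ins1, fr_inr, conn_J, Om_neg_left, Om_neg_right, Om_J_J, neg_zero, add_zero]
      exact Jet.zero
  · rintro (i | i) (j | j)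
    · rw [fr_inl, fr_inl, (h.eig i).ins1 (h.eig j)]
      rcases eq_or_ne i j with rfl | hij
      · rw [sub_self, zero_mul]; exact Jet.zero
      · exact (hE i j hij).mul_left _
    · simp only [ins1, fr_inl, fr_inr, jacobi_J, Om_zero_right, Om_jacobi_J, add_zero]
      exact Jet.zero
    · simp only [ins1, fr_inl, fr_inr, jacobi_J, Om_zero_left, Om_swap T _ (T.J (e i)),
        Om_jacobi_J, neg_zero, add_zero]
      exact Jet.zero
    · simp only [ins1, fr_inr, jacobi_J, Om_zero_left, Om_zero_right, add_zero]
      exact Jet.zero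

end SprayGerm
end Rapcsak

/-! ### Vector fields as derivations, and jets in charts. -/

namespace Rapcsak

section Manifold

variable {E : Type*} [NormedAddCommGroup E] [NormedSpace ℝ E]
  {H : Type*} [TopologicalSpace H] {I : ModelWithCorners ℝ E H}
  {N : Type*} [TopologicalSpace N] [ChartedSpace H N]

/-- The derivative of a function along a vector field. -/
def along (X : ∀ p : N, TangentSpace I p) (f : N → ℝ) (p : N) : ℝ :=
  mfderiv I 𝓘(ℝ, ℝ) f p (X p)

/-- The vector field near `x` that is constant equal to `v` in the preferred chart at `x`. -/
def coordField (I : ModelWithCorners ℝ E H) (x : N) (v : E) : ∀ p : N, TangentSpace I p :=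
  VectorField.mpullback I 𝓘(ℝ, E) (extChartAt I x) (fun _ => (v : E))

theorem along_eq_zero {X : ∀ p : N, TangentSpace I p} {f : N → ℝ} {p : N} (h : X p = 0) :
    along X f p = 0 := by
  simp only [along, h]
  exact map_zero (mfderiv I 𝓘(ℝ, ℝ) f p)

theorem along_congr {X : ∀ p : N, TangentSpace I p} {f g : N → ℝ} {p : N} (h : f =ᶠ[𝓝 p] g) :
    along X f p = along X g p := by
  simp only [along, h.mfderiv_eq]
  rfl

theorem along_congr_field {X Y : ∀ p : N, TangentSpace I p} (f : N → ℝ) {p : N} (h : X p = Y p) :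
    along X f p = along Y f p :=
  congrArg (mfderiv I 𝓘(ℝ, ℝ) f p) h

theorem along_add {X : ∀ p : N, TangentSpace I p} {f g : N → ℝ} {p : N}
    (hf : ContMDiffAt I 𝓘(ℝ, ℝ) ∞ f p) (hg : ContMDiffAt I 𝓘(ℝ, ℝ) ∞ g p) :
    along X (f + g) p = along X f p + along X g p :=
  congr($(mvfderiv_add (hf.mdifferentiableAt (by simp)) (hg.mdifferentiableAt (by simp))) (X p))

theorem along_mul {X : ∀ p : N, TangentSpace I p} {f g : N → ℝ} {p : N}
    (hf : ContMDiffAt I 𝓘(ℝ, ℝ) ∞ f p) (hg : ContMDiffAt I 𝓘(ℝ, ℝ) ∞ g p) :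
    along X (f * g) p = f p * along X g p + g p * along X f p :=
  congr($(mvfderiv_mul (hf.mdifferentiableAt (by simp)) (hg.mdifferentiableAt (by simp))) (X p))

theorem along_const (X : ∀ p : N, TangentSpace I p) (c : ℝ) (p : N) :
    along X (fun _ => c) p = 0 :=
  congr($(mvfderiv_const c) (X p))

theorem along_add_field (X Y : ∀ p : N, TangentSpace I p) (f : N → ℝ) :
    along (X + Y) f = along X f + along Y f :=
  funext fun p => map_add (mfderiv I 𝓘(ℝ, ℝ) f p) (X p) (Y p)

theorem along_smul_field (g : N → ℝ) (X : ∀ p : N, TangentSpace I p) (f : N → ℝ) :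
    along (g • X) f = g * along X f :=
  funext fun p => map_smul (mfderiv I 𝓘(ℝ, ℝ) f p) (g p) (X p)

variable [IsManifold I ∞ N]

theorem along_clm_comp_extChartAt {x p : N} (hp : p ∈ (extChartAt I x).source)
    (X : ∀ p : N, TangentSpace I p) (l : E →L[ℝ] ℝ) :
    along X (fun q => l (extChartAt I x q)) p =
      l (mfderiv I 𝓘(ℝ, E) (extChartAt I x) p (X p)) := by
  have : IsManifold I 1 N := .of_le (n := ∞) (by simp)
  have h1 : MDifferentiableAt I 𝓘(ℝ, E) (extChartAt I x) p :=
    mdifferentiableAt_extChartAt (by rwa [extChartAt_source] at hp)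
  have h2 := mfderiv_comp p (l.mdifferentiableAt (x := extChartAt I x p)) h1
  rw [l.mfderiv_eq] at h2
  exact congr($h2 (X p))

/-- The section of the tangent bundle given by the vector field `X` is smooth at `p`. -/
abbrev SmoothFieldAt (X : ∀ p : N, TangentSpace I p) (p : N) : Prop :=
  ContMDiffAt I I.tangent ∞ (fun q => (⟨q, X q⟩ : TangentBundle I N)) p

theorem contMDiffAt_along {f : N → ℝ} {X : ∀ p : N, TangentSpace I p} {p : N}
    (hf : ContMDiffAt I 𝓘(ℝ, ℝ) ∞ f p) (hX : SmoothFieldAt X p) :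
    ContMDiffAt I 𝓘(ℝ, ℝ) ∞ (along X f) p := by
  have : IsManifold I 1 N := .of_le (n := ∞) (by simp)
  have h1 : ContMDiffAt I 𝓘(ℝ, E →L[ℝ] ℝ) ∞
      (inTangentCoordinates I 𝓘(ℝ, ℝ) id f (mfderiv I 𝓘(ℝ, ℝ) f) p) p :=
    hf.mfderiv_const (by simp)
  have h2 := ContMDiffAt.clm_apply_of_inCoordinates (b₁ := id) (b₂ := f) (m₀ := p)
    (ϕ := fun q => mfderiv I 𝓘(ℝ, ℝ) f q) (v := X) h1 hX hf
  exact (contMDiff_snd_tangentBundle_modelSpace ℝ 𝓘(ℝ, ℝ)).contMDiffAt.comp p h2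

theorem mfderiv_extChartAt_coordField {x p : N} (hp : p ∈ (extChartAt I x).source) (v : E) :
    mfderiv I 𝓘(ℝ, E) (extChartAt I x) p (coordField I x v p) = v := by
  have : IsManifold I 1 N := .of_le (n := ∞) (by simp)
  exact (isInvertible_mfderiv_extChartAt hp).self_apply_inverse v

theorem field_eq_coordField {x p : N} (hp : p ∈ (extChartAt I x).source) (w : TangentSpace I p) :
    w = coordField I x (mfderiv I 𝓘(ℝ, E) (extChartAt I x) p w) p := by
  have : IsManifold I 1 N := .of_le (n := ∞) (by simp)
  exact ((isInvertible_mfderiv_extChartAt hp).inverse_apply_self w).symm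

theorem SmoothFieldAt.add {X Y : ∀ p : N, TangentSpace I p} {p : N}
    (hX : SmoothFieldAt X p) (hY : SmoothFieldAt Y p) : SmoothFieldAt (X + Y) p := by
  have : IsManifold I ((⊤ : ℕ∞) + 1) N := ‹IsManifold I ∞ N›
  have : IsManifold I 1 N := .of_le (n := ∞) (by simp)
  exact hX.add_section hY

theorem SmoothFieldAt.smul {f : N → ℝ} {X : ∀ p : N, TangentSpace I p} {p : N}
    (hf : ContMDiffAt I 𝓘(ℝ, ℝ) ∞ f p) (hX : SmoothFieldAt X p) : SmoothFieldAt (f • X) p := by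
  have : IsManifold I ((⊤ : ℕ∞) + 1) N := ‹IsManifold I ∞ N›
  have : IsManifold I 1 N := .of_le (n := ∞) (by simp)
  exact hf.smul_section hX

theorem along_eq_fderiv [I.Boundaryless] {f : N → ℝ} {x p : N}
    (hp : p ∈ (extChartAt I x).source)
    (hf : ContMDiffAt I 𝓘(ℝ, ℝ) ∞ f p) (X : ∀ p : N, TangentSpace I p) :
    along X f p = fderiv ℝ (f ∘ (extChartAt I x).symm) (extChartAt I x p)
      (mfderiv I 𝓘(ℝ, E) (extChartAt I x) p (X p)) := by
  have : IsManifold I 1 N := .of_le (n := ∞) (by simp)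
  have h1 : MDifferentiableAt I 𝓘(ℝ, E) (extChartAt I x) p :=
    mdifferentiableAt_extChartAt (by rwa [extChartAt_source] at hp)
  have ht : (extChartAt I x).target ∈ 𝓝 (extChartAt I x p) :=
    extChartAt_target_mem_nhds' ((extChartAt I x).map_source hp)
  have hs : MDifferentiableAt 𝓘(ℝ, E) I (extChartAt I x).symm (extChartAt I x p) :=
    (mdifferentiableOn_extChartAt_symm.mdifferentiableAt ht)
  have hfs : MDifferentiableAt 𝓘(ℝ, E) 𝓘(ℝ, ℝ) (f ∘ (extChartAt I x).symm) (extChartAt I x p) := by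
    refine MDifferentiableAt.comp (I' := I) _ ?_ hs
    rw [(extChartAt I x).left_inv hp]
    exact hf.mdifferentiableAt (by simp)
  have hloc : f =ᶠ[𝓝 p] (f ∘ (extChartAt I x).symm) ∘ extChartAt I x := by
    filter_upwards [extChartAt_source_mem_nhds' hp] with q hq
    simp only [Function.comp_apply, (extChartAt I x).left_inv hq]
  rw [along_congr hloc]
  have h2 := mfderiv_comp p hfs h1
  rw [mfderiv_eq_fderiv] at h2
  exact congr($h2 (X p))

theorem contDiffAt_comp_extChartAt_symm [I.Boundaryless] {f : N → ℝ} {x : N}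
    (hf : ContMDiffAt I 𝓘(ℝ, ℝ) ∞ f x) :
    ContDiffAt ℝ ∞ (f ∘ (extChartAt I x).symm) (extChartAt I x x) := by
  rw [← contMDiffAt_iff_contDiffAt]
  refine ContMDiffAt.comp (I' := I) _ ?_ ((contMDiffOn_extChartAt_symm x).contMDiffAt
    (extChartAt_target_mem_nhds x))
  rwa [extChartAt_to_inv]

/-- Coordinate fields act as constant-direction derivatives in the chart, which links iterated field
derivatives with `iteratedFDeriv`. -/
theorem along_coordField_comp_symm [I.Boundaryless] {f : N → ℝ} {x : N}
    (hf : ∀ᶠ q in 𝓝 x, ContMDiffAt I 𝓘(ℝ, ℝ) ∞ f q) (v : E) :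
    along (coordField I x v) f ∘ (extChartAt I x).symm =ᶠ[𝓝 (extChartAt I x x)]
      fun u => fderiv ℝ (f ∘ (extChartAt I x).symm) u v := by
  have h1 : ∀ᶠ u in 𝓝 (extChartAt I x x),
      ContMDiffAt I 𝓘(ℝ, ℝ) ∞ f ((extChartAt I x).symm u) := by
    refine (continuousAt_extChartAt_symm x).eventually ?_
    rwa [extChartAt_to_inv]
  filter_upwards [h1, extChartAt_target_mem_nhds (I := I) x] with u hu ht
  have hs := (extChartAt I x).map_target ht
  simp only [Function.comp_apply]
  rw [along_eq_fderiv hs hu, mfderiv_extChartAt_coordField hs, (extChartAt I x).right_inv ht]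

variable [CompleteSpace E]

theorem smoothFieldAt_coordField {x p : N} (hp : p ∈ (extChartAt I x).source) (v : E) :
    SmoothFieldAt (coordField I x v) p := by
  have : IsManifold I 1 N := .of_le (n := ∞) (by simp)
  refine ContMDiffAt.mpullback_vectorField_preimage (n := ∞) ?_ (contMDiffAt_extChartAt' ?_)
    (isInvertible_mfderiv_extChartAt hp) (by simp)
  · exact contMDiffAt_vectorSpace_iff_contDiffAt.2 contDiffAt_const
  · rwa [extChartAt_source] at hp

theorem smoothFieldAt_mlieBracket {X Y : ∀ p : N, TangentSpace I p} {p : N}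
    (hX : SmoothFieldAt X p) (hY : SmoothFieldAt Y p) :
    SmoothFieldAt (VectorField.mlieBracket I X Y) p := by
  have : IsManifold I ((⊤ : ℕ∞) + 1) N := ‹IsManifold I ∞ N›
  have : IsManifold I (minSmoothness ℝ 2) N :=
    .of_le (n := ∞) (by rw [minSmoothness_of_isRCLikeNormedField]; exact ENat.LEInfty.out)
  exact ContMDiffAt.mlieBracket_vectorField (m := ⊤) (n := ⊤) hX hY
    (by rw [minSmoothness_of_isRCLikeNormedField]; simp)

theorem mlieBracket_smul_field {f : N → ℝ} {X Y : ∀ p : N, TangentSpace I p} {p : N}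
    (hf : ContMDiffAt I 𝓘(ℝ, ℝ) ∞ f p) (hY : SmoothFieldAt Y p) :
    VectorField.mlieBracket I X (f • Y) p =
      along X f p • Y p + f p • VectorField.mlieBracket I X Y p := by
  have : IsManifold I 1 N := .of_le (n := ∞) (by simp)
  exact VectorField.mlieBracket_smul_right (hf.mdifferentiableAt (by simp))
    (hY.mdifferentiableAt (by simp))

theorem mlieBracket_add_field {X Y Z : ∀ p : N, TangentSpace I p} {p : N}
    (hY : SmoothFieldAt Y p) (hZ : SmoothFieldAt Z p) :
    VectorField.mlieBracket I X (Y + Z) p =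
      VectorField.mlieBracket I X Y p + VectorField.mlieBracket I X Z p := by
  have : IsManifold I 1 N := .of_le (n := ∞) (by simp)
  exact VectorField.mlieBracket_add_right (hY.mdifferentiableAt (by simp))
    (hZ.mdifferentiableAt (by simp))

theorem mlieBracket_mlieBracket_smul {f : N → ℝ} {X Y Z : ∀ p : N, TangentSpace I p} {p : N}
    (hf : ∀ᶠ q in 𝓝 p, ContMDiffAt I 𝓘(ℝ, ℝ) ∞ f q)
    (hY : SmoothFieldAt Y p) (hZ : ∀ᶠ q in 𝓝 p, SmoothFieldAt Z q) :
    VectorField.mlieBracket I X (VectorField.mlieBracket I Y (f • Z)) p =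
      along X (along Y f) p • Z p + along Y f p • VectorField.mlieBracket I X Z p +
      (along X f p • VectorField.mlieBracket I Y Z p +
        f p • VectorField.mlieBracket I X (VectorField.mlieBracket I Y Z) p) := by
  have hf' := hf.self_of_nhds
  have hZ' := hZ.self_of_nhds
  have hYZ := smoothFieldAt_mlieBracket hY hZ'
  have key : VectorField.mlieBracket I Y (f • Z) =ᶠ[𝓝 p]
      along Y f • Z + f • VectorField.mlieBracket I Y Z := by
    filter_upwards [hf, hZ] with q h1 h2 using mlieBracket_smul_field h1 h2
  rw [EventuallyEq.mlieBracket_vectorField_eq (EventuallyEq.refl _ X) key,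
    mlieBracket_add_field (.smul (contMDiffAt_along hf' hY) hZ') (.smul hf' hYZ),
    mlieBracket_smul_field (contMDiffAt_along hf' hY) hZ', mlieBracket_smul_field hf' hYZ]

/-- The commutator formula is extracted from the Jacobi identity for brackets: it is applied to Z
and to fZ with Z nonzero at p, and the Leibniz rule leaves the difference of the two sides
multiplied by Z. -/
theorem along_mlieBracket {f : N → ℝ} {X Y : ∀ p : N, TangentSpace I p} {p : N}
    (hf : ∀ᶠ q in 𝓝 p, ContMDiffAt I 𝓘(ℝ, ℝ) ∞ f q)
    (hX : SmoothFieldAt X p) (hY : SmoothFieldAt Y p) :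
    along (VectorField.mlieBracket I X Y) f p = along X (along Y f) p - along Y (along X f) p := by
  rcases subsingleton_or_nontrivial E with hE | hE
  · have h (w : TangentSpace I p) : w = 0 := hE.elim (α := E) w 0
    rw [along_eq_zero (h _), along_eq_zero (h _), along_eq_zero (h _), sub_zero]
  obtain ⟨v, hv⟩ := exists_ne (0 : E)
  have hsrc : ∀ᶠ q in 𝓝 p, q ∈ (extChartAt I p).source := extChartAt_source_mem_nhds p
  set Z := coordField I p v with hZdef
  have hZ : ∀ᶠ q in 𝓝 p, SmoothFieldAt Z q :=
    hsrc.mono fun q hq => smoothFieldAt_coordField hq v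
  have hZ' := hZ.self_of_nhds
  have hZp : Z p ≠ 0 := by
    intro h0
    apply hv
    rw [← mfderiv_extChartAt_coordField (I := I) hsrc.self_of_nhds v, ← hZdef, h0, map_zero]
    rfl
  have hf' := hf.self_of_nhds
  have : IsManifold I (minSmoothness ℝ 3) N :=
    .of_le (n := ∞) (by rw [minSmoothness_of_isRCLikeNormedField]; exact ENat.LEInfty.out)
  have two_le : minSmoothness ℝ 2 ≤ ∞ := by
    rw [minSmoothness_of_isRCLikeNormedField]; exact ENat.LEInfty.out
  have j1 := VectorField.leibniz_identity_mlieBracket_apply (hX.of_le two_le) (hY.of_le two_le)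
    ((SmoothFieldAt.smul hf' hZ').of_le two_le)
  have j2 := VectorField.leibniz_identity_mlieBracket_apply (hX.of_le two_le) (hY.of_le two_le)
    (hZ'.of_le two_le)
  rw [mlieBracket_mlieBracket_smul hf hY hZ, mlieBracket_mlieBracket_smul hf hX hZ,
    mlieBracket_smul_field hf' hZ', j2] at j1
  have h3 : (along (VectorField.mlieBracket I X Y) f p -
      (along X (along Y f) p - along Y (along X f) p)) • Z p = 0 := by
    rw [← sub_eq_zero] at j1
    rw [← neg_eq_zero, ← j1]
    module
  exact sub_eq_zero.1 ((smul_eq_zero.1 h3).resolve_right hZp)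

end Manifold

section Jet

variable {E : Type*} [NormedAddCommGroup E] [NormedSpace ℝ E]

theorem iteratedFDeriv_fderiv_apply_const {g : E → ℝ} {a : E} (hg : ContDiffAt ℝ ∞ g a) (j : ℕ)
    (v : E) (m : Fin j → E) :
    iteratedFDeriv ℝ j (fun u => fderiv ℝ g u v) a m = iteratedFDeriv ℝ j (fderiv ℝ g) a m v := by
  have h1 : ContDiffAt ℝ ∞ (fderiv ℝ g) a := hg.fderiv_right (by simp)
  have h2 := (ContinuousLinearMap.apply ℝ ℝ v).iteratedFDeriv_comp_left h1
    (i := j) (by exact_mod_cast le_top)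
  exact congr($h2 m)

theorem jet_succ_iff {g : E → ℝ} {a : E} (hg : ContDiffAt ℝ ∞ g a) (k : ℕ) :
    (∀ j ≤ k + 1, iteratedFDeriv ℝ j g a = 0) ↔
      g a = 0 ∧ ∀ v, ∀ j ≤ k, iteratedFDeriv ℝ j (fun u => fderiv ℝ g u v) a = 0 := by
  have h0 : iteratedFDeriv ℝ 0 g a = 0 ↔ g a = 0 := by
    rw [← norm_eq_zero, norm_iteratedFDeriv_zero, norm_eq_zero]
  have hs (j : ℕ) : iteratedFDeriv ℝ (j + 1) g a = 0 ↔
      ∀ v, iteratedFDeriv ℝ j (fun u => fderiv ℝ g u v) a = 0 := by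
    rw [← norm_eq_zero, ← norm_iteratedFDeriv_fderiv, norm_eq_zero]
    constructor
    · intro h v
      ext m
      rw [iteratedFDeriv_fderiv_apply_const hg, h]
      simp
    · intro h
      ext m v
      rw [← iteratedFDeriv_fderiv_apply_const hg, h]
      simp
  constructor
  · intro h
    exact ⟨h0.1 (h 0 (by omega)), fun v j hj => (hs j).1 (h _ (by omega)) v⟩
  · rintro ⟨h, h'⟩ (_ | j) hj
    · exact h0.2 h
    · exact (hs j).2 fun v => h' v j (by omega)

end Jet

end Rapcsak

/-! ### The vertical structure of TM in the induced charts. -/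

namespace Rapcsak

variable {n : ℕ} {M : Type*} [TopologicalSpace M] [ChartedSpace (EuclideanSpace ℝ (Fin n)) M]
  [IsManifold (𝓡 n) ∞ M]

theorem smoothNear_iff {f : TM n M → ℝ} {x : TM n M} :
    SmoothNear f x ↔ ∀ᶠ p in 𝓝 x, ContMDiffAt (𝓡 n).tangent 𝓘(ℝ, ℝ) ∞ f p := by
  constructor
  · rintro ⟨U, hU, h⟩
    filter_upwards [eventually_mem_nhds_iff.2 hU] with p hp using h.contMDiffAt hp
  · exact fun h => ⟨_, h, fun p hp => hp.contMDiffWithinAt⟩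

theorem smoothFieldNear_iff {X : VF n M} {x : TM n M} :
    SmoothFieldNear X x ↔ ∀ᶠ p in 𝓝 x, SmoothFieldAt X p := by
  constructor
  · rintro ⟨U, hU, h⟩
    filter_upwards [eventually_mem_nhds_iff.2 hU] with p hp using ContMDiffOn.contMDiffAt h hp
  · exact fun h => ⟨_, h, fun p hp => ContMDiffAt.contMDiffWithinAt hp⟩

/-- The fibre coordinates on `T_q M` given by the preferred chart at `b`. -/
def fibreCoord (b q : M) : TangentSpace (𝓡 n) q →L[ℝ] EuclideanSpace ℝ (Fin n) :=
  (trivializationAt (EuclideanSpace ℝ (Fin n)) (TangentSpace (𝓡 n)) b).continuousLinearMapAt ℝ q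

theorem mem_extChartAt_source_iff {x p : TM n M} :
    p ∈ (extChartAt (𝓡 n).tangent x).source ↔
      p.proj ∈ (chartAt (EuclideanSpace ℝ (Fin n)) x.proj).source := by
  rw [extChartAt_source]
  exact TangentBundle.mem_chart_source_iff p x

theorem extChartAt_tangent_apply {x p : TM n M} (hp : p ∈ (extChartAt (𝓡 n).tangent x).source) :
    extChartAt (𝓡 n).tangent x p =
      (extChartAt (𝓡 n) x.proj p.proj, fibreCoord x.proj p.proj p.snd) := by
  have h := mem_extChartAt_source_iff.1 hp
  have h1 : fibreCoord x.proj p.proj p.snd =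
      (trivializationAt (EuclideanSpace ℝ (Fin n)) (TangentSpace (𝓡 n)) x.proj p).2 := by
    rw [fibreCoord, Trivialization.continuousLinearMapAt_apply, Trivialization.linearMapAt_apply]
    simp [h]
  rw [h1]
  rfl

theorem mfderiv_extChartAt_fst {x p : TM n M} (hp : p ∈ (extChartAt (𝓡 n).tangent x).source)
    (w : TangentSpace (𝓡 n).tangent p) :
    (mfderiv (𝓡 n).tangent 𝓘(ℝ, EuclideanSpace ℝ (Fin n) × EuclideanSpace ℝ (Fin n))
      (extChartAt (𝓡 n).tangent x) p w).1 =
    fibreCoord x.proj p.proj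
      (mfderiv (𝓡 n).tangent (𝓡 n) (fun q : TM n M => q.proj) p w) := by
  have h := mem_extChartAt_source_iff.1 hp
  have hφ : MDifferentiableAt (𝓡 n).tangent
      𝓘(ℝ, EuclideanSpace ℝ (Fin n) × EuclideanSpace ℝ (Fin n)) (extChartAt (𝓡 n).tangent x) p :=
    mdifferentiableAt_extChartAt (by rwa [extChartAt_source] at hp)
  have h1 := mfderiv_comp p ((ContinuousLinearMap.fst ℝ (EuclideanSpace ℝ (Fin n))
    (EuclideanSpace ℝ (Fin n))).mdifferentiableAt (x := extChartAt (𝓡 n).tangent x p)) hφ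
  rw [ContinuousLinearMap.mfderiv_eq] at h1
  have h2 := mfderiv_comp p (mdifferentiableAt_extChartAt (I := 𝓡 n) h)
    (mdifferentiableAt_proj (TangentSpace (𝓡 n)) (p := p))
  have h3 : (fun q : TM n M => (ContinuousLinearMap.fst ℝ (EuclideanSpace ℝ (Fin n))
    (EuclideanSpace ℝ (Fin n))) (extChartAt (𝓡 n).tangent x q)) =
      (fun q => extChartAt (𝓡 n) x.proj q.proj) := rfl
  rw [fibreCoord, TangentBundle.continuousLinearMapAt_trivializationAt h]
  refine (congr($h1 w)).symm.trans ?_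
  exact congr($h2 w)

/-- Charts of TM are linear on fibres, so the curve p + t w becomes an affine line with fixed base
coordinate. -/
theorem mfderiv_extChartAt_vertLift {x p : TM n M}
    (hp : p ∈ (extChartAt (𝓡 n).tangent x).source) (w : TangentSpace (𝓡 n) p.proj) :
    mfderiv (𝓡 n).tangent 𝓘(ℝ, EuclideanSpace ℝ (Fin n) × EuclideanSpace ℝ (Fin n))
      (extChartAt (𝓡 n).tangent x) p (vertLift p w) = (0, fibreCoord x.proj p.proj w) := by
  have h := mem_extChartAt_source_iff.1 hp
  have hφ : MDifferentiableAt (𝓡 n).tangent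
      𝓘(ℝ, EuclideanSpace ℝ (Fin n) × EuclideanSpace ℝ (Fin n)) (extChartAt (𝓡 n).tangent x) p :=
    mdifferentiableAt_extChartAt (by rwa [extChartAt_source] at hp)
  set c : ℝ → TM n M := fun t => ⟨p.proj, p.snd + t • w⟩ with hc
  set L : ℝ → EuclideanSpace ℝ (Fin n) × EuclideanSpace ℝ (Fin n) := fun t =>
    (extChartAt (𝓡 n) x.proj p.proj,
      fibreCoord x.proj p.proj p.snd + t • fibreCoord x.proj p.proj w) with hL
  have hc0 : c 0 = p := by simp [hc]
  have hsrc (t : ℝ) : c t ∈ (extChartAt (𝓡 n).tangent x).source := mem_extChartAt_source_iff.2 h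
  have hφc (t : ℝ) : extChartAt (𝓡 n).tangent x (c t) = L t := by
    rw [extChartAt_tangent_apply (hsrc t)]
    exact Prod.ext rfl ((map_add (fibreCoord x.proj p.proj) _ _).trans
      (congrArg _ (map_smul (fibreCoord x.proj p.proj) t w)))
  have hcL : c = (extChartAt (𝓡 n).tangent x).symm ∘ L := by
    ext1 t
    rw [Function.comp_apply, ← hφc, (extChartAt (𝓡 n).tangent x).left_inv (hsrc t)]
  have hLd : HasDerivAt L (0, fibreCoord x.proj p.proj w) 0 := by
    refine (hasDerivAt_const _ _).prodMk ?_
    simpa using ((hasDerivAt_id (0 : ℝ)).smul_const (fibreCoord x.proj p.proj w)).const_add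
      (fibreCoord x.proj p.proj p.snd)
  have hcd : MDifferentiableAt 𝓘(ℝ, ℝ) (𝓡 n).tangent c 0 := by
    rw [hcL]
    refine MDifferentiableAt.comp (I' := 𝓘(ℝ, EuclideanSpace ℝ (Fin n) × EuclideanSpace ℝ (Fin n)))
      _ (mdifferentiableOn_extChartAt_symm.mdifferentiableAt ?_)
      hLd.differentiableAt.mdifferentiableAt
    rw [← hφc]
    exact extChartAt_target_mem_nhds' ((extChartAt (𝓡 n).tangent x).map_source (hsrc 0))
  have h1 := mfderiv_comp_of_eq hφ hcd hc0
  have h2 : extChartAt (𝓡 n).tangent x ∘ c = L := funext hφc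
  rw [h2, mfderiv_eq_fderiv] at h1
  -- The curve passes through p only up to a propositional equality; this transports the derivative
  -- between the two tangent spaces.
  have h3 : ∀ q, q = p → ∀ u : EuclideanSpace ℝ (Fin n) × EuclideanSpace ℝ (Fin n),
      (mfderiv (𝓡 n).tangent 𝓘(ℝ, EuclideanSpace ℝ (Fin n) × EuclideanSpace ℝ (Fin n))
        (extChartAt (𝓡 n).tangent x) q : _ → EuclideanSpace ℝ (Fin n) × EuclideanSpace ℝ (Fin n)) u =
      (mfderiv (𝓡 n).tangent 𝓘(ℝ, EuclideanSpace ℝ (Fin n) × EuclideanSpace ℝ (Fin n))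
        (extChartAt (𝓡 n).tangent x) p :
          _ → EuclideanSpace ℝ (Fin n) × EuclideanSpace ℝ (Fin n)) u := by
    rintro _ rfl _
    rfl
  refine (h3 _ hc0 _).symm.trans ((congr($h1 (1 : ℝ))).symm.trans ?_)
  rw [hLd.hasFDerivAt.fderiv]
  simp

theorem mfderiv_extChartAt_J {x p : TM n M} (hp : p ∈ (extChartAt (𝓡 n).tangent x).source)
    (X : VF n M) :
    mfderiv (𝓡 n).tangent 𝓘(ℝ, EuclideanSpace ℝ (Fin n) × EuclideanSpace ℝ (Fin n))
      (extChartAt (𝓡 n).tangent x) p (J X p) =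
      (0, (mfderiv (𝓡 n).tangent 𝓘(ℝ, EuclideanSpace ℝ (Fin n) × EuclideanSpace ℝ (Fin n))
        (extChartAt (𝓡 n).tangent x) p (X p)).1) := by
  rw [mfderiv_extChartAt_fst hp]
  exact mfderiv_extChartAt_vertLift hp _

theorem mfderiv_extChartAt_liouville {x p : TM n M}
    (hp : p ∈ (extChartAt (𝓡 n).tangent x).source) :
    mfderiv (𝓡 n).tangent 𝓘(ℝ, EuclideanSpace ℝ (Fin n) × EuclideanSpace ℝ (Fin n))
      (extChartAt (𝓡 n).tangent x) p (liouville p) = (0, (extChartAt (𝓡 n).tangent x p).2) := by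
  rw [extChartAt_tangent_apply hp]
  exact mfderiv_extChartAt_vertLift hp _

theorem slashed_mem_nhds {x : TM n M} (hx : x ∈ slashed n M) : slashed n M ∈ 𝓝 x := by
  have hsrc := mem_extChartAt_source (I := (𝓡 n).tangent) x
  have hne : (extChartAt (𝓡 n).tangent x x).2 ≠ 0 := by
    rw [extChartAt_tangent_apply hsrc]
    intro h
    apply hx
    have h1 := (trivializationAt (EuclideanSpace ℝ (Fin n)) (TangentSpace (𝓡 n))
      x.proj).symmL_continuousLinearMapAt (R := ℝ) (b := x.proj) (mem_chart_source _ _) x.snd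
    rw [← h1]
    simp only [fibreCoord] at h
    rw [h, map_zero]
  have hcont : ContinuousAt (fun p => (extChartAt (𝓡 n).tangent x p).2) x :=
    (continuousAt_extChartAt x).snd
  filter_upwards [extChartAt_source_mem_nhds (I := (𝓡 n).tangent) x,
    hcont.eventually_ne hne] with p hp hp2
  rw [extChartAt_tangent_apply hp] at hp2
  intro h
  apply hp2
  change fibreCoord x.proj p.proj p.snd = 0
  rw [h, map_zero]

end Rapcsak

/-! ### Germs of smooth functions and of vector fields. -/

namespace Rapcsak

section Germ

variable {E : Type*} [NormedAddCommGroup E] [NormedSpace ℝ E]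
  {H : Type*} [TopologicalSpace H] (I : ModelWithCorners ℝ E H)
  {N : Type*} [TopologicalSpace N] [ChartedSpace H N] (x : N)

/-- The algebra of functions that are smooth near `x`. -/
def smoothFunctions : Subalgebra ℝ (N → ℝ) where
  carrier := {f | ∀ᶠ p in 𝓝 x, ContMDiffAt I 𝓘(ℝ, ℝ) ∞ f p}
  mul_mem' hf hg := by filter_upwards [hf, hg] with p h1 h2 using h1.mul h2
  add_mem' hf hg := by filter_upwards [hf, hg] with p h1 h2 using h1.add h2
  algebraMap_mem' _ := .of_forall fun _ => contMDiffAt_const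

/-- The ideal of functions that vanish near `x`. -/
def locallyZero : Ideal (smoothFunctions I x) where
  carrier := {f | ∀ᶠ p in 𝓝 x, (f : N → ℝ) p = 0}
  add_mem' hf hg := by
    filter_upwards [hf, hg] with p h1 h2
    simp [h1, h2]
  zero_mem' := .of_forall fun _ => rfl
  smul_mem' c f hf := by
    filter_upwards [hf] with p h1
    simp [h1]

/-- Germs at `x` of smooth functions. -/
def FnGerm : Type _ := smoothFunctions I x ⧸ locallyZero I x

instance : CommRing (FnGerm I x) := inferInstanceAs (CommRing (smoothFunctions I x ⧸ locallyZero I x))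

instance : Algebra ℝ (FnGerm I x) :=
  inferInstanceAs (Algebra ℝ (smoothFunctions I x ⧸ locallyZero I x))

/-- The germ of a function that is smooth near `x`. -/
def toGerm : smoothFunctions I x →ₐ[ℝ] FnGerm I x := Ideal.Quotient.mkₐ ℝ (locallyZero I x)

/-- The value of a germ at `x`. -/
def evGerm : FnGerm I x →ₐ[ℝ] ℝ :=
  Ideal.Quotient.liftₐ (locallyZero I x)
    ((Pi.evalAlgHom ℝ (fun _ : N => ℝ) x).comp (smoothFunctions I x).val)
    fun _ ha => ha.self_of_nhds

variable {I x}

/-- `f` represents the germ `a`. -/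
def Rep (f : N → ℝ) (a : FnGerm I x) : Prop :=
  ∃ h : f ∈ smoothFunctions I x, toGerm I x ⟨f, h⟩ = a

theorem toGerm_eq_iff {f g : smoothFunctions I x} :
    toGerm I x f = toGerm I x g ↔ (f : N → ℝ) =ᶠ[𝓝 x] g := by
  refine (Ideal.Quotient.mk_eq_mk_iff_sub_mem f g).trans ?_
  exact eventually_congr (.of_forall fun p => sub_eq_zero)

theorem exists_rep (a : FnGerm I x) : ∃ f, Rep f a := by
  obtain ⟨⟨f, h⟩, rfl⟩ := Ideal.Quotient.mk_surjective a
  exact ⟨f, h, rfl⟩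

variable {f g : N → ℝ} {a b : FnGerm I x}

theorem Rep.smooth (h : Rep f a) : ∀ᶠ p in 𝓝 x, ContMDiffAt I 𝓘(ℝ, ℝ) ∞ f p := h.1

theorem exists_germ (h : ∀ᶠ p in 𝓝 x, ContMDiffAt I 𝓘(ℝ, ℝ) ∞ f p) :
    ∃ a : FnGerm I x, Rep f a := ⟨_, h, rfl⟩

theorem Rep.eventuallyEq (hf : Rep f a) (hg : Rep g a) : f =ᶠ[𝓝 x] g := by
  obtain ⟨h1, rfl⟩ := hf
  obtain ⟨h2, h⟩ := hg
  exact (toGerm_eq_iff.1 h).symm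

theorem Rep.eq_of_eventuallyEq (hf : Rep f a) (hg : Rep g b) (h : f =ᶠ[𝓝 x] g) : a = b := by
  obtain ⟨h1, rfl⟩ := hf
  obtain ⟨h2, rfl⟩ := hg
  exact toGerm_eq_iff.2 h

theorem Rep.congr (hf : Rep f a) (h : f =ᶠ[𝓝 x] g) : Rep g a := by
  have hg : ∀ᶠ p in 𝓝 x, ContMDiffAt I 𝓘(ℝ, ℝ) ∞ g p := by
    filter_upwards [hf.smooth, h.eventuallyEq_nhds] with p h1 h2
    exact h1.congr_of_eventuallyEq h2.symm
  obtain ⟨b, hb⟩ := exists_germ hg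
  rwa [hf.eq_of_eventuallyEq hb h]

theorem Rep.add (hf : Rep f a) (hg : Rep g b) : Rep (f + g) (a + b) := by
  obtain ⟨h1, rfl⟩ := hf
  obtain ⟨h2, rfl⟩ := hg
  exact ⟨add_mem h1 h2, map_add (toGerm I x) ⟨f, h1⟩ ⟨g, h2⟩⟩

theorem Rep.sub (hf : Rep f a) (hg : Rep g b) : Rep (f - g) (a - b) := by
  obtain ⟨h1, rfl⟩ := hf
  obtain ⟨h2, rfl⟩ := hg
  exact ⟨sub_mem h1 h2, map_sub (toGerm I x) ⟨f, h1⟩ ⟨g, h2⟩⟩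

theorem Rep.mul (hf : Rep f a) (hg : Rep g b) : Rep (f * g) (a * b) := by
  obtain ⟨h1, rfl⟩ := hf
  obtain ⟨h2, rfl⟩ := hg
  exact ⟨mul_mem h1 h2, map_mul (toGerm I x) ⟨f, h1⟩ ⟨g, h2⟩⟩

theorem Rep.const (r : ℝ) : Rep (fun _ => r) (algebraMap ℝ (FnGerm I x) r) :=
  ⟨(smoothFunctions I x).algebraMap_mem r, (toGerm I x).commutes r⟩

theorem Rep.zero : Rep (0 : N → ℝ) (0 : FnGerm I x) := by
  rw [← map_zero (algebraMap ℝ (FnGerm I x))]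
  exact Rep.const 0

theorem Rep.one : Rep (1 : N → ℝ) (1 : FnGerm I x) := by
  rw [← map_one (algebraMap ℝ (FnGerm I x))]
  exact Rep.const 1

theorem Rep.ev (hf : Rep f a) : evGerm I x a = f x := by
  obtain ⟨h1, rfl⟩ := hf
  rfl

/-- A representative is nonzero near x by continuity, and its pointwise inverse is smooth there. -/
theorem isUnit_of_evGerm_ne_zero (h : evGerm I x a ≠ 0) : IsUnit a := by
  obtain ⟨f, hf⟩ := exists_rep a
  rw [hf.ev] at h
  have hne : ∀ᶠ p in 𝓝 x, f p ≠ 0 := hf.smooth.self_of_nhds.continuousAt.eventually_ne h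
  have hs : ∀ᶠ p in 𝓝 x, ContMDiffAt I 𝓘(ℝ, ℝ) ∞ (fun q => (f q)⁻¹) p := by
    filter_upwards [hne, hf.smooth] with p h1 h2 using h2.inv₀ h1
  obtain ⟨b, hb⟩ := exists_germ hs
  refine IsUnit.of_mul_eq_one b ((hf.mul hb).eq_of_eventuallyEq Rep.one ?_)
  filter_upwards [hne] with p hp using mul_inv_cancel₀ hp

variable [IsManifold I ∞ N]

/-- `X` represents the derivation `D` of the algebra of germs. -/
structure RepDer (X : ∀ p : N, TangentSpace I p)
    (D : Derivation ℝ (FnGerm I x) (FnGerm I x)) : Prop where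
  smooth : ∀ᶠ p in 𝓝 x, SmoothFieldAt X p
  rep : ∀ {f a}, Rep f a → Rep (along X f) (D a)

variable {X Y : ∀ p : N, TangentSpace I p}

theorem exists_rep_along (hX : ∀ᶠ p in 𝓝 x, SmoothFieldAt X p) (a : FnGerm I x) :
    ∃ b : FnGerm I x, ∀ f, Rep f a → Rep (along X f) b := by
  obtain ⟨f, hf⟩ := exists_rep a
  have hs : ∀ᶠ p in 𝓝 x, ContMDiffAt I 𝓘(ℝ, ℝ) ∞ (along X f) p := by
    filter_upwards [hX, hf.smooth] with p h1 h2 using contMDiffAt_along h2 h1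
  obtain ⟨b, hb⟩ := exists_germ hs
  refine ⟨b, fun g hg => hb.congr ?_⟩
  filter_upwards [(hf.eventuallyEq hg).eventuallyEq_nhds] with p hp using along_congr hp

theorem exists_repDer (hX : ∀ᶠ p in 𝓝 x, SmoothFieldAt X p) :
    ∃ D : Derivation ℝ (FnGerm I x) (FnGerm I x), RepDer X D := by
  choose D hD using exists_rep_along (x := x) hX
  have hadd (a b) : D (a + b) = D a + D b := by
    obtain ⟨f, hf⟩ := exists_rep a
    obtain ⟨g, hg⟩ := exists_rep b
    refine (hD _ _ (hf.add hg)).eq_of_eventuallyEq ((hD _ _ hf).add (hD _ _ hg)) ?_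
    filter_upwards [hf.smooth, hg.smooth] with p h1 h2 using along_add h1 h2
  have hmul (a b) : D (a * b) = a * D b + b * D a := by
    obtain ⟨f, hf⟩ := exists_rep a
    obtain ⟨g, hg⟩ := exists_rep b
    refine (hD _ _ (hf.mul hg)).eq_of_eventuallyEq
      ((hf.mul (hD _ _ hg)).add (hg.mul (hD _ _ hf))) ?_
    filter_upwards [hf.smooth, hg.smooth] with p h1 h2 using along_mul h1 h2
  have hconst (r : ℝ) : D (algebraMap ℝ _ r) = 0 :=
    (hD _ _ (Rep.const r)).eq_of_eventuallyEq Rep.zero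
      (.of_forall fun p => along_const X r p)
  refine ⟨Derivation.mk' ⟨⟨D, hadd⟩, fun r a => ?_⟩ hmul, hX, fun h => hD _ _ h⟩
  simp only [Algebra.smul_def, hmul, hconst, mul_zero, add_zero, RingHom.id_apply]

theorem exists_rep_chart (l : E →L[ℝ] ℝ) :
    ∃ a : FnGerm I x, Rep (fun p => l (extChartAt I x p)) a := by
  apply exists_germ
  filter_upwards [extChartAt_source_mem_nhds (I := I) x] with p hp
  rw [extChartAt_source] at hp
  exact l.contMDiff.contMDiffAt.comp p (contMDiffAt_extChartAt' hp)

variable [CompleteSpace E]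

variable (I x) in
/-- The Lie–Rinehart algebra of germs at `x` of smooth vector fields. -/
def fieldAlgebra :
    LieRinehartSubalgebra (FnGerm I x) (Derivation ℝ (FnGerm I x) (FnGerm I x)) where
  carrier := {D | ∃ X : ∀ p : N, TangentSpace I p, RepDer X D}
  add_mem' := by
    rintro D D' ⟨X, hX⟩ ⟨Y, hY⟩
    refine ⟨X + Y, ?_, fun h => ?_⟩
    · filter_upwards [hX.smooth, hY.smooth] with p h1 h2 using h1.add h2
    · rw [along_add_field]
      exact (hX.rep h).add (hY.rep h)
  zero_mem' := by
    obtain ⟨D, hD⟩ := exists_repDer (I := I) (x := x) (X := (0 : N → ℝ) • coordField I x 0) (by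
      filter_upwards [extChartAt_source_mem_nhds (I := I) x] with p hp
      exact .smul contMDiffAt_const (smoothFieldAt_coordField hp 0))
    refine ⟨_, hD.smooth, fun h => ?_⟩
    rw [along_smul_field, zero_mul]
    exact Rep.zero
  smul_mem' := by
    rintro a D ⟨X, hX⟩
    obtain ⟨g, hg⟩ := exists_rep a
    refine ⟨g • X, ?_, fun h => ?_⟩
    · filter_upwards [hX.smooth, hg.smooth] with p h1 h2 using h1.smul h2
    · rw [along_smul_field]
      exact hg.mul (hX.rep h)
  lie_mem' := by
    rintro D D' ⟨X, hX⟩ ⟨Y, hY⟩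
    refine ⟨VectorField.mlieBracket I X Y, ?_, fun {f a} h => ?_⟩
    · filter_upwards [hX.smooth, hY.smooth] with p h1 h2 using smoothFieldAt_mlieBracket h1 h2
    · rw [Derivation.commutator_apply]
      -- The commutator of the derivations is represented by the Lie bracket of the fields.
      refine ((hX.rep (hY.rep h)).sub (hY.rep (hX.rep h))).congr ?_
      filter_upwards [hX.smooth, hY.smooth, h.smooth.eventually_nhds] with p h1 h2 h3
      exact (along_mlieBracket h3 h1 h2).symm

variable (I x) in
/-- Germs at `x` of smooth vector fields. -/
def FieldGerm : Type _ := fieldAlgebra I x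

instance : LieRing (FieldGerm I x) := inferInstanceAs (LieRing (fieldAlgebra I x))

instance : Module (FnGerm I x) (FieldGerm I x) :=
  inferInstanceAs (Module (FnGerm I x) (fieldAlgebra I x))

instance : LieRingModule (FieldGerm I x) (FnGerm I x) :=
  inferInstanceAs (LieRingModule (fieldAlgebra I x) (FnGerm I x))

instance : LieRinehartRing (FnGerm I x) (FieldGerm I x) :=
  inferInstanceAs (LieRinehartRing (FnGerm I x) (fieldAlgebra I x))

instance : LieAlgebra ℝ (FieldGerm I x) := inferInstanceAs (LieAlgebra ℝ (fieldAlgebra I x))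

instance : LieRinehartAlgebra ℝ (FnGerm I x) (FieldGerm I x) :=
  inferInstanceAs (LieRinehartAlgebra ℝ (FnGerm I x) (fieldAlgebra I x))

/-- `X` represents the germ `D` of vector fields. -/
structure RepV (X : ∀ p : N, TangentSpace I p) (D : FieldGerm I x) : Prop where
  smooth : ∀ᶠ p in 𝓝 x, SmoothFieldAt X p
  act : ∀ {f : N → ℝ} {a : FnGerm I x}, Rep f a → Rep (along X f) ⁅D, a⁆

theorem exists_repV (D : FieldGerm I x) : ∃ X, RepV X D := by
  obtain ⟨D, X, hX⟩ := D
  exact ⟨X, hX.smooth, hX.rep⟩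

theorem exists_fieldGerm (hX : ∀ᶠ p in 𝓝 x, SmoothFieldAt X p) :
    ∃ D : FieldGerm I x, RepV X D := by
  obtain ⟨D, hD⟩ := exists_repDer hX
  exact ⟨⟨D, X, hD⟩, hD.smooth, hD.rep⟩

variable {D D' : FieldGerm I x}

theorem FieldGerm.ext (h : ∀ a : FnGerm I x, ⁅D, a⁆ = ⁅D', a⁆) : D = D' :=
  Subtype.ext (Derivation.ext h)

theorem RepV.eq_of_eventuallyEq (hX : RepV X D) (hY : RepV Y D') (h : X =ᶠ[𝓝 x] Y) : D = D' := by
  refine FieldGerm.ext fun a => ?_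
  obtain ⟨f, hf⟩ := exists_rep a
  refine (hX.act hf).eq_of_eventuallyEq (hY.act hf) ?_
  filter_upwards [h] with p hp using along_congr_field f hp

theorem RepV.congr (hX : RepV X D) (h : X =ᶠ[𝓝 x] Y) : RepV Y D := by
  refine ⟨?_, fun hf => (hX.act hf).congr ?_⟩
  · filter_upwards [hX.smooth, h.eventuallyEq_nhds] with p h1 h2
    refine ContMDiffAt.congr_of_eventuallyEq h1 ?_
    filter_upwards [h2] with q hq
    rw [hq]
  · filter_upwards [h] with p hp using along_congr_field _ hp

theorem RepV.add (hX : RepV X D) (hY : RepV Y D') : RepV (X + Y) (D + D') := by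
  refine ⟨?_, fun h => ?_⟩
  · filter_upwards [hX.smooth, hY.smooth] with p h1 h2 using h1.add h2
  · rw [along_add_field, add_lie]
    exact (hX.act h).add (hY.act h)

theorem RepV.smul (hg : Rep g a) (hX : RepV X D) : RepV (g • X) (a • D) := by
  refine ⟨?_, fun h => ?_⟩
  · filter_upwards [hX.smooth, hg.smooth] with p h1 h2 using h1.smul h2
  · rw [along_smul_field]
    exact hg.mul (hX.act h)

theorem RepV.real_smul (r : ℝ) (hX : RepV X D) : RepV (r • X) (r • D) := by
  rw [← algebraMap_smul (FnGerm I x) r D]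
  exact .smul (Rep.const r) hX

theorem RepV.sub (hX : RepV X D) (hY : RepV Y D') : RepV (X - Y) (D - D') := by
  have h1 : X - Y = X + (-1 : ℝ) • Y := by module
  have h2 : D - D' = D + (-1 : ℝ) • D' := by module
  rw [h1, h2]
  exact hX.add (hY.real_smul _)

theorem RepV.zero : RepV (0 : ∀ p : N, TangentSpace I p) (0 : FieldGerm I x) := by
  obtain ⟨X, hX⟩ := exists_repV (0 : FieldGerm I x)
  have h := hX.sub hX
  rwa [sub_self, sub_self] at h

theorem RepV.sum {ι : Type*} (s : Finset ι) {X : ι → ∀ p : N, TangentSpace I p}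
    {D : ι → FieldGerm I x} (h : ∀ i, RepV (X i) (D i)) :
    RepV (∑ i ∈ s, X i) (∑ i ∈ s, D i) := by
  classical
  induction s using Finset.induction_on with
  | empty => simpa using RepV.zero
  | insert i s hi ih =>
    rw [Finset.sum_insert hi, Finset.sum_insert hi]
    exact (h i).add ih

theorem RepV.lie (hX : RepV X D) (hY : RepV Y D') : RepV (VectorField.mlieBracket I X Y) ⁅D, D'⁆ := by
  refine ⟨?_, fun h => ?_⟩
  · filter_upwards [hX.smooth, hY.smooth] with p h1 h2 using smoothFieldAt_mlieBracket h1 h2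
  · rw [lie_lie]
    refine ((hX.act (hY.act h)).sub (hY.act (hX.act h))).congr ?_
    filter_upwards [hX.smooth, hY.smooth, h.smooth.eventually_nhds] with p h1 h2 h3
    exact (along_mlieBracket h3 h1 h2).symm

theorem exists_repV_coordField (v : E) : ∃ D : FieldGerm I x, RepV (coordField I x v) D :=
  exists_fieldGerm (by
    filter_upwards [extChartAt_source_mem_nhds (I := I) x] with p hp
    exact smoothFieldAt_coordField hp v)

end Germ
end Rapcsak

/-! ### The algebraic spray attached to a spray on M. -/

namespace Rapcsak

/-- The model space of `TM`. -/
abbrev ModelTM (n : ℕ) : Type := EuclideanSpace ℝ (Fin n) × EuclideanSpace ℝ (Fin n)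

/-- The base coordinate functions of the model of `TM`. -/
def xCoord {n : ℕ} (i : Fin n) : ModelTM n →L[ℝ] ℝ :=
  (EuclideanSpace.proj i).comp (ContinuousLinearMap.fst ℝ _ _)

/-- The fibre coordinate functions of the model of `TM`. -/
def yCoord {n : ℕ} (i : Fin n) : ModelTM n →L[ℝ] ℝ :=
  (EuclideanSpace.proj i).comp (ContinuousLinearMap.snd ℝ _ _)

/-- The base coordinate vectors of the model of `TM`. -/
def xVec {n : ℕ} (i : Fin n) : ModelTM n := (EuclideanSpace.single i 1, 0)

/-- The fibre coordinate vectors of the model of `TM`. -/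
def yVec {n : ℕ} (i : Fin n) : ModelTM n := (0, EuclideanSpace.single i 1)

theorem xCoord_apply {n : ℕ} (i : Fin n) (v : ModelTM n) : xCoord i v = v.1 i := rfl

theorem yCoord_apply {n : ℕ} (i : Fin n) (v : ModelTM n) : yCoord i v = v.2 i := rfl

theorem sum_coord {n : ℕ} (v : ModelTM n) :
    v = ∑ i, xCoord i v • xVec i + ∑ i, yCoord i v • yVec i := by
  refine Prod.ext ?_ ?_
  · ext j
    simp [xVec, yVec, xCoord_apply, Prod.fst_sum, Pi.single_apply]
  · ext j
    simp [xVec, yVec, yCoord_apply, Prod.snd_sum, Pi.single_apply]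

variable {n : ℕ} {M : Type*} [TopologicalSpace M] [ChartedSpace (EuclideanSpace ℝ (Fin n)) M]
  [IsManifold (𝓡 n) ∞ M] {x : TM n M}

/-- The derivative at `p` of the preferred chart at `x`. -/
def dchart (x p : TM n M) : TangentSpace (𝓡 n).tangent p →L[ℝ] ModelTM n :=
  mfderiv (𝓡 n).tangent 𝓘(ℝ, ModelTM n) (extChartAt (𝓡 n).tangent x) p

theorem coordField_sum {ι : Type*} (s : Finset ι) (c : ι → ℝ) (v : ι → ModelTM n) (p : TM n M) :
    coordField (𝓡 n).tangent x (∑ i ∈ s, c i • v i) p =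
      ∑ i ∈ s, c i • coordField (𝓡 n).tangent x (v i) p :=
  (map_sum (dchart x p).inverse _ _).trans
    (Finset.sum_congr rfl fun _ _ => map_smul (dchart x p).inverse _ _)

theorem coordField_add (v w : ModelTM n) (p : TM n M) :
    coordField (𝓡 n).tangent x (v + w) p =
      coordField (𝓡 n).tangent x v p + coordField (𝓡 n).tangent x w p :=
  map_add (dchart x p).inverse _ _

theorem eventually_mem_source : ∀ᶠ p in 𝓝 x, p ∈ (extChartAt (𝓡 n).tangent x).source :=
  extChartAt_source_mem_nhds x

theorem dchart_coordField {p : TM n M} (hp : p ∈ (extChartAt (𝓡 n).tangent x).source)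
    (v : ModelTM n) : dchart x p (coordField (𝓡 n).tangent x v p) = v :=
  mfderiv_extChartAt_coordField hp v

theorem along_chart {p : TM n M} (hp : p ∈ (extChartAt (𝓡 n).tangent x).source) (X : VF n M)
    (l : ModelTM n →L[ℝ] ℝ) :
    along X (fun q => l (extChartAt (𝓡 n).tangent x q)) p = l (dchart x p (X p)) :=
  along_clm_comp_extChartAt hp X l

theorem vector_eq_sum {p : TM n M} (hp : p ∈ (extChartAt (𝓡 n).tangent x).source)
    (w : TangentSpace (𝓡 n).tangent p) :
    w = ∑ i, xCoord i (dchart x p w) • coordField (𝓡 n).tangent x (xVec i) p +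
      ∑ i, yCoord i (dchart x p w) • coordField (𝓡 n).tangent x (yVec i) p := by
  rw [← coordField_sum, ← coordField_sum, ← coordField_add, ← sum_coord]
  exact field_eq_coordField hp w

variable (x) in
/-- The germ of a linear function of the chart coordinates. -/
def chartGerm (l : ModelTM n →L[ℝ] ℝ) : FnGerm (𝓡 n).tangent x :=
  Classical.choose (exists_rep_chart l)

theorem rep_chartGerm (l : ModelTM n →L[ℝ] ℝ) :
    Rep (fun p => l (extChartAt (𝓡 n).tangent x p)) (chartGerm x l) :=
  Classical.choose_spec (exists_rep_chart l)

variable (x) in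
/-- The germ of a coordinate field. -/
def coordGerm (v : ModelTM n) : FieldGerm (𝓡 n).tangent x :=
  Classical.choose (exists_repV_coordField v)

theorem repV_coordGerm (v : ModelTM n) :
    RepV (coordField (𝓡 n).tangent x v) (coordGerm x v) :=
  Classical.choose_spec (exists_repV_coordField v)

theorem coordGerm_chartGerm (v : ModelTM n) (l : ModelTM n →L[ℝ] ℝ) :
    ⁅coordGerm x v, chartGerm x l⁆ = algebraMap ℝ _ (l v) := by
  refine ((repV_coordGerm v).act (rep_chartGerm l)).eq_of_eventuallyEq (.const _) ?_
  filter_upwards [eventually_mem_source] with p hp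
  rw [along_chart hp, dchart_coordField hp]

theorem fieldGerm_eq_sum (D : FieldGerm (𝓡 n).tangent x) :
    D = ∑ i, ⁅D, chartGerm x (xCoord i)⁆ • coordGerm x (xVec i) +
      ∑ i, ⁅D, chartGerm x (yCoord i)⁆ • coordGerm x (yVec i) := by
  obtain ⟨X, hX⟩ := exists_repV D
  refine hX.eq_of_eventuallyEq ((RepV.sum _ fun i => .smul (hX.act (rep_chartGerm (xCoord i)))
    (repV_coordGerm (xVec i))).add (RepV.sum _ fun i => .smul (hX.act (rep_chartGerm (yCoord i)))
    (repV_coordGerm (yVec i)))) ?_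
  filter_upwards [eventually_mem_source] with p hp
  simp only [Pi.add_apply, Finset.sum_apply, Pi.smul_apply', along_chart hp]
  exact vector_eq_sum hp (X p)

theorem repV_J {X : VF n M} {D : FieldGerm (𝓡 n).tangent x} (hX : RepV X D) :
    RepV (J X) (∑ i, ⁅D, chartGerm x (xCoord i)⁆ • coordGerm x (yVec i)) := by
  refine (RepV.sum _ fun i => .smul (hX.act (rep_chartGerm (xCoord i)))
    (repV_coordGerm (yVec i))).congr ?_
  filter_upwards [eventually_mem_source] with p hp
  simp only [Finset.sum_apply, Pi.smul_apply', along_chart hp]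
  rw [vector_eq_sum hp (J X p)]
  have h : dchart x p (J X p) = (0, (dchart x p (X p)).1) := mfderiv_extChartAt_J hp X
  simp [h, xCoord_apply, yCoord_apply]
  rfl

theorem repV_liouville :
    RepV (liouville : VF n M) (∑ i, chartGerm x (yCoord i) • coordGerm x (yVec i)) := by
  refine (RepV.sum _ fun i => .smul (rep_chartGerm (yCoord i))
    (repV_coordGerm (yVec i))).congr ?_
  filter_upwards [eventually_mem_source] with p hp
  simp only [Finset.sum_apply, Pi.smul_apply']
  rw [vector_eq_sum hp (liouville p)]
  have h : dchart x p (liouville p) = (0, (extChartAt (𝓡 n).tangent x p).2) :=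
    mfderiv_extChartAt_liouville hp
  simp [h, xCoord_apply, yCoord_apply]
  rfl

theorem IsSpray.smoothNear {S : VF n M} (hS : IsSpray S) (hx : x ∈ slashed n M) :
    ∀ᶠ p in 𝓝 x, SmoothFieldAt S p :=
  smoothFieldNear_iff.1 ⟨_, slashed_mem_nhds hx, hS.smooth⟩

theorem coordGerm_xVec_xCoord (i j : Fin n) :
    ⁅coordGerm x (xVec i), chartGerm x (xCoord j)⁆ = if i = j then 1 else 0 := by
  rw [coordGerm_chartGerm, xCoord_apply, xVec, PiLp.single_apply, apply_ite (algebraMap ℝ _),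
    map_one, map_zero]
  simp only [eq_comm]

theorem coordGerm_xVec_yCoord (i j : Fin n) :
    ⁅coordGerm x (xVec i), chartGerm x (yCoord j)⁆ = 0 := by
  rw [coordGerm_chartGerm, yCoord_apply, xVec, PiLp.zero_apply, map_zero]

theorem coordGerm_yVec_xCoord (i j : Fin n) :
    ⁅coordGerm x (yVec i), chartGerm x (xCoord j)⁆ = 0 := by
  rw [coordGerm_chartGerm, xCoord_apply, yVec, PiLp.zero_apply, map_zero]

theorem coordGerm_yVec_yCoord (i j : Fin n) :
    ⁅coordGerm x (yVec i), chartGerm x (yCoord j)⁆ = if i = j then 1 else 0 := by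
  rw [coordGerm_chartGerm, yCoord_apply, yVec, PiLp.single_apply, apply_ite (algebraMap ℝ _),
    map_one, map_zero]
  simp only [eq_comm]

section Spray

variable {S : VF n M} (hS : IsSpray S) (hx : x ∈ slashed n M)

/-- The germ of a spray as a vector field. -/
def IsSpray.germ : FieldGerm (𝓡 n).tangent x :=
  Classical.choose (exists_fieldGerm (hS.smoothNear hx))

theorem IsSpray.repV_germ : RepV S (hS.germ hx) :=
  Classical.choose_spec (exists_fieldGerm (hS.smoothNear hx))

/-- In the chart, JS = C says that the base components of `S` are the fibre coordinates. -/
theorem IsSpray.germ_xCoord (i : Fin n) :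
    ⁅hS.germ hx, chartGerm x (xCoord i)⁆ = chartGerm x (yCoord i) := by
  refine ((hS.repV_germ hx).act (rep_chartGerm (xCoord i))).eq_of_eventuallyEq
    (rep_chartGerm (yCoord i)) ?_
  filter_upwards [eventually_mem_source, slashed_mem_nhds hx] with p hp hp'
  rw [along_chart hp]
  have h1 : dchart x p (J S p) = (0, (dchart x p (S p)).1) := mfderiv_extChartAt_J hp S
  have h2 : dchart x p (liouville p) = (0, (extChartAt (𝓡 n).tangent x p).2) :=
    mfderiv_extChartAt_liouville hp
  rw [hS.second_order p hp', h2] at h1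
  exact congrArg (fun v : EuclideanSpace ℝ (Fin n) => v i) (congrArg Prod.snd h1).symm

theorem IsSpray.lie_liouville_germ :
    ⁅∑ i, chartGerm x (yCoord i) • coordGerm x (yVec i), hS.germ hx⁆ = hS.germ hx := by
  refine (repV_liouville.lie (hS.repV_germ hx)).eq_of_eventuallyEq (hS.repV_germ hx) ?_
  filter_upwards [slashed_mem_nhds hx] with p hp using hS.homogeneous p hp

/-- The spray, with the chart coordinates, in the algebra of germs. -/
def IsSpray.sprayGerm :
    SprayGerm (Fin n) (FnGerm (𝓡 n).tangent x) (FieldGerm (𝓡 n).tangent x) where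
  x i := chartGerm x (xCoord i)
  y i := chartGerm x (yCoord i)
  px i := coordGerm x (xVec i)
  py i := coordGerm x (yVec i)
  px_x := coordGerm_xVec_xCoord
  px_y := coordGerm_xVec_yCoord
  py_x := coordGerm_yVec_xCoord
  py_y := coordGerm_yVec_yCoord
  decomp := fieldGerm_eq_sum
  S := hS.germ hx
  S_x := hS.germ_xCoord hx
  homogeneous := hS.lie_liouville_germ hx
  ev := evGerm (𝓡 n).tangent x
  isUnit_of_ev _ := isUnit_of_evGerm_ne_zero

end Spray

end Rapcsak

/-! ### Dictionary between fields near x and their germs. -/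

namespace Rapcsak

variable {n : ℕ} {M : Type*} [TopologicalSpace M] [ChartedSpace (EuclideanSpace ℝ (Fin n)) M]
  [IsManifold (𝓡 n) ∞ M] {x : TM n M} {S : VF n M}

/-- The algebraic spray `T` is the germ at `x` of the spray `S`. -/
structure Models (S : VF n M)
    (T : SprayGerm (Fin n) (FnGerm (𝓡 n).tangent x) (FieldGerm (𝓡 n).tangent x)) : Prop where
  spray : RepV S T.S
  liouville : RepV liouville T.C
  J : ∀ {X : VF n M} {D : FieldGerm (𝓡 n).tangent x}, RepV X D → RepV (J X) (T.J D)
  ev : T.ev = evGerm (𝓡 n).tangent x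

theorem IsSpray.models (hS : IsSpray S) (hx : x ∈ slashed n M) : Models S (hS.sprayGerm hx) where
  spray := hS.repV_germ hx
  liouville := repV_liouville
  J h := repV_J h
  ev := rfl

namespace Models

variable {T : SprayGerm (Fin n) (FnGerm (𝓡 n).tangent x) (FieldGerm (𝓡 n).tangent x)}
  {X Y Z : VF n M} {D D' D'' : FieldGerm (𝓡 n).tangent x} {F f : TM n M → ℝ}
  {a b : FnGerm (𝓡 n).tangent x}

theorem conn (h : Models S T) (hX : RepV X D) : RepV (conn S X) (T.conn D) :=
  ((h.J hX).lie h.spray).sub (h.J (hX.lie h.spray))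

theorem hor (h : Models S T) (hX : RepV X D) : RepV (hor S X) (T.hor D) :=
  (hX.add (h.conn hX)).real_smul _

theorem fnSelf {K : VF n M → VF n M}
    {K' : FieldGerm (𝓡 n).tangent x →ₗ[FnGerm (𝓡 n).tangent x] FieldGerm (𝓡 n).tangent x}
    (hK : ∀ {X D}, RepV X D → RepV (K X) (K' D)) (hX : RepV X D) (hY : RepV Y D') :
    RepV (fnSelf K X Y) (fnSq K' D D') :=
  ((((hK hX).lie (hK hY)).add (hK (hK (hX.lie hY)))).sub (hK ((hK hX).lie hY))).sub
    (hK (hX.lie (hK hY))) |>.real_smul _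

theorem curv (h : Models S T) (hX : RepV X D) (hY : RepV Y D') :
    RepV (curv S X Y) (T.curv D D') :=
  (fnSelf h.hor hX hY).real_smul _

theorem jacobi (h : Models S T) (hX : RepV X D) : RepV (jacobi S X) (T.jacobi D) :=
  h.curv h.spray hX

theorem Om (h : Models S T) (hF : Rep F a) (hX : RepV X D) (hY : RepV Y D') :
    Rep (Om F X Y) (T.Om a D D') :=
  ((hX.act ((h.J hY).act hF)).sub (hY.act ((h.J hX).act hF))).sub ((h.J (hX.lie hY)).act hF)

theorem ins1 (h : Models S T) {K : VF n M → VF n M}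
    {K' : FieldGerm (𝓡 n).tangent x →ₗ[FnGerm (𝓡 n).tangent x] FieldGerm (𝓡 n).tangent x}
    (hK : ∀ {X D}, RepV X D → RepV (K X) (K' D)) (hF : Rep F a) (hX : RepV X D)
    (hY : RepV Y D') : Rep (ins1 F K X Y) (T.ins1 a K' D D') :=
  (h.Om hF (hK hX) hY).add (h.Om hF hX (hK hY))

theorem ins2 (h : Models S T) {R : VF n M → VF n M → VF n M}
    {R' : FieldGerm (𝓡 n).tangent x → FieldGerm (𝓡 n).tangent x → FieldGerm (𝓡 n).tangent x}
    (hR : ∀ {X Y D D'}, RepV X D → RepV Y D' → RepV (R X Y) (R' D D')) (hF : Rep F a)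
    (hX : RepV X D) (hY : RepV Y D') (hZ : RepV Z D'') :
    Rep (ins2 F R X Y Z) (T.ins2 a R' D D' D'') :=
  ((h.Om hF (hR hX hY) hZ).add (h.Om hF (hR hY hZ) hX)).add (h.Om hF (hR hZ hX) hY)

theorem cyc (h : Models S T) (hF : Rep F a) (hX : RepV X D) (hY : RepV Y D')
    (hZ : RepV Z D'') : Rep (cyc F X Y Z) (T.cyc a D D' D'') :=
  ((h.Om hF (hX.lie hY) hZ).add (h.Om hF (hY.lie hZ) hX)).add (h.Om hF (hZ.lie hX) hY)

theorem ev_rep (h : Models S T) (hf : Rep f a) : T.ev a = f x := by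
  rw [h.ev, hf.ev]

theorem jet_of_coordGerm {k : ℕ} (h : ∀ v, T.Jet k ⁅coordGerm x v, a⁆)
    (D : FieldGerm (𝓡 n).tangent x) : T.Jet k ⁅D, a⁆ := by
  rw [fieldGerm_eq_sum D, add_lie, sum_lie, sum_lie]
  simp only [smul_act]
  exact (SprayGerm.Jet.sum _ fun i _ => (h _).mul_left _).add
    (SprayGerm.Jet.sum _ fun i _ => (h _).mul_left _)

/-- By induction on the order: partial derivatives in the chart are derivatives along coordinate
fields, and these generate all field germs over functions. -/
theorem jetVanishes_iff (h : Models S T) {k : ℕ} (hf : Rep f a) :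
    JetVanishes k f x ↔ T.Jet k a := by
  induction k generalizing f a with
  | zero =>
    simp only [JetVanishes, SprayGerm.Jet, h.ev_rep hf, Nat.le_zero, forall_eq]
    rw [← norm_eq_zero, norm_iteratedFDeriv_zero, norm_eq_zero, Function.comp_apply,
      extChartAt_to_inv]
  | succ k ih =>
    have hcd := contDiffAt_comp_extChartAt_symm hf.smooth.self_of_nhds
    refine (jet_succ_iff hcd k).trans ?_
    rw [Function.comp_apply, extChartAt_to_inv, ← h.ev_rep hf]
    refine and_congr_right fun _ => ?_
    have hv (v : ModelTM n) : (∀ j ≤ k, iteratedFDeriv ℝ j (fun u =>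
        fderiv ℝ (f ∘ (extChartAt (𝓡 n).tangent x).symm) u v) (extChartAt (𝓡 n).tangent x x) = 0) ↔
        T.Jet k ⁅coordGerm x v, a⁆ := by
      rw [← ih ((repV_coordGerm v).act hf), JetVanishes]
      refine forall₂_congr fun j _ => ?_
      rw [((along_coordField_comp_symm hf.smooth v).iteratedFDeriv ℝ j).eq_of_nhds]
    exact (forall_congr' hv).trans ⟨fun h' => jet_of_coordGerm h', fun h' v => h' _⟩

end Models

end Rapcsak

namespace Rapcsak

variable {n : ℕ} {M : Type*} [TopologicalSpace M] [ChartedSpace (EuclideanSpace ℝ (Fin n)) M]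
  [IsManifold (𝓡 n) ∞ M] {x : TM n M} {S : VF n M}

namespace Models

variable {T : SprayGerm (Fin n) (FnGerm (𝓡 n).tangent x) (FieldGerm (𝓡 n).tangent x)}
  {X Y : VF n M} {D D' : FieldGerm (𝓡 n).tangent x} {F lam : TM n M → ℝ}
  {a b : FnGerm (𝓡 n).tangent x}

theorem isFormalSolution_iff (h : Models S T) (hF : Rep F a) (l : ℕ) :
    IsFormalSolution S l F x ↔ T.Sol l a := by
  constructor
  · rintro ⟨h1, h2, h3⟩
    refine ⟨(h.jetVanishes_iff ((h.liouville.act hF).sub hF)).1 h1, fun D D' => ?_, fun D D' => ?_⟩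
    all_goals
      obtain ⟨X, hX⟩ := exists_repV D
      obtain ⟨Y, hY⟩ := exists_repV D'
    · exact (h.jetVanishes_iff (h.ins1 h.conn hF hX hY)).1
        (h2 X Y (smoothFieldNear_iff.2 hX.smooth) (smoothFieldNear_iff.2 hY.smooth))
    · exact (h.jetVanishes_iff (h.ins1 h.jacobi hF hX hY)).1
        (h3 X Y (smoothFieldNear_iff.2 hX.smooth) (smoothFieldNear_iff.2 hY.smooth))
  · rintro ⟨h1, h2, h3⟩
    refine ⟨(h.jetVanishes_iff ((h.liouville.act hF).sub hF)).2 h1, fun X Y hX hY => ?_,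
      fun X Y hX hY => ?_⟩
    all_goals
      obtain ⟨D, hX⟩ := exists_fieldGerm (smoothFieldNear_iff.1 hX)
      obtain ⟨D', hY⟩ := exists_fieldGerm (smoothFieldNear_iff.1 hY)
    · exact (h.jetVanishes_iff (h.ins1 h.conn hF hX hY)).2 (h2 D D')
    · exact (h.jetVanishes_iff (h.ins1 h.jacobi hF hX hY)).2 (h3 D D')

theorem prolongedFirstCondition_iff (h : Models S T) (hF : Rep F a) {e : Fin n → VF n M}
    {E : Fin n → FieldGerm (𝓡 n).tangent x} (he : ∀ i, RepV (e i) (E i)) :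
    ProlongedFirstCondition S e F x ↔ T.Compat E a := by
  constructor
  · rintro ⟨h1, h2, h3⟩
    refine ⟨fun D D' D'' => ?_, fun D D' D'' => ?_, fun i j k hij hjk hik =>
      (h.jetVanishes_iff (h.cyc hF (h.J (he i)) (he j) (he k))).1 (h3 i j k hij hjk hik)⟩
    all_goals
      obtain ⟨X, hX⟩ := exists_repV D
      obtain ⟨Y, hY⟩ := exists_repV D'
      obtain ⟨Z, hZ⟩ := exists_repV D''
    · exact (h.jetVanishes_iff (h.ins2 h.curv hF hX hY hZ)).1 (h1 X Y Z
        (smoothFieldNear_iff.2 hX.smooth) (smoothFieldNear_iff.2 hY.smooth)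
        (smoothFieldNear_iff.2 hZ.smooth))
    · exact (h.jetVanishes_iff (h.ins2 (fnSelf h.jacobi) hF hX hY hZ)).1 (h2 X Y Z
        (smoothFieldNear_iff.2 hX.smooth) (smoothFieldNear_iff.2 hY.smooth)
        (smoothFieldNear_iff.2 hZ.smooth))
  · rintro ⟨h1, h2, h3⟩
    refine ⟨fun X Y Z hX hY hZ => ?_, fun X Y Z hX hY hZ => ?_, fun i j k hij hjk hik =>
      (h.jetVanishes_iff (h.cyc hF (h.J (he i)) (he j) (he k))).2 (h3 i j k hij hjk hik)⟩
    all_goals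
      obtain ⟨D, hX⟩ := exists_fieldGerm (smoothFieldNear_iff.1 hX)
      obtain ⟨D', hY⟩ := exists_fieldGerm (smoothFieldNear_iff.1 hY)
      obtain ⟨D'', hZ⟩ := exists_fieldGerm (smoothFieldNear_iff.1 hZ)
    · exact (h.jetVanishes_iff (h.ins2 h.curv hF hX hY hZ)).2 (h1 D D' D'')
    · exact (h.jetVanishes_iff (h.ins2 (fnSelf h.jacobi) hF hX hY hZ)).2 (h2 D D' D'')

theorem thirdOrderIdentity_iff (h : Models S T) (hF : Rep F a) (hX : RepV X D)
    (hY : RepV Y D') : ThirdOrderIdentity S F X Y x ↔ T.ThirdOrder a D D' := by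
  have hJX := h.J hX
  have hJY := h.J hY
  have hHX := h.hor hX
  have hHY := h.hor hY
  have hPX := h.jacobi hX
  have hPY := h.jacobi hY
  have h1 := h.ev_rep ((hHX.lie hPX).act (h.Om hF hJY hY))
  have h2 := h.ev_rep ((hHY.lie hPY).act (h.Om hF hX hJX))
  have h3 := h.ev_rep (hPX.act (h.cyc hF hJY hHX hHY))
  have h4 := h.ev_rep (hHX.act ((h.cyc hF hJY hPX hHY).sub (h.cyc hF hJY hPY hX)))
  have h5 := h.ev_rep (hPY.act (h.cyc hF hJX hHX hHY))
  have h6 := h.ev_rep (hHY.act ((h.cyc hF hJX hPX hY).sub (h.cyc hF hJX hPY hX)))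
  exact (Iff.of_eq (congrArg₂ (· = ·) (congrArg₂ (· - ·) h1 h2) (congrArg₂ (· + ·)
    (congrArg₂ (· - ·) (congrArg₂ (· - ·) h3 h4) h5) h6))).symm

theorem eig (h : Models S T) (hX : RepV X D) (hl : Rep lam a) (he : IsEigenfield S x lam X) :
    T.Eig a D :=
  ⟨(h.hor hX).eq_of_eventuallyEq hX he.horizontal,
    (h.jacobi hX).eq_of_eventuallyEq (.smul hl (h.J hX)) he.eigen⟩

theorem exists_ev_lie_ne_zero (h : Models S T) (hX : RepV X D) (hne : X x ≠ 0) :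
    ∃ f, T.ev ⁅D, f⁆ ≠ 0 := by
  by_contra! hc
  apply hne
  have hsrc := mem_extChartAt_source (I := (𝓡 n).tangent) x
  have hl (l : ModelTM n →L[ℝ] ℝ) : l (dchart x x (X x)) = 0 := by
    rw [← along_chart hsrc, ← h.ev_rep (hX.act (rep_chartGerm l)), hc]
  rw [vector_eq_sum hsrc (X x)]
  simp only [hl, zero_smul, Finset.sum_const_zero, add_zero]

theorem eigenFrame (h : Models S T) {lam : Fin n → TM n M → ℝ} {e : Fin n → VF n M}
    (he : IsAdaptedFrame S x lam e) {E : Fin n → FieldGerm (𝓡 n).tangent x}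
    (hE : ∀ i, RepV (e i) (E i)) {L : Fin n → FnGerm (𝓡 n).tangent x}
    (hL : ∀ i, Rep (lam i) (L i)) : ∃ o, T.EigenFrame L E o := by
  obtain ⟨o, ho⟩ := he.spray
  refine ⟨o, fun i => h.eig (hE i) (hL i) (he.eigenfield i), fun i j hij => ?_,
    fun i => h.exists_ev_lie_ne_zero (hE i) (he.ne_zero i),
    (hE o).eq_of_eventuallyEq h.spray ho⟩
  rw [h.ev_rep (hL i), h.ev_rep (hL j)]
  exact he.distinct i j hij

end Models

end Rapcsak

end

/-! ### The lifting criterion. -/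

open Rapcsak in
theorem mainTheorem5 {n : ℕ} {M : Type*} [TopologicalSpace M]
    [ChartedSpace (EuclideanSpace ℝ (Fin n)) M] [IsManifold (𝓡 n) ∞ M]
    (S : Rapcsak.VF n M) (hS : Rapcsak.IsSpray S)
    (x : Rapcsak.TM n M) (hx : x ∈ Rapcsak.slashed n M)
    (lam : Fin n → Rapcsak.TM n M → ℝ) (e : Fin n → Rapcsak.VF n M)
    (he : Rapcsak.IsAdaptedFrame S x lam e)
    (F : Rapcsak.TM n M → ℝ) (hF : Rapcsak.SmoothNear F x)
    (hsol : Rapcsak.IsFormalSolution S 1 F x) :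
    (∃ G : Rapcsak.TM n M → ℝ, Rapcsak.SmoothNear G x ∧ Rapcsak.SameJet 3 G F x ∧
        Rapcsak.IsFormalSolution S 2 G x) ↔
      Rapcsak.ProlongedFirstCondition S e F x ∧
        ∀ (X Y : Rapcsak.VF n M) (lX lY : Rapcsak.TM n M → ℝ),
          Rapcsak.IsEigenfield S x lX X → Rapcsak.IsEigenfield S x lY Y → lX x ≠ lY x →
            Rapcsak.ThirdOrderIdentity S F X Y x := by
  have h := hS.models hx
  obtain ⟨a, ha⟩ := exists_germ (smoothNear_iff.1 hF)
  choose E hE using fun i => exists_fieldGerm (smoothFieldNear_iff.1 (he.eigenfield i).smooth)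
  choose L hL using fun i => exists_germ (smoothNear_iff.1 (he.eigenfield i).smooth_eigenfunction)
  obtain ⟨o, hfr⟩ := h.eigenFrame he hE hL
  rw [h.prolongedFirstCondition_iff ha hE]
  constructor
  · rintro ⟨G, hG, hjet, hGsol⟩
    obtain ⟨g, hg⟩ := exists_germ (smoothNear_iff.1 hG)
    have hjet' := (h.jetVanishes_iff (hg.sub ha)).1 hjet
    have hsol' := (h.isFormalSolution_iff hg 2).1 hGsol
    refine ⟨SprayGerm.compat_congr hjet' (hsol'.compat hfr.eig hfr.distinct),
      fun X Y lX lY hX hY hne => ?_⟩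
    obtain ⟨D, hD⟩ := exists_fieldGerm (smoothFieldNear_iff.1 hX.smooth)
    obtain ⟨D', hD'⟩ := exists_fieldGerm (smoothFieldNear_iff.1 hY.smooth)
    obtain ⟨r, hr⟩ := exists_germ (smoothNear_iff.1 hX.smooth_eigenfunction)
    obtain ⟨s, hs⟩ := exists_germ (smoothNear_iff.1 hY.smooth_eigenfunction)
    rw [h.thirdOrderIdentity_iff ha hD hD']
    refine SprayGerm.thirdOrder_congr hjet' _ _
      (hsol'.thirdOrder (h.eig hD hr hX) (h.eig hD' hs hY) ?_)
    rwa [h.ev_rep hr, h.ev_rep hs]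
  · rintro ⟨hc, ht⟩
    -- The third-order identity is needed only for pairs of frame fields.
    obtain ⟨g, hjet, hgsol⟩ := hfr.exists_lift ((h.isFormalSolution_iff ha 1).1 hsol) hc
      fun i j hij => (h.thirdOrderIdentity_iff ha (hE i) (hE j)).1
        (ht _ _ _ _ (he.eigenfield i) (he.eigenfield j) (he.distinct i j hij))
    obtain ⟨G, hG⟩ := exists_rep g
    exact ⟨G, smoothNear_iff.2 hG.smooth, (h.jetVanishes_iff (hG.sub ha)).2 hjet,
      (h.isFormalSolution_iff hG 2).2 hgsol⟩
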